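/- Let $M$ be a smooth manifold (finite-dimensional, Hausdorff, second countable, without boundary), $\Omega^*(M)$ the algebra of smooth complex-valued differential forms, and $u$ a formal variable (of degree $-2$). A descent datum for a gerbe $\mathcal L$ on $M$ consists of an open cover $(U_\alpha)$, complex line bundles $\mathcal L_{\alpha\beta}\to U_{\alpha\beta}=U_\alpha\cap U_\beta$ and isomorphisms $\mu_{\alpha\beta\gamma}:\mathcal L_{\alpha\beta}\otimes\mathcal L_{\beta\gamma}\to\mathcal L_{\alpha\gamma}$ over $U_{\alpha\beta\gamma}$ that are associative over $U_{\alpha\beta\gamma\delta}$. An $\mathcal L$-twisted bundle $\mathcal E$ is given on this datum by complex vector bundles $\mathcal E_\alpha\to U_\alpha$ of finite rank and isomorphisms $\varphi_{\alpha\beta}:\mathcal E_\alpha\otimes\mathcal L_{\alpha\beta}\to\mathcal E_\beta$ over $U_{\alpha\beta}$ with $\varphi_{\beta\gamma}\circ(\varphi_{\alpha\beta}\otimes\mathrm{id})=\varphi_{\alpha\gamma}\circ(\mathrm{id}\otimes\mu_{\alpha\beta\gamma})$. A connection $\nabla=(\nabla_\alpha,\nabla_{\alpha\beta},\omega_\alpha)$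 on $\mathcal E$ consists of connections $\nabla_{\alpha\beta}$ on $\mathcal L_{\alpha\beta}$ with $\mu_{\alpha\beta\gamma}^*\nabla_{\alpha\gamma}=\nabla_{\alpha\beta}\otimes\mathrm{id}+\mathrm{id}\otimes\nabla_{\beta\gamma}$, forms $\omega_\alpha\in\Omega^2(U_\alpha)$ with $\nabla_{\alpha\beta}^2=\omega_\alpha-\omega_\beta$ on $U_{\alpha\beta}$, and connections $\nabla_\alpha$ on $\mathcal E_\alpha$ with $\varphi_{\alpha\beta}^*\nabla_\beta=\nabla_\alpha\otimes\mathrm{id}+\mathrm{id}\otimes\nabla_{\alpha\beta}$. Such a connection has a curvature $3$-form $\varOmega$, given by $\varOmega|_{U_\alpha}=\frac{d\omega_\alpha}{2\pi i}$, and a form $\theta$ with values in $\operatorname{End}(\mathcal E)$, given by $\theta|_{U_\alpha}=\nabla_\alpha^2+\omega_\alpha$. Put $d_{\varOmega}=u\,d+u^2\varOmega\wedge\cdot$ on $\Omega^*(M)[u]$, let $H_{\varOmega}(M)$ be the cohomology of $(\Omega^*(M)[u],d_{\varOmega})$, and let $\operatorname{Ch}_{\mathcal L}(\nabla)=\operatorname{tr}e^{-u\theta/2\pi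 i}$, i.e. $\operatorname{Ch}_{\mathcal L}(\nabla)|_{U_\alpha}=\sum_k\frac{1}{k!}\left(\frac{-u}{2\pi i}\right)^k\operatorname{tr}\left((\nabla_\alpha^2+\omega_\alpha)^k\right)$. Then: 1. For every connection $\nabla$ on $\mathcal E$, $\varOmega$ is a well-defined smooth closed $3$-form on $M$, $(\Omega^*(M)[u],d_\varOmega)$ is a complex, $\operatorname{Ch}_{\mathcal L}(\nabla)$ is a well-defined element of $\Omega^*(M)[u]$, and $d_{\varOmega}\operatorname{Ch}_{\mathcal L}(\nabla)=0$. 2. Let $\nabla$, $\nabla'=(\nabla'_\alpha,\nabla'_{\alpha\beta},\omega'_\alpha)$ be two connections on $\mathcal E$, with curvature $3$-forms $\varOmega$, $\varOmega'$. Call $\eta$ a comparison form if there are $\delta_\alpha\in\Omega^1(U_\alpha)$ with $\nabla'_{\alpha\beta}-\nabla_{\alpha\beta}=\delta_\alpha-\delta_\beta$ on all $U_{\alpha\beta}$ and $\eta|_{U_\alpha}=\frac{1}{2\pi i}(\omega'_\alpha-\omega_\alpha-d\delta_\alpha)$ for all $\alpha$. Comparison forms exist, and each one is a smooth $2$-form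 on $M$ with $\varOmega'=\varOmega+d\eta$. There is an isomorphism $I:H_{\varOmega}(M)\to H_{\varOmega'}(M)$ that is induced by $I_\eta:\xi\mapsto e^{-u\eta}\wedge\xi$ for every comparison form $\eta$ (so it does not depend on the choice of $\eta$), and $$I([\operatorname{Ch}_{\mathcal L}(\nabla)])=[\operatorname{Ch}_{\mathcal L}(\nabla')].$$ -/

import Mathlib

open scoped Manifold ContDiff Topology TensorProduct BigOperators
open Polynomial TopologicalSpace

noncomputable section

namespace TwGerbe

universe uE uM uV uI

/-! ## Complex-valued differential forms -/

section Forms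

/-- The complexified cotangent space `Hom_ℝ(T_x M, ℂ) = T_x* M ⊗ ℂ`. -/
abbrev Cotangent (E : Type uE) [NormedAddCommGroup E] [NormedSpace ℝ E]
    {M : Type uM} [TopologicalSpace M] [ChartedSpace E M] (x : M) : Type uE :=
  TangentSpace 𝓘(ℝ, E) x →ₗ[ℝ] ℂ

/-- The algebra of all (not necessarily smooth) sections of the bundle of algebras `Λ(T*M ⊗ ℂ)`.
The wedge product is the product of the exterior algebra; all operations are pointwise. -/
def Form (E : Type uE) [NormedAddCommGroup E] [NormedSpace ℝ E]
    (M : Type uM) [TopologicalSpace M] [ChartedSpace E M] : Type (max uE uM) :=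
  ∀ x : M, ExteriorAlgebra ℂ (Cotangent E x)

instance instRingForm (E : Type uE) [NormedAddCommGroup E] [NormedSpace ℝ E]
    (M : Type uM) [TopologicalSpace M] [ChartedSpace E M] : Ring (Form E M) :=
  inferInstanceAs (Ring (∀ x : M, ExteriorAlgebra ℂ (Cotangent E x)))

instance instAlgebraForm (E : Type uE) [NormedAddCommGroup E] [NormedSpace ℝ E]
    (M : Type uM) [TopologicalSpace M] [ChartedSpace E M] : Algebra ℂ (Form E M) :=
  inferInstanceAs (Algebra ℂ (∀ x : M, ExteriorAlgebra ℂ (Cotangent E x)))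

/-- The exterior algebra of the complexified dual of the model vector space. -/
abbrev CoordForm (E : Type uE) [NormedAddCommGroup E] [NormedSpace ℝ E] : Type uE :=
  ExteriorAlgebra ℂ (E →ₗ[ℝ] ℂ)

instance instFiniteDual (E : Type uE) [NormedAddCommGroup E] [NormedSpace ℝ E]
    [FiniteDimensional ℝ E] : Module.Finite ℂ (E →ₗ[ℝ] ℂ) :=
  Module.Finite.of_restrictScalars_finite ℝ ℂ _

instance instFiniteCoordForm (E : Type uE) [NormedAddCommGroup E] [NormedSpace ℝ E]
    [FiniteDimensional ℝ E] : Module.Finite ℂ (CoordForm E) :=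
  Module.Finite.of_basis (Module.finBasis ℂ (E →ₗ[ℝ] ℂ)).ExteriorAlgebra

variable {E : Type uE} [NormedAddCommGroup E] [NormedSpace ℝ E]
  {M : Type uM} [TopologicalSpace M] [ChartedSpace E M]

theorem Form.add_apply (w w' : Form E M) (x : M) : (w + w') x = w x + w' x := rfl

theorem Form.smul_apply (c : ℂ) (w : Form E M) (x : M) : (c • w) x = c • w x := rfl

theorem Form.mul_apply (w w' : Form E M) (x : M) : (w * w') x = w x * w' x := rfl

theorem Form.zero_apply (x : M) : (0 : Form E M) x = 0 := rfl

/-- The derivative at `y` of the inverse of the chart centred at `p`. -/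
def chartInvDeriv (p : M) (y : E) :
    E →ₗ[ℝ] TangentSpace 𝓘(ℝ, E) ((extChartAt 𝓘(ℝ, E) p).symm y) :=
  (mfderiv 𝓘(ℝ, E) 𝓘(ℝ, E) (extChartAt 𝓘(ℝ, E) p).symm y).toLinearMap

/-- The derivative at `p` of the chart centred at `p`. -/
def chartDeriv (p : M) : TangentSpace 𝓘(ℝ, E) p →ₗ[ℝ] E :=
  (mfderiv 𝓘(ℝ, E) 𝓘(ℝ, E) (extChartAt 𝓘(ℝ, E) p) p).toLinearMap

/-- The expression of a form in the chart centred at `p`: the pullback of `ω` under the inverse of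
this chart, a function on (an open subset of) the model vector space. -/
def chartRep (w : Form E M) (p : M) (y : E) : CoordForm E :=
  ExteriorAlgebra.map (LinearMap.lcomp ℂ ℂ (chartInvDeriv p y))
    (w ((extChartAt 𝓘(ℝ, E) p).symm y))

theorem chartRep_add (w w' : Form E M) (p : M) (y : E) :
    chartRep (w + w') p y = chartRep w p y + chartRep w' p y := by
  unfold chartRep
  rw [Form.add_apply, map_add]

theorem chartRep_smul (c : ℂ) (w : Form E M) (p : M) (y : E) :
    chartRep (c • w) p y = c • chartRep w p y := by
  unfold chartRep
  rw [Form.smul_apply, map_smul]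

theorem chartRep_zero (p : M) (y : E) : chartRep (0 : Form E M) p y = 0 := by
  unfold chartRep
  rw [Form.zero_apply, map_zero]

/-- Smoothness at a point of a form: all components of its chart expression are smooth. -/
def FormSmoothAt (w : Form E M) (p : M) : Prop :=
  ∀ l : CoordForm E →ₗ[ℂ] ℂ,
    ContDiffAt ℝ ∞ (fun y => l (chartRep w p y)) (extChartAt 𝓘(ℝ, E) p p)

theorem formSmoothAt_zero (p : M) : FormSmoothAt (0 : Form E M) p := by
  intro l
  simp only [chartRep_zero, map_zero]
  exact contDiffAt_const

theorem FormSmoothAt.add {w w' : Form E M} {p : M} (h : FormSmoothAt w p)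
    (h' : FormSmoothAt w' p) : FormSmoothAt (w + w') p := by
  intro l
  simp only [chartRep_add, map_add]
  exact (h l).add (h' l)

theorem FormSmoothAt.smul (c : ℂ) {w : Form E M} {p : M} (h : FormSmoothAt w p) :
    FormSmoothAt (c • w) p := by
  intro l
  simp only [chartRep_smul, map_smul]
  exact (contDiffAt_const (c := c)).smul (h l)

/-- Smoothness of a form on a set (used for open sets only). -/
def FormSmoothOn (w : Form E M) (V : Set M) : Prop :=
  ∀ p ∈ V, FormSmoothAt w p

/-- Homogeneity of degree `k` of a form on a set. -/
def IsHomogeneousOn (k : ℕ) (w : Form E M) (V : Set M) : Prop :=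
  ∀ x ∈ V, w x ∈ ⋀[ℂ]^k (Cotangent E x)

/-- A family of complex covectors, seen as a form of degree one. -/
def ofCovector (a : ∀ x : M, Cotangent E x) : Form E M :=
  fun x => ExteriorAlgebra.ι ℂ (a x)

/-- The differential of a complex-valued function. -/
def dFun (f : M → ℂ) (x : M) : Cotangent E x :=
  (mfderiv 𝓘(ℝ, E) 𝓘(ℝ, ℂ) f x).toLinearMap

variable [FiniteDimensional ℝ E]

/-- Directional derivative at `y` along `v` of a function with values in the finite-dimensional
space `CoordForm E`, computed coordinatewise in a basis. -/
def coordPartial (f : E → CoordForm E) (y v : E) : CoordForm E :=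
  ∑ j, (fderiv ℝ (fun z => (Module.finBasis ℂ (CoordForm E)).repr (f z) j) y v) •
    Module.finBasis ℂ (CoordForm E) j

/-- The exterior derivative `∑ᵢ dxⁱ ∧ ∂f/∂xⁱ` on the model vector space, for the linear
coordinates `xⁱ` of a basis. -/
def coordExtDeriv (f : E → CoordForm E) (y : E) : CoordForm E :=
  ∑ i, ExteriorAlgebra.ι ℂ
      (Complex.ofRealCLM.toLinearMap ∘ₗ (Module.finBasis ℝ E).coord i : E →ₗ[ℝ] ℂ) *
    coordPartial f y (Module.finBasis ℝ E i)

/-- The exterior derivative of a form, computed at `p` in the chart centred at `p`. -/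
def dForm (w : Form E M) : Form E M := fun p =>
  ExteriorAlgebra.map (LinearMap.lcomp ℂ ℂ (chartDeriv p))
    (coordExtDeriv (chartRep w p) (extChartAt 𝓘(ℝ, E) p p))

/-! Linearity of `dForm` on smooth forms. -/

theorem dForm_zero : dForm (0 : Form E M) = 0 := by
  funext p
  rw [Form.zero_apply]
  simp [dForm, coordExtDeriv, coordPartial, chartRep_zero]

theorem FormSmoothAt.differentiableAt {w : Form E M} {p : M} (h : FormSmoothAt w p)
    (j : Fin (Module.finrank ℂ (CoordForm E))) :
    DifferentiableAt ℝ (fun z => (Module.finBasis ℂ (CoordForm E)).repr (chartRep w p z) j)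
      (extChartAt 𝓘(ℝ, E) p p) :=
  (h ((Module.finBasis ℂ (CoordForm E)).coord j)).differentiableAt (by simp)

theorem dForm_add {w w' : Form E M} {p : M} (h : FormSmoothAt w p)
    (h' : FormSmoothAt w' p) : dForm (w + w') p = dForm w p + dForm w' p := by
  simp only [dForm, coordExtDeriv, coordPartial, chartRep_add]
  rw [← map_add, ← Finset.sum_add_distrib]
  congr 1
  refine Finset.sum_congr rfl fun i _ => ?_
  rw [← mul_add, ← Finset.sum_add_distrib]
  congr 1
  refine Finset.sum_congr rfl fun j _ => ?_
  rw [← add_smul]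
  congr 1
  have := fderiv_add (h.differentiableAt j) (h'.differentiableAt j)
  simp only [map_add, Finsupp.add_apply]
  exact congrArg (fun L => L (Module.finBasis ℝ E i)) this

theorem dForm_smul (c : ℂ) {w : Form E M} {p : M} (h : FormSmoothAt w p) :
    dForm (c • w) p = c • dForm w p := by
  simp only [dForm, coordExtDeriv, coordPartial, chartRep_smul]
  rw [← map_smul, Finset.smul_sum]
  congr 1
  refine Finset.sum_congr rfl fun i _ => ?_
  rw [← mul_smul_comm, Finset.smul_sum]
  congr 1
  refine Finset.sum_congr rfl fun j _ => ?_
  rw [← mul_smul]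
  congr 1
  have := fderiv_const_smul (h.differentiableAt j) c
  simp only [map_smul, Finsupp.smul_apply]
  exact congrArg (fun L => L (Module.finBasis ℝ E i)) this

end Forms

/-! ## The twisted de Rham complex `(Ω*(M)[u], u d + u² Ω ∧ ·)` -/

section Twisted

variable {E : Type uE} [NormedAddCommGroup E] [NormedSpace ℝ E]
  {M : Type uM} [TopologicalSpace M] [ChartedSpace E M]

/-- `Ω*(M)[u]`: the polynomials in the formal variable `u` with smooth forms as coefficients. -/
def smoothPoly (E : Type uE) [NormedAddCommGroup E] [NormedSpace ℝ E] [FiniteDimensional ℝ E]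
    (M : Type uM) [TopologicalSpace M] [ChartedSpace E M] : Submodule ℂ (Form E M)[X] where
  carrier := {ξ | ∀ k, FormSmoothOn (ξ.coeff k) Set.univ}
  add_mem' h h' k p hp := by
    rw [Polynomial.coeff_add]
    exact (h k p hp).add (h' k p hp)
  zero_mem' k p _ := by
    rw [Polynomial.coeff_zero]
    exact formSmoothAt_zero p
  smul_mem' c _ h k p hp := by
    rw [Polynomial.coeff_smul]
    exact (h k p hp).smul c

variable [FiniteDimensional ℝ E]

/-- The differential `u d + u² Ω ∧ ·`. -/
def dTwist (Om : Form E M) (ξ : (Form E M)[X]) : (Form E M)[X] :=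
  X * (ξ.sum fun k a => monomial k (dForm a)) + X ^ 2 * (C Om * ξ)

theorem coeff_dPoly (ξ : (Form E M)[X]) (k : ℕ) :
    (ξ.sum fun k a => monomial k (dForm a)).coeff k = dForm (ξ.coeff k) := by
  rw [Polynomial.sum_def, Polynomial.finsetSum_coeff]
  simp only [Polynomial.coeff_monomial]
  rw [Finset.sum_ite_eq']
  split_ifs with h
  · rfl
  · rw [Polynomial.notMem_support_iff.mp h, dForm_zero]

theorem dTwist_add (Om : Form E M) {ξ ζ : (Form E M)[X]} (h : ξ ∈ smoothPoly E M)
    (h' : ζ ∈ smoothPoly E M) : dTwist Om (ξ + ζ) = dTwist Om ξ + dTwist Om ζ := by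
  have key : ((ξ + ζ).sum fun k a => monomial k (dForm a)) =
      (ξ.sum fun k a => monomial k (dForm a)) + (ζ.sum fun k a => monomial k (dForm a)) := by
    ext k : 1
    rw [Polynomial.coeff_add, coeff_dPoly, coeff_dPoly, coeff_dPoly, Polynomial.coeff_add]
    funext p
    exact dForm_add (h k p trivial) (h' k p trivial)
  rw [dTwist, dTwist, dTwist, key, mul_add, mul_add, mul_add]
  abel

theorem dTwist_smul (Om : Form E M) (c : ℂ) {ξ : (Form E M)[X]} (h : ξ ∈ smoothPoly E M) :
    dTwist Om (c • ξ) = c • dTwist Om ξ := by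
  have key : ((c • ξ).sum fun k a => monomial k (dForm a)) =
      c • (ξ.sum fun k a => monomial k (dForm a)) := by
    ext k : 1
    rw [Polynomial.coeff_smul, coeff_dPoly, coeff_dPoly, Polynomial.coeff_smul]
    funext p
    exact dForm_smul c (h k p trivial)
  rw [dTwist, dTwist, key, smul_add, mul_smul_comm, mul_smul_comm, mul_smul_comm]

/-- The differential as a linear map on `Ω*(M)[u]`. -/
def dTwistLin (Om : Form E M) : smoothPoly E M →ₗ[ℂ] (Form E M)[X] where
  toFun ξ := dTwist Om ξ
  map_add' ξ ζ := dTwist_add Om ξ.2 ζ.2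
  map_smul' c ξ := dTwist_smul Om c ξ.2

/-- The cocycles: smooth `ξ` with `d_Ω ξ = 0`. -/
def twCocycles (Om : Form E M) : Submodule ℂ (Form E M)[X] :=
  (LinearMap.ker (dTwistLin Om)).map (smoothPoly E M).subtype

/-- The coboundaries: the `d_Ω ζ` with `ζ` smooth. -/
def twCoboundaries (Om : Form E M) : Submodule ℂ (Form E M)[X] :=
  LinearMap.range (dTwistLin Om)

/-- The twisted cohomology `H_Ω(M)`. -/
abbrev TwCohomology (Om : Form E M) : Type (max uE uM) :=
  twCocycles Om ⧸ (twCoboundaries Om).submoduleOf (twCocycles Om)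

/-- The class of a cocycle. -/
def twClass (Om : Form E M) (ξ : (Form E M)[X]) (h : ξ ∈ twCocycles Om) : TwCohomology Om :=
  Submodule.Quotient.mk ⟨ξ, h⟩

/-- `exp(u a)` for a form `a` of positive degree. All powers `aᵏ` with `k > dim M` vanish, so the
exponential series is this finite sum. -/
def expU (a : Form E M) : (Form E M)[X] :=
  ∑ k ∈ Finset.range (Module.finrank ℝ E + 1), monomial k ((k.factorial : ℂ)⁻¹ • a ^ k)

/-- The map `I_η : ξ ↦ exp(-uη) ∧ ξ`. -/
def twistMap (η : Form E M) (ξ : (Form E M)[X]) : (Form E M)[X] := expU (-η) * ξ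

end Twisted

/-! ## Vector bundles and connections -/

section Bundles

/-- A smooth complex vector bundle of finite rank over an open subset `U` of a manifold `M`: complex
vector spaces `Fiber x` (only those with `x ∈ U` matter) with, around every point `p` of `U`, a
local frame on an open set `dom p`, given together with the dual coframe, such that the changes of
frame are smooth. -/
structure CxBundle (E : Type uE) [NormedAddCommGroup E] [NormedSpace ℝ E]
    {M : Type uM} [TopologicalSpace M] [ChartedSpace E M] (U : Opens M) where
  Fiber : M → Type uV
  [addCommGroup : ∀ x, AddCommGroup (Fiber x)]
  [module : ∀ x, Module ℂ (Fiber x)]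
  dom : M → Opens M
  mem_dom : ∀ p ∈ U, p ∈ dom p
  dom_le : ∀ p, dom p ≤ U
  rank : M → ℕ
  frame : ∀ p, Fin (rank p) → ∀ x, Fiber x
  coframe : ∀ p, Fin (rank p) → ∀ x, Fiber x →ₗ[ℂ] ℂ
  coframe_frame : ∀ p, ∀ x ∈ dom p, ∀ a b, coframe p a x (frame p b x) = if a = b then 1 else 0
  sum_coframe : ∀ p, ∀ x ∈ dom p, ∀ v : Fiber x, ∑ a, coframe p a x v • frame p a x = v
  smooth_change : ∀ p q a b, ContMDiffOn 𝓘(ℝ, E) 𝓘(ℝ, ℂ) ∞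
    (fun x => coframe p a x (frame q b x)) (dom p ∩ dom q : Set M)

attribute [instance] CxBundle.addCommGroup CxBundle.module

variable {E : Type uE} [NormedAddCommGroup E] [NormedSpace ℝ E]
  {M : Type uM} [TopologicalSpace M] [ChartedSpace E M] {U : Opens M}

/-- Smoothness of a section over a set `V` (used for open `V ⊆ U` only). -/
def SectionSmoothOn (B : CxBundle.{uE, uM, uV} E U) (s : ∀ x, B.Fiber x) (V : Set M) : Prop :=
  ∀ p ∈ V, ∀ a, ContMDiffAt 𝓘(ℝ, E) 𝓘(ℝ, ℂ) ∞ (fun x => B.coframe p a x (s x)) p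

/-- The component in the direction of the `a`-th frame vector at `p` of a bundle-valued 1-form. -/
def oneFormComp (B : CxBundle.{uE, uM, uV} E U)
    (t : ∀ x : M, TangentSpace 𝓘(ℝ, E) x →ₗ[ℝ] B.Fiber x) (p : M) (a : Fin (B.rank p)) :
    Form E M :=
  ofCovector fun x => (B.coframe p a x).restrictScalars ℝ ∘ₗ t x

/-- Smoothness of a bundle-valued 1-form. -/
def OneFormSmoothOn (B : CxBundle.{uE, uM, uV} E U)
    (t : ∀ x : M, TangentSpace 𝓘(ℝ, E) x →ₗ[ℝ] B.Fiber x) (V : Set M) : Prop :=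
  ∀ p ∈ V, ∀ a, FormSmoothAt (oneFormComp B t p a) p

/-- A connection on a smooth complex vector bundle over `U`: `D s x v` is `(∇_v s)(x)`, meaningful
when `s` is smooth on a neighbourhood of `x ∈ U`. -/
structure Connection (B : CxBundle.{uE, uM, uV} E U) where
  D : (∀ x, B.Fiber x) → ∀ x : M, TangentSpace 𝓘(ℝ, E) x →ₗ[ℝ] B.Fiber x
  add : ∀ V : Opens M, V ≤ U → ∀ s t, SectionSmoothOn B s V → SectionSmoothOn B t V →
    ∀ x ∈ V, D (fun y => s y + t y) x = D s x + D t x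
  leibniz : ∀ V : Opens M, V ≤ U → ∀ (f : M → ℂ) (s),
    ContMDiffOn 𝓘(ℝ, E) 𝓘(ℝ, ℂ) ∞ f V → SectionSmoothOn B s V →
    ∀ x ∈ V, ∀ v : TangentSpace 𝓘(ℝ, E) x, D (fun y => f y • s y) x v =
      f x • D s x v + dFun f x v • s x
  smooth : ∀ V : Opens M, V ≤ U → ∀ s, SectionSmoothOn B s V → OneFormSmoothOn B (D s) V

/-- The fibre at `x` of the bundle `Λ T*M ⊗ End(B)`, an algebra. -/
abbrev EndForm (B : CxBundle.{uE, uM, uV} E U) (x : M) : Type (max uE uV) :=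
  Module.End ℂ (B.Fiber x) ⊗[ℂ] ExteriorAlgebra ℂ (Cotangent E x)

/-- A scalar form as an endomorphism-valued form. -/
def scalarForm (B : CxBundle.{uE, uM, uV} E U) {x : M}
    (w : ExteriorAlgebra ℂ (Cotangent E x)) : EndForm B x :=
  1 ⊗ₜ[ℂ] w

/-- The trace `Λ T*M ⊗ End(B) → Λ T*M`. -/
def trForm (B : CxBundle.{uE, uM, uV} E U) (x : M) :
    EndForm B x →ₗ[ℂ] ExteriorAlgebra ℂ (Cotangent E x) :=
  (TensorProduct.lid ℂ _).toLinearMap ∘ₗ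
    LinearMap.rTensor _ (LinearMap.trace ℂ (B.Fiber x))

/-- The connection matrix in the frame at `p`: `∇ e_b = ∑ₐ e_a ⊗ A_ab`. -/
def Connection.matrix {B : CxBundle.{uE, uM, uV} E U} (nab : Connection B) (p : M)
    (a b : Fin (B.rank p)) : Form E M :=
  oneFormComp B (nab.D (B.frame p b)) p a

/-- The curvature `∇²`, computed at `x` in the frame at `x`, where its matrix is `dA + A ∧ A`. -/
def Connection.curvature [FiniteDimensional ℝ E] {B : CxBundle.{uE, uM, uV} E U}
    (nab : Connection B) (x : M) : EndForm B x :=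
  ∑ a, ∑ b, ((B.coframe x b x).smulRight (B.frame x a x) : Module.End ℂ (B.Fiber x)) ⊗ₜ[ℂ]
    (dForm (nab.matrix x a b) x + ∑ c, nab.matrix x a c x * nab.matrix x c b x)

end Bundles

/-! ## Gerbes and twisted bundles -/

section Gerbes

/-- A descent datum `(U_α, L_αβ, μ_αβγ)` for a gerbe on `M`. -/
structure GerbeDatum (E : Type uE) [NormedAddCommGroup E] [NormedSpace ℝ E]
    (M : Type uM) [TopologicalSpace M] [ChartedSpace E M] (ι : Type uI) where
  U : ι → Opens M
  cover : ∀ x, ∃ α, x ∈ U α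
  L : ∀ α β, CxBundle.{uE, uM, uV} E (U α ⊓ U β)
  line : ∀ α β, ∀ x ∈ U α ⊓ U β, Module.finrank ℂ ((L α β).Fiber x) = 1
  mu : ∀ α β γ x, (L α β).Fiber x ⊗[ℂ] (L β γ).Fiber x →ₗ[ℂ] (L α γ).Fiber x
  mu_bijective : ∀ α β γ, ∀ x ∈ U α ⊓ U β ⊓ U γ, Function.Bijective (mu α β γ x)
  mu_smooth : ∀ α β γ, ∀ V : Opens M, V ≤ U α ⊓ U β ⊓ U γ → ∀ s t,
    SectionSmoothOn (L α β) s V → SectionSmoothOn (L β γ) t V →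
    SectionSmoothOn (L α γ) (fun x => mu α β γ x (s x ⊗ₜ[ℂ] t x)) V
  mu_assoc : ∀ α β γ δ, ∀ x ∈ U α ⊓ U β ⊓ U γ ⊓ U δ, ∀ a b c,
    mu α γ δ x (mu α β γ x (a ⊗ₜ[ℂ] b) ⊗ₜ[ℂ] c) =
      mu α β δ x (a ⊗ₜ[ℂ] mu β γ δ x (b ⊗ₜ[ℂ] c))

variable {E : Type uE} [NormedAddCommGroup E] [NormedSpace ℝ E]
  {M : Type uM} [TopologicalSpace M] [ChartedSpace E M] {ι : Type uI}

/-- The remaining part `(E_α, φ_αβ)` of a descent datum for a vector bundle twisted by the gerbe. -/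
structure TwistedBundle (G : GerbeDatum.{uE, uM, uV, uI} E M ι) where
  bundle : ∀ α, CxBundle.{uE, uM, uV} E (G.U α)
  phi : ∀ α β x, (bundle α).Fiber x ⊗[ℂ] (G.L α β).Fiber x →ₗ[ℂ] (bundle β).Fiber x
  phi_bijective : ∀ α β, ∀ x ∈ G.U α ⊓ G.U β, Function.Bijective (phi α β x)
  phi_smooth : ∀ α β, ∀ V : Opens M, V ≤ G.U α ⊓ G.U β → ∀ s t,
    SectionSmoothOn (bundle α) s V → SectionSmoothOn (G.L α β) t V →
    SectionSmoothOn (bundle β) (fun x => phi α β x (s x ⊗ₜ[ℂ] t x)) V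
  phi_mu : ∀ α β γ, ∀ x ∈ G.U α ⊓ G.U β ⊓ G.U γ, ∀ e a b,
    phi β γ x (phi α β x (e ⊗ₜ[ℂ] a) ⊗ₜ[ℂ] b) = phi α γ x (e ⊗ₜ[ℂ] G.mu α β γ x (a ⊗ₜ[ℂ] b))

variable [FiniteDimensional ℝ E]

/-- A connection `(∇_αβ, ω_α)` on a descent datum for a gerbe. The field `compat` says
`μ* ∇_αγ = ∇_αβ ⊗ id + id ⊗ ∇_βγ`, evaluated on the (generating) decomposable sections. -/
structure GerbeConnection (G : GerbeDatum.{uE, uM, uV, uI} E M ι) where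
  conn : ∀ α β, Connection (G.L α β)
  compat : ∀ α β γ, ∀ V : Opens M, V ≤ G.U α ⊓ G.U β ⊓ G.U γ → ∀ s t,
    SectionSmoothOn (G.L α β) s V → SectionSmoothOn (G.L β γ) t V →
    ∀ x ∈ V, ∀ v : TangentSpace 𝓘(ℝ, E) x,
      (conn α γ).D (fun y => G.mu α β γ y (s y ⊗ₜ[ℂ] t y)) x v =
        G.mu α β γ x ((conn α β).D s x v ⊗ₜ[ℂ] t x + s x ⊗ₜ[ℂ] (conn β γ).D t x v)
  omega : ι → Form E M
  omega_smooth : ∀ α, FormSmoothOn (omega α) (G.U α)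
  omega_degree : ∀ α, IsHomogeneousOn 2 (omega α) (G.U α)
  curvature_eq : ∀ α β, ∀ x ∈ G.U α ⊓ G.U β,
    (conn α β).curvature x = scalarForm (G.L α β) (omega α x - omega β x)

/-- A connection `(∇_α, ∇_αβ, ω_α)` on a descent datum for a twisted bundle. The field
`compat_phi` says `φ* ∇_β = ∇_α ⊗ id + id ⊗ ∇_αβ`. -/
structure TwistedConnection {G : GerbeDatum.{uE, uM, uV, uI} E M ι} (T : TwistedBundle G)
    extends GerbeConnection G where
  nab : ∀ α, Connection (T.bundle α)
  compat_phi : ∀ α β, ∀ V : Opens M, V ≤ G.U α ⊓ G.U β → ∀ s t,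
    SectionSmoothOn (T.bundle α) s V → SectionSmoothOn (G.L α β) t V →
    ∀ x ∈ V, ∀ v : TangentSpace 𝓘(ℝ, E) x,
      (nab β).D (fun y => T.phi α β y (s y ⊗ₜ[ℂ] t y)) x v =
        T.phi α β x ((nab α).D s x v ⊗ₜ[ℂ] t x + s x ⊗ₜ[ℂ] (conn α β).D t x v)

variable {G : GerbeDatum.{uE, uM, uV, uI} E M ι}

/-- A member of the cover that contains `x`. -/
def GerbeDatum.idx (G : GerbeDatum.{uE, uM, uV, uI} E M ι) (x : M) : ι := (G.cover x).choose

/-- The form `dω_α / 2πi`, meaningful on `U_α`. -/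
def GerbeConnection.localCurv3 (nab : GerbeConnection G) (α : ι) : Form E M :=
  (2 * Real.pi * Complex.I : ℂ)⁻¹ • dForm (nab.omega α)

/-- The curvature 3-form, equal to `dω_α / 2πi` on `U_α`. -/
def GerbeConnection.curv3 (nab : GerbeConnection G) : Form E M :=
  fun x => nab.localCurv3 (G.idx x) x

variable {T : TwistedBundle G}

/-- The curvature `θ = ∇_α² + ω_α` of a twisted connection, on `U_α`. -/
def TwistedConnection.theta (nab : TwistedConnection T) (α : ι) (x : M) :
    EndForm (T.bundle α) x :=
  (nab.nab α).curvature x + scalarForm (T.bundle α) (nab.omega α x)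

/-- On `U_α`, the coefficient of `uᵏ` in `tr exp(-uθ/2πi)`. -/
def TwistedConnection.localChern (nab : TwistedConnection T) (α : ι) (k : ℕ) : Form E M :=
  fun x => (k.factorial : ℂ)⁻¹ •
    trForm (T.bundle α) x ((-(2 * Real.pi * Complex.I : ℂ)⁻¹ • nab.theta α x) ^ k)

/-- The Chern character form `tr exp(-uθ/2πi)`. As `θ` has degree two, `θᵏ = 0` for `k > dim M`, so
the exponential series is this finite sum. -/
def TwistedConnection.chern (nab : TwistedConnection T) : (Form E M)[X] :=
  ∑ k ∈ Finset.range (Module.finrank ℝ E + 1), monomial k fun x => nab.localChern (G.idx x) k x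

/-- `η` is a representative of the canonical class in `Ω²(M)/dΩ¹(M)` that compares two connections
on a gerbe: `η = (ω'_α - ω_α - dδ_α) / 2πi` on `U_α`, for some 1-forms `δ_α` on `U_α` with
`∇'_αβ - ∇_αβ = δ_α - δ_β` on the overlaps. -/
def IsComparison (nab nab' : GerbeConnection G) (η : Form E M) : Prop :=
  ∃ δ : ι → ∀ x : M, Cotangent E x,
    (∀ α, FormSmoothOn (ofCovector (δ α)) (G.U α)) ∧
    (∀ α β, ∀ V : Opens M, V ≤ G.U α ⊓ G.U β → ∀ s, SectionSmoothOn (G.L α β) s V →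
      ∀ x ∈ V, ∀ v : TangentSpace 𝓘(ℝ, E) x,
        (nab'.conn α β).D s x v = (nab.conn α β).D s x v + (δ α x v - δ β x v) • s x) ∧
    ∀ α, ∀ x ∈ G.U α, η x = (2 * Real.pi * Complex.I : ℂ)⁻¹ •
      (nab'.omega α x - nab.omega α x - dForm (ofCovector (δ α)) x)

end Gerbes

end TwGerbe

end

/-! In a local frame of `E_α` the connection is a matrix `A` of 1-forms and `θ = dA + A² + ω_α`. The
Bianchi identity gives `dθ = [θ, A] + dω_α`. Since `θ` is even, commutators with its powers have
trace zero, so `d tr θ^(k+1) = (k+1) dω_α tr θ^k` (`GCDGA.d_trace_theta_pow`). With the factors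
`(-1/2πi)^k / k!` this reads `d ch_(k+1) + Ω ch_k = 0`, which is closedness under `u d + u² Ω`.

The local forms agree on overlaps for the following reason. A frame of `L_αβ` turns `φ_αβ` into an
isomorphism `E_α → E_β` carrying `∇_α + a` to `∇_β`, where `a` is the connection form of `L_αβ`.
Adding the scalar `a` changes the curvature by `da = ω_α - ω_β`, which is exactly what `ω`
compensates, so `θ` is merely conjugated (`Intertwines.theta`). Applying `d` once more shows that
`dω_α = dω_β`.

For two connections, the differences `∇'_αβ - ∇_αβ` form a Čech cocycle of 1-forms, because both
connections are compatible with `μ`. A partition of unity writes this cocycle as `δ_α - δ_β`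
(`exists_isConnDiff`). The forms `ω'_α - ω_α - dδ_α` then glue to `2πi η`, and two choices of `δ`
differ by a global 1-form, so two choices of `η` differ by some `dτ`. Multiplication by `exp(-uη)`
carries `d_Ω` to `d_Ω'` and has inverse `exp(uη)`. Replacing `η` by `η + dτ` changes the image of a
cocycle by an explicit coboundary (`expP_sub_mul_eq_tw`).

For the Chern characters, `∇_α` is compared with `∇'_α + δ_α` rather than with `∇'_α`: the
difference `B = ∇'_α - ∇_α + δ_α` is a global `End(E)`-valued 1-form (`diffMat_conj`). Along the
path `∇_α + tB` the form `ω_α`, and hence `Ω`, is kept fixed, and the usual transgression integral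
shows that the Chern forms of the two ends differ by a `d_Ω`-coboundary. The curvature at `t = 1` is
`θ' - 2πi η` (`endMatTheta_map`), and its scalar part splits off as an exponential. The result is
`Ch' = exp(-uη)(Ch + d_Ω(...))` (`chern_eq_twistMap`).

The algebra is carried out in an abstract `GCDGA`, where an involution recording parity replaces the
grading. `Form` also contains non-smooth sections, on which the exterior derivative obeys no rules.
Local computations therefore take place in germs of smooth forms (`germDGA`) and are then evaluated
at the base point, while global ones use `formDGA`. Polynomials over a `GCDGA` form a `GCDGA` again;
this serves both for the path parameter `t` and for `u`. -/

open scoped Manifold ContDiff Topology TensorProduct BigOperators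
open Polynomial TopologicalSpace

noncomputable section

namespace TwGerbe

universe uE uM uV uI

set_option linter.unusedSectionVars false

/-! ### Exterior algebras: parity signs and degrees. -/

section Exterior

variable {V : Type*} [AddCommGroup V] [Module ℂ V] {W : Type*} [AddCommGroup W] [Module ℂ W]

/-- The grade involution of an exterior algebra. -/
def gradeInv (V : Type*) [AddCommGroup V] [Module ℂ V] :
    ExteriorAlgebra ℂ V →ₐ[ℂ] ExteriorAlgebra ℂ V :=
  ExteriorAlgebra.map (-LinearMap.id)

theorem gradeInv_ι (v : V) : gradeInv V (ExteriorAlgebra.ι ℂ v) = -ExteriorAlgebra.ι ℂ v := by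
  simp [gradeInv]

theorem map_gradeInv (f : V →ₗ[ℂ] W) (a : ExteriorAlgebra ℂ V) :
    ExteriorAlgebra.map f (gradeInv V a) = gradeInv W (ExteriorAlgebra.map f a) := by
  have : (ExteriorAlgebra.map f).comp (gradeInv V) =
      (gradeInv W).comp (ExteriorAlgebra.map f) := by
    apply ExteriorAlgebra.hom_ext
    ext v
    simp [gradeInv_ι]
  exact DFunLike.congr_fun this a

/-- Passing a covector through a product of `k` covectors costs `(-1)^k`. The involution encodes
this sign without reference to degrees, and the identity is multiplicative in `a`, so generators
suffice. -/
theorem ι_mul_comm_gradeInv (v : V) (a : ExteriorAlgebra ℂ V) :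
    ExteriorAlgebra.ι ℂ v * a = gradeInv V a * ExteriorAlgebra.ι ℂ v := by
  induction a using ExteriorAlgebra.induction with
  | algebraMap r => simpa using (Algebra.commutes r (ExteriorAlgebra.ι ℂ v)).symm
  | ι w =>
    rw [gradeInv_ι, neg_mul]
    exact eq_neg_of_add_eq_zero_left (ExteriorAlgebra.ι_add_mul_swap v w)
  | mul a b ha hb => rw [map_mul, ← mul_assoc, ha, mul_assoc, hb, mul_assoc]
  | add a b ha hb => rw [map_add, mul_add, add_mul, ha, hb]

/-- An even element commutes with every covector by `ι_mul_comm_gradeInv`, hence with the algebra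
that covectors generate. -/
theorem commute_of_gradeInv_eq {a : ExteriorAlgebra ℂ V} (h : gradeInv V a = a)
    (b : ExteriorAlgebra ℂ V) : a * b = b * a := by
  induction b using ExteriorAlgebra.induction with
  | algebraMap r => exact (Algebra.commutes r a).symm
  | ι w => rw [ι_mul_comm_gradeInv, h]
  | mul b c hb hc => rw [← mul_assoc, hb, mul_assoc, hc, mul_assoc]
  | add b c hb hc => rw [mul_add, add_mul, hb, hc]

theorem mul_eq_gradeInv_mul_of_odd {a : ExteriorAlgebra ℂ V} (h : gradeInv V a = -a)
    (b : ExteriorAlgebra ℂ V) : a * b = gradeInv V b * a := by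
  induction b using ExteriorAlgebra.induction with
  | algebraMap r => simpa using (Algebra.commutes r a).symm
  | ι w => rw [gradeInv_ι, neg_mul, ι_mul_comm_gradeInv, h, neg_mul, neg_neg]
  | mul b c hb hc => rw [map_mul, ← mul_assoc, hb, mul_assoc, hc, mul_assoc]
  | add b c hb hc => rw [map_add, mul_add, add_mul, hb, hc]

theorem gradeInv_of_mem {k : ℕ} {a : ExteriorAlgebra ℂ V} (h : a ∈ ⋀[ℂ]^k V) :
    gradeInv V a = (-1) ^ k * a := by
  induction k generalizing a with
  | zero =>
    rw [ExteriorAlgebra.exteriorPower, pow_zero] at h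
    obtain ⟨r, rfl⟩ := Submodule.mem_one.mp h
    simp
  | succ k ih =>
    rw [ExteriorAlgebra.exteriorPower, pow_succ] at h
    induction h using Submodule.mul_induction_on' with
    | mem_mul_mem m hm n hn =>
      obtain ⟨v, rfl⟩ := hn
      rw [map_mul, ih hm, gradeInv_ι, pow_succ]
      simp [mul_assoc]
    | add x _ y _ hx hy => rw [map_add, hx, hy, mul_add]

theorem mul_mem_exteriorPower {j k : ℕ} {a b : ExteriorAlgebra ℂ V} (ha : a ∈ ⋀[ℂ]^j V)
    (hb : b ∈ ⋀[ℂ]^k V) : a * b ∈ ⋀[ℂ]^(j + k) V := by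
  rw [ExteriorAlgebra.exteriorPower, pow_add]
  exact Submodule.mul_mem_mul ha hb

theorem ι_mem_exteriorPower (v : V) : ExteriorAlgebra.ι ℂ v ∈ ⋀[ℂ]^1 V := by
  rw [ExteriorAlgebra.exteriorPower, pow_one]
  exact ⟨v, rfl⟩

theorem pow_mem_exteriorPower {j : ℕ} {a : ExteriorAlgebra ℂ V} (ha : a ∈ ⋀[ℂ]^j V) (k : ℕ) :
    a ^ k ∈ ⋀[ℂ]^(j * k) V := by
  rw [ExteriorAlgebra.exteriorPower, pow_mul]
  exact Submodule.pow_mem_pow _ ha k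

theorem map_mem_exteriorPower (f : V →ₗ[ℂ] W) {k : ℕ} {a : ExteriorAlgebra ℂ V}
    (ha : a ∈ ⋀[ℂ]^k V) : ExteriorAlgebra.map f a ∈ ⋀[ℂ]^k W := by
  have h : Submodule.map (ExteriorAlgebra.map f).toLinearMap (⋀[ℂ]^k V) ≤ ⋀[ℂ]^k W := by
    rw [ExteriorAlgebra.exteriorPower, ExteriorAlgebra.exteriorPower, Submodule.map_pow]
    refine pow_le_pow_left₀ ?_ ?_ k
    · exact bot_le
    rintro _ ⟨_, ⟨v, rfl⟩, rfl⟩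
    exact ⟨f v, by simp⟩
  exact h ⟨a, ha, rfl⟩

/-- The dimension of `⋀^k` is a binomial coefficient, which vanishes here. This is why cutting the
exponential series off at `dim M` loses nothing. -/
theorem eq_zero_of_mem_exteriorPower [Module.Finite ℂ V] {k : ℕ} (hk : Module.finrank ℂ V < k)
    {a : ExteriorAlgebra ℂ V} (ha : a ∈ ⋀[ℂ]^k V) : a = 0 := by
  have h := exteriorPower.finrank_eq (R := ℂ) (M := V) k
  rw [Nat.choose_eq_zero_of_lt hk] at h
  have := Module.finrank_zero_iff.mp h
  exact congrArg Subtype.val (Subsingleton.elim (⟨a, ha⟩ : ⋀[ℂ]^k V) 0)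

end Exterior

theorem finrank_dual (E : Type uE) [NormedAddCommGroup E] [NormedSpace ℝ E]
    [FiniteDimensional ℝ E] : Module.finrank ℂ (E →ₗ[ℝ] ℂ) = Module.finrank ℝ E := by
  exact Module.finrank_linearMap_self ℝ ℂ E

/-! ### The exterior derivative on the model vector space. -/

section Calculus

variable {E : Type uE} [NormedAddCommGroup E] [NormedSpace ℝ E] [FiniteDimensional ℝ E]

/-- A norm transported from the coordinates in a fixed basis makes Fréchet calculus available for
form-valued functions. In finite dimension the choice of basis does not affect which functions are
smooth. -/
instance coordFormNormedAddCommGroup : NormedAddCommGroup (CoordForm E) :=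
  NormedAddCommGroup.induced (CoordForm E) (Fin (Module.finrank ℂ (CoordForm E)) → ℂ)
    (Module.finBasis ℂ (CoordForm E)).equivFun.toLinearMap
    (Module.finBasis ℂ (CoordForm E)).equivFun.injective

instance coordFormNormedSpace : NormedSpace ℂ (CoordForm E) :=
  NormedSpace.induced ℂ (CoordForm E) (Fin (Module.finrank ℂ (CoordForm E)) → ℂ)
    (Module.finBasis ℂ (CoordForm E)).equivFun.toLinearMap

instance coordFormFiniteReal : FiniteDimensional ℝ (CoordForm E) :=
  Module.Finite.trans ℂ (CoordForm E)

theorem contDiffAt_coordForm_iff {f : E → CoordForm E} {y : E} {n : WithTop ℕ∞} :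
    ContDiffAt ℝ n f y ↔ ∀ l : CoordForm E →ₗ[ℂ] ℂ, ContDiffAt ℝ n (fun z => l (f z)) y := by
  constructor
  · intro h l
    exact ((l.restrictScalars ℝ).toContinuousLinearMap.contDiff.contDiffAt).comp y h
  · intro h
    have : f = fun z => ∑ j, (Module.finBasis ℂ (CoordForm E)).repr (f z) j •
        Module.finBasis ℂ (CoordForm E) j := by
      funext z
      exact ((Module.finBasis ℂ (CoordForm E)).sum_repr (f z)).symm
    rw [this]
    refine ContDiffAt.sum fun j _ => ContDiffAt.fun_smul ?_ contDiffAt_const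
    exact h ((Module.finBasis ℂ (CoordForm E)).coord j)

theorem coordPartial_eq {f : E → CoordForm E} {y : E} (h : DifferentiableAt ℝ f y) (v : E) :
    coordPartial f y v = fderiv ℝ f y v := by
  rw [coordPartial, ← (Module.finBasis ℂ (CoordForm E)).sum_repr (fderiv ℝ f y v)]
  refine Finset.sum_congr rfl fun j _ => ?_
  congr 1
  let l : CoordForm E →L[ℝ] ℂ :=
    (((Module.finBasis ℂ (CoordForm E)).coord j).restrictScalars ℝ).toContinuousLinearMap
  have := (l.hasFDerivAt.comp y h.hasFDerivAt).fderiv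
  exact DFunLike.congr_fun this v

/-- The `i`-th coordinate covector. -/
def dx (i : Fin (Module.finrank ℝ E)) : CoordForm E :=
  ExteriorAlgebra.ι ℂ
      (Complex.ofRealCLM.toLinearMap ∘ₗ (Module.finBasis ℝ E).coord i : E →ₗ[ℝ] ℂ)

/-- Antisymmetrization of a linear map into forms. -/
def wedgeD (T : E →L[ℝ] CoordForm E) : CoordForm E :=
  ∑ i, dx i * T (Module.finBasis ℝ E i)

theorem coordExtDeriv_eq {f : E → CoordForm E} {y : E} (h : DifferentiableAt ℝ f y) :
    coordExtDeriv f y = wedgeD (fderiv ℝ f y) := by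
  simp only [coordExtDeriv, wedgeD, coordPartial_eq h, dx]

theorem sum_smul_dx (a : E →ₗ[ℝ] ℂ) :
    ∑ i, a (Module.finBasis ℝ E i) • dx i = ExteriorAlgebra.ι ℂ a := by
  simp only [dx, ← map_smul, ← map_sum]
  congr 1
  refine (Module.finBasis ℝ E).ext fun j => ?_
  simp [LinearMap.sum_apply, Finsupp.single_apply, apply_ite Complex.ofReal]

/-- Multiplication of forms as a bounded bilinear map. -/
def mulCLM (E : Type uE) [NormedAddCommGroup E] [NormedSpace ℝ E] [FiniteDimensional ℝ E] :
    CoordForm E →L[ℝ] CoordForm E →L[ℝ] CoordForm E :=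
  LinearMap.toContinuousBilinearMap
    (LinearMap.mk₂ ℝ (fun a b : CoordForm E => a * b) add_mul
      (fun c a b => by
        change ((c : ℂ) • a) * b = (c : ℂ) • (a * b)
        rw [smul_mul_assoc])
      mul_add
      (fun c a b => by
        change a * ((c : ℂ) • b) = (c : ℂ) • (a * b)
        rw [mul_smul_comm]))

theorem contDiffAt_mul {f g : E → CoordForm E} {y : E} {n : WithTop ℕ∞}
    (hf : ContDiffAt ℝ n f y) (hg : ContDiffAt ℝ n g y) :
    ContDiffAt ℝ n (fun z => f z * g z) y :=
  (ContDiffAt.clm_apply ((mulCLM E).contDiff.contDiffAt.comp y hf) hg)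

theorem fderiv_coordForm_mul {f g : E → CoordForm E} {y : E}
    (hf : DifferentiableAt ℝ f y) (hg : DifferentiableAt ℝ g y) (v : E) :
    fderiv ℝ (fun z => f z * g z) y v = f y * fderiv ℝ g y v + fderiv ℝ f y v * g y := by
  have := ((mulCLM E).hasFDerivAt_of_bilinear hf.hasFDerivAt hg.hasFDerivAt).fderiv
  exact DFunLike.congr_fun this v

/-- The ordinary product rule, after which `dxⁱ` has to be moved past `f y`; this produces the
involution. -/
theorem coordExtDeriv_mul {f g : E → CoordForm E} {y : E}
    (hf : DifferentiableAt ℝ f y) (hg : DifferentiableAt ℝ g y) :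
    coordExtDeriv (fun z => f z * g z) y =
      coordExtDeriv f y * g y + gradeInv _ (f y) * coordExtDeriv g y := by
  have hfg : DifferentiableAt ℝ (fun z => f z * g z) y :=
    ((mulCLM E).hasFDerivAt_of_bilinear hf.hasFDerivAt hg.hasFDerivAt).differentiableAt
  rw [coordExtDeriv_eq hf, coordExtDeriv_eq hg, coordExtDeriv_eq hfg]
  simp only [wedgeD, fderiv_coordForm_mul hf hg, mul_add, Finset.sum_add_distrib, Finset.sum_mul,
    Finset.mul_sum]
  rw [add_comm]
  congr 1
  · refine Finset.sum_congr rfl fun i _ => (mul_assoc _ _ _).symm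
  · refine Finset.sum_congr rfl fun i _ => ?_
    rw [← mul_assoc, dx, ι_mul_comm_gradeInv, mul_assoc]

theorem dx_mul_dx_swap (i j : Fin (Module.finrank ℝ E)) :
    dx i * dx j = -(dx j * dx i : CoordForm E) :=
  eq_neg_of_add_eq_zero_left (ExteriorAlgebra.ι_add_mul_swap _ _)

/-- Contraction of a symmetric family with the products `dxⁱ dxʲ` vanishes. -/
theorem sum_dx_dx_eq_zero (S : Fin (Module.finrank ℝ E) → Fin (Module.finrank ℝ E) → CoordForm E)
    (hS : ∀ i j, S i j = S j i) : ∑ i, ∑ j, dx i * (dx j * S i j) = 0 := by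
  have h : ∑ i, ∑ j, dx i * (dx j * S i j) = -∑ i, ∑ j, dx i * (dx j * S i j) := by
    conv_lhs => rw [Finset.sum_comm]
    rw [← Finset.sum_neg_distrib]
    refine Finset.sum_congr rfl fun i _ => ?_
    rw [← Finset.sum_neg_distrib]
    refine Finset.sum_congr rfl fun j _ => ?_
    rw [← mul_assoc, ← mul_assoc, dx_mul_dx_swap, hS, neg_mul]
  have h2 : (2 : ℂ) • ∑ i, ∑ j, dx i * (dx j * S i j) = 0 := by
    rw [two_smul]
    exact add_eq_zero_iff_eq_neg.mpr h
  exact (smul_eq_zero.mp h2).resolve_left two_ne_zero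

theorem wedgeD_contDiffAt {f : E → CoordForm E} {y : E} (h : ContDiffAt ℝ ∞ f y) :
    ContDiffAt ℝ ∞ (fun z => wedgeD (fderiv ℝ f z)) y := by
  unfold wedgeD
  refine ContDiffAt.sum fun i _ => ?_
  refine contDiffAt_mul contDiffAt_const ?_
  exact (h.fderiv_right (m := ∞) (by simp)).clm_apply contDiffAt_const

theorem eventually_coordExtDeriv_eq {f : E → CoordForm E} {y : E} (h : ContDiffAt ℝ ∞ f y) :
    coordExtDeriv f =ᶠ[𝓝 y] fun z => wedgeD (fderiv ℝ f z) := by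
  have : ContDiffAt ℝ 1 f y := h.of_le (by simp)
  filter_upwards [this.eventually (by simp)] with z hz
  exact coordExtDeriv_eq (hz.differentiableAt (by simp))

theorem coordExtDeriv_contDiffAt {f : E → CoordForm E} {y : E} (h : ContDiffAt ℝ ∞ f y) :
    ContDiffAt ℝ ∞ (coordExtDeriv f) y :=
  (wedgeD_contDiffAt h).congr_of_eventuallyEq (eventually_coordExtDeriv_eq h)

theorem coordExtDeriv_congr {f g : E → CoordForm E} {y : E} (h : f =ᶠ[𝓝 y] g) :
    coordExtDeriv f y = coordExtDeriv g y := by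
  unfold coordExtDeriv coordPartial
  refine Finset.sum_congr rfl fun i _ => ?_
  congr 1
  refine Finset.sum_congr rfl fun j _ => ?_
  congr 2
  apply Filter.EventuallyEq.fderiv_eq
  filter_upwards [h] with z hz
  rw [hz]

/-- Second derivatives are symmetric, whereas the products `dxⁱ dxʲ` are antisymmetric. -/
theorem coordExtDeriv_coordExtDeriv {f : E → CoordForm E} {y : E} (h : ContDiffAt ℝ ∞ f y) :
    coordExtDeriv (coordExtDeriv f) y = 0 := by
  rw [coordExtDeriv_congr (eventually_coordExtDeriv_eq h),
    coordExtDeriv_eq ((wedgeD_contDiffAt h).differentiableAt (by simp))]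
  have hD : DifferentiableAt ℝ (fderiv ℝ f) y :=
    (h.fderiv_right (m := ∞) (by simp)).differentiableAt (by simp)
  have key : ∀ v, fderiv ℝ (fun z => wedgeD (fderiv ℝ f z)) y v =
      ∑ j, dx j * fderiv ℝ (fderiv ℝ f) y v (Module.finBasis ℝ E j) := by
    intro v
    have h1 : HasFDerivAt (fun z => wedgeD (fderiv ℝ f z))
        (∑ j, ((mulCLM E (dx j)).comp ((ContinuousLinearMap.apply ℝ (CoordForm E)
          (Module.finBasis ℝ E j)).comp (fderiv ℝ (fderiv ℝ f) y)))) y := by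
      unfold wedgeD
      refine HasFDerivAt.fun_sum fun j _ => ?_
      exact (mulCLM E (dx j)).hasFDerivAt.comp y
        ((ContinuousLinearMap.apply ℝ (CoordForm E)
          (Module.finBasis ℝ E j)).hasFDerivAt.comp y hD.hasFDerivAt)
    rw [h1.fderiv, _root_.sum_apply]
    rfl
  simp only [wedgeD] at key ⊢
  simp only [key, Finset.mul_sum]
  refine sum_dx_dx_eq_zero _ fun i j => ?_
  exact (h.isSymmSndFDerivAt (by
    rw [minSmoothness_of_isRCLikeNormedField]
    exact WithTop.coe_le_coe.mpr le_top)).eq _ _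

theorem wedgeD_mem {k : ℕ} {T : E →L[ℝ] CoordForm E}
    (h : ∀ v, T v ∈ ⋀[ℂ]^k (E →ₗ[ℝ] ℂ)) : wedgeD T ∈ ⋀[ℂ]^(k + 1) (E →ₗ[ℝ] ℂ) := by
  refine Submodule.sum_mem _ fun i _ => ?_
  rw [add_comm]
  exact mul_mem_exteriorPower (ι_mem_exteriorPower _) (h _)

theorem coordExtDeriv_mem {k : ℕ} {f : E → CoordForm E} {y : E} (hf : DifferentiableAt ℝ f y)
    (h : ∀ᶠ z in 𝓝 y, f z ∈ ⋀[ℂ]^k (E →ₗ[ℝ] ℂ)) :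
    coordExtDeriv f y ∈ ⋀[ℂ]^(k + 1) (E →ₗ[ℝ] ℂ) := by
  rw [coordExtDeriv_eq hf]
  refine wedgeD_mem fun v => ?_
  by_contra hv
  -- A subspace is the intersection of the kernels of the functionals that vanish on it. Such a
  -- functional kills `f` near `y`, hence also its derivative.
  obtain ⟨l, hl, hl'⟩ := Submodule.exists_le_ker_of_notMem hv
  have h0 : (fun z => l (f z)) =ᶠ[𝓝 y] fun _ => 0 := by
    filter_upwards [h] with z hz
    exact hl' hz
  let L : CoordForm E →L[ℝ] ℂ := (l.restrictScalars ℝ).toContinuousLinearMap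
  have h1 := (L.hasFDerivAt.comp y hf.hasFDerivAt).fderiv
  have h2 : fderiv ℝ (fun z => l (f z)) y = 0 := by
    rw [h0.fderiv_eq]; simp
  have h3 := DFunLike.congr_fun (h1.symm.trans h2) v
  exact hl h3

end Calculus

/-! ### Pullback of forms under smooth maps of the model space. -/

section Pullback

variable {E : Type uE} [NormedAddCommGroup E] [NormedSpace ℝ E]

/-- Pullback of constant forms under a linear map. -/
def pull (T : E →L[ℝ] E) : CoordForm E →ₐ[ℂ] CoordForm E :=
  ExteriorAlgebra.map (LinearMap.lcomp ℂ ℂ T.toLinearMap)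

theorem pull_ι (T : E →L[ℝ] E) (a : E →ₗ[ℝ] ℂ) :
    pull T (ExteriorAlgebra.ι ℂ a) = ExteriorAlgebra.ι ℂ (a ∘ₗ T.toLinearMap) := by
  rw [pull, ExteriorAlgebra.map_apply_ι]
  rfl

variable [FiniteDimensional ℝ E]

theorem coordExtDeriv_const (c : CoordForm E) (y : E) : coordExtDeriv (fun _ => c) y = 0 := by
  rw [coordExtDeriv_eq (differentiableAt_const c)]
  simp [wedgeD]

/-- The pullback of a constant form is closed. For a covector the coefficients of the pullback are
first derivatives of `F`, so symmetry of the second derivative applies; products follow from the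
Leibniz rule. Smoothness is carried along because the Leibniz rule needs it in the induction. -/
theorem pull_const_aux {F : E → E} {y : E} (hF : ContDiffAt ℝ ∞ F y) (e : CoordForm E) :
    ContDiffAt ℝ ∞ (fun z => pull (fderiv ℝ F z) e) y ∧
      coordExtDeriv (fun z => pull (fderiv ℝ F z) e) y = 0 := by
  induction e using ExteriorAlgebra.induction with
  | algebraMap r =>
    simp only [AlgHom.commutes]
    exact ⟨contDiffAt_const, coordExtDeriv_const _ _⟩
  | ι a =>
    have hD : ContDiffAt ℝ ∞ (fderiv ℝ F) y := hF.fderiv_right (by simp)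
    have hdD : DifferentiableAt ℝ (fderiv ℝ F) y := hD.differentiableAt (by simp)
    let A : E →L[ℝ] ℂ := a.toContinuousLinearMap
    have h0 : (fun z => pull (fderiv ℝ F z) (ExteriorAlgebra.ι ℂ a)) =
        fun z => ∑ j, A (fderiv ℝ F z (Module.finBasis ℝ E j)) • dx j := by
      funext z
      rw [pull_ι, ← sum_smul_dx]
      rfl
    have h1 : ∀ j, ContDiffAt ℝ ∞ (fun z => A (fderiv ℝ F z (Module.finBasis ℝ E j))) y :=
      fun j => A.contDiff.contDiffAt.comp y (hD.clm_apply contDiffAt_const)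
    have h2 : ContDiffAt ℝ ∞ (fun z => pull (fderiv ℝ F z) (ExteriorAlgebra.ι ℂ a)) y := by
      rw [h0]
      exact ContDiffAt.sum fun j _ => ContDiffAt.fun_smul (h1 j) contDiffAt_const
    refine ⟨h2, ?_⟩
    rw [coordExtDeriv_eq (h2.differentiableAt (by simp)), h0]
    have key : ∀ v, fderiv ℝ
        (fun z => ∑ j, A (fderiv ℝ F z (Module.finBasis ℝ E j)) • dx j) y v =
        ∑ j, A (fderiv ℝ (fderiv ℝ F) y v (Module.finBasis ℝ E j)) • dx j := by
      intro v
      have h3 : HasFDerivAt (fun z => ∑ j, A (fderiv ℝ F z (Module.finBasis ℝ E j)) • dx j)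
          (∑ j, ((A.comp ((ContinuousLinearMap.apply ℝ E
          (Module.finBasis ℝ E j)).comp (fderiv ℝ (fderiv ℝ F) y))).smulRight
            (dx j : CoordForm E))) y := by
        refine HasFDerivAt.fun_sum fun j _ => HasFDerivAt.smul_const ?_ _
        exact A.hasFDerivAt.comp y
          ((ContinuousLinearMap.apply ℝ E
            (Module.finBasis ℝ E j)).hasFDerivAt.comp y hdD.hasFDerivAt)
      rw [h3.fderiv, _root_.sum_apply]
      rfl
    rw [wedgeD]
    simp only [key, Finset.mul_sum]
    rw [← sum_dx_dx_eq_zero (fun i j => algebraMap ℂ (CoordForm E)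
      (A (fderiv ℝ (fderiv ℝ F) y (Module.finBasis ℝ E i) (Module.finBasis ℝ E j))))]
    · refine Finset.sum_congr rfl fun i _ => Finset.sum_congr rfl fun j _ => ?_
      rw [← Algebra.commutes, ← Algebra.smul_def]
    · intro i j
      congr 2
      exact (hF.isSymmSndFDerivAt (by
        rw [minSmoothness_of_isRCLikeNormedField]
        exact WithTop.coe_le_coe.mpr le_top)).eq _ _
  | mul a b ha hb =>
    simp only [map_mul]
    refine ⟨contDiffAt_mul ha.1 hb.1, ?_⟩
    rw [coordExtDeriv_mul (ha.1.differentiableAt (by simp)) (hb.1.differentiableAt (by simp)),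
      ha.2, hb.2, zero_mul, mul_zero, add_zero]
  | add a b ha hb =>
    simp only [map_add]
    refine ⟨ha.1.add hb.1, ?_⟩
    have h1 := ha.1.differentiableAt (n := ∞) (by simp)
    have h2 := hb.1.differentiableAt (n := ∞) (by simp)
    have h3 := ha.2
    have h4 := hb.2
    rw [coordExtDeriv_eq h1] at h3
    rw [coordExtDeriv_eq h2] at h4
    rw [coordExtDeriv_eq (h1.fun_add h2), fderiv_fun_add h1 h2]
    rw [wedgeD] at h3 h4 ⊢
    simp only [_root_.add_apply, mul_add, Finset.sum_add_distrib, h3, h4, add_zero]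

theorem pull_basis_expansion (F : E → E) (w : E → CoordForm E) :
    (fun z => pull (fderiv ℝ F z) (w (F z))) =
      fun z => ∑ j, (Module.finBasis ℂ (CoordForm E)).repr (w (F z)) j •
        pull (fderiv ℝ F z) (Module.finBasis ℂ (CoordForm E) j) := by
  funext z
  conv_lhs => rw [← (Module.finBasis ℂ (CoordForm E)).sum_repr (w (F z))]
  simp only [map_sum, map_smul]

theorem pull_contDiffAt {F : E → E} {y : E} (hF : ContDiffAt ℝ ∞ F y) {w : E → CoordForm E}
    (hw : ContDiffAt ℝ ∞ w (F y)) :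
    ContDiffAt ℝ ∞ (fun z => pull (fderiv ℝ F z) (w (F z))) y := by
  rw [pull_basis_expansion]
  refine ContDiffAt.sum fun j _ => ContDiffAt.fun_smul ?_ (pull_const_aux hF _).1
  exact ContDiffAt.comp y
    (contDiffAt_coordForm_iff.mp hw ((Module.finBasis ℂ (CoordForm E)).coord j)) hF

/-- Expand `w` in constant basis forms. The terms that differentiate the pulled-back basis vanish by
`pull_const_aux`, and the chain rule for the coefficient functions gives the rest. -/
theorem coordExtDeriv_pull {F : E → E} {y : E} (hF : ContDiffAt ℝ ∞ F y) {w : E → CoordForm E}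
    (hw : ContDiffAt ℝ ∞ w (F y)) :
    coordExtDeriv (fun z => pull (fderiv ℝ F z) (w (F z))) y =
      pull (fderiv ℝ F y) (coordExtDeriv w (F y)) := by
  have hs := pull_contDiffAt hF hw
  rw [coordExtDeriv_eq (hs.differentiableAt (by simp)),
    coordExtDeriv_eq (hw.differentiableAt (by simp))]
  let b := Module.finBasis ℂ (CoordForm E)
  let c : Fin (Module.finrank ℂ (CoordForm E)) → CoordForm E →L[ℝ] ℂ :=
    fun j => ((b.coord j).restrictScalars ℝ).toContinuousLinearMap
  have hFd := (hF.differentiableAt (by simp)).hasFDerivAt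
  have hwd := (hw.differentiableAt (by simp)).hasFDerivAt
  have hP : ∀ j, HasFDerivAt (fun z => pull (fderiv ℝ F z) (b j))
      (fderiv ℝ (fun z => pull (fderiv ℝ F z) (b j)) y) y :=
    fun j => ((pull_const_aux hF (b j)).1.differentiableAt (by simp)).hasFDerivAt
  have hcoef : ∀ j, HasFDerivAt (fun z => c j (w (F z)))
      ((c j).comp ((fderiv ℝ w (F y)).comp (fderiv ℝ F y))) y :=
    fun j => (c j).hasFDerivAt.comp y (hwd.comp y hFd)
  have hsum : HasFDerivAt (fun z => pull (fderiv ℝ F z) (w (F z)))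
      (∑ j, (c j (w (F y)) • fderiv ℝ (fun z => pull (fderiv ℝ F z) (b j)) y +
        ((c j).comp ((fderiv ℝ w (F y)).comp (fderiv ℝ F y))).smulRight
          (pull (fderiv ℝ F y) (b j)))) y := by
    rw [pull_basis_expansion]
    exact HasFDerivAt.fun_sum fun j _ => (hcoef j).fun_smul (hP j)
  rw [hsum.fderiv]
  have hz : ∀ j, wedgeD (fderiv ℝ (fun z => pull (fderiv ℝ F z) (b j)) y) = 0 := by
    intro j
    rw [← coordExtDeriv_eq (hP j).differentiableAt]
    exact (pull_const_aux hF (b j)).2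
  have hlin : ∀ v, fderiv ℝ w (F y) v = ∑ j, c j (fderiv ℝ w (F y) v) • b j :=
    fun v => (b.sum_repr _).symm
  have hR : ∀ j, ∑ i, (c j (fderiv ℝ w (F y) (Module.finBasis ℝ E i))) • dx i =
      ExteriorAlgebra.ι ℂ ((c j).toLinearMap ∘ₗ (fderiv ℝ w (F y)).toLinearMap) :=
    fun j => sum_smul_dx ((c j).toLinearMap ∘ₗ (fderiv ℝ w (F y)).toLinearMap)
  have hR2 : wedgeD (fderiv ℝ w (F y)) = ∑ j,
      ExteriorAlgebra.ι ℂ ((c j).toLinearMap ∘ₗ (fderiv ℝ w (F y)).toLinearMap) * b j := by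
    rw [wedgeD]
    simp only [← hR, Finset.sum_mul]
    rw [Finset.sum_comm]
    refine Finset.sum_congr rfl fun i _ => ?_
    conv_lhs => rw [hlin]
    rw [Finset.mul_sum]
    refine Finset.sum_congr rfl fun j _ => ?_
    rw [mul_smul_comm, smul_mul_assoc]
  rw [hR2, map_sum]
  have hL : wedgeD (∑ j, (c j (w (F y)) • fderiv ℝ (fun z => pull (fderiv ℝ F z) (b j)) y +
        ((c j).comp ((fderiv ℝ w (F y)).comp (fderiv ℝ F y))).smulRight
          (pull (fderiv ℝ F y) (b j)))) = ∑ j, ∑ i,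
          ((c j) (fderiv ℝ w (F y) (fderiv ℝ F y (Module.finBasis ℝ E i))) • dx i) *
            (pull (fderiv ℝ F y) (b j)) := by
    rw [wedgeD]
    simp only [_root_.sum_apply, _root_.add_apply, _root_.smul_apply,
      Finset.mul_sum, mul_add]
    rw [Finset.sum_comm]
    refine Finset.sum_congr rfl fun j _ => ?_
    rw [Finset.sum_add_distrib]
    have : ∑ i, dx i * c j (w (F y)) • (fderiv ℝ (fun z => pull (fderiv ℝ F z) (b j)) y)
        (Module.finBasis ℝ E i) = 0 := by
      have := hz j
      rw [wedgeD] at this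
      simp only [mul_smul_comm]
      rw [← Finset.smul_sum, this, smul_zero]
    rw [this, zero_add]
    refine Finset.sum_congr rfl fun i _ => ?_
    rw [ContinuousLinearMap.smulRight_apply, mul_smul_comm, smul_mul_assoc]
    rfl
  rw [hL]
  refine Finset.sum_congr rfl fun j _ => ?_
  rw [map_mul, pull_ι, ← Finset.sum_mul, ← sum_smul_dx]
  rfl

end Pullback

/-! ### Forms on the manifold: chart independence and the rules for `d`. -/

section ChartChange

variable {E : Type uE} [NormedAddCommGroup E] [NormedSpace ℝ E]
  {M : Type uM} [TopologicalSpace M] [ChartedSpace E M]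

/-- The derivative at `y` of the inverse chart at `p`, as a map between model spaces. -/
def chartInvCLM (p : M) (y : E) : E →L[ℝ] E :=
  mfderiv 𝓘(ℝ, E) 𝓘(ℝ, E) (extChartAt 𝓘(ℝ, E) p).symm y

/-- The derivative at `p` of the chart at `p`, as a map between model spaces. -/
def chartCLM (p : M) : E →L[ℝ] E :=
  mfderiv 𝓘(ℝ, E) 𝓘(ℝ, E) (extChartAt 𝓘(ℝ, E) p) p

/-- A form, regarded as a function with values in the forms on the model space. -/
def Form.raw (w : Form E M) (x : M) : CoordForm E := w x

theorem chartRep_eq_pull (w : Form E M) (p : M) (y : E) :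
    chartRep w p y = pull (chartInvCLM p y) (w.raw ((extChartAt 𝓘(ℝ, E) p).symm y)) := rfl

theorem chartRep_apply (w : Form E M) {p x : M} (hx : x ∈ (extChartAt 𝓘(ℝ, E) p).source) :
    chartRep w p (extChartAt 𝓘(ℝ, E) p x) =
      pull (chartInvCLM p (extChartAt 𝓘(ℝ, E) p x)) (w.raw x) := by
  rw [chartRep_eq_pull, (extChartAt 𝓘(ℝ, E) p).left_inv hx]

theorem pull_pull (S T : E →L[ℝ] E) (a : CoordForm E) :
    pull S (pull T a) = pull (T.comp S) a := by
  have : (pull S).comp (pull T) = pull (T.comp S) := by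
    unfold pull
    rw [ExteriorAlgebra.map_comp_map]
    rfl
  exact DFunLike.congr_fun this a

theorem pull_id (a : CoordForm E) : pull (ContinuousLinearMap.id ℝ E) a = a := by
  have : pull (ContinuousLinearMap.id ℝ E) = AlgHom.id ℂ _ := by
    unfold pull
    rw [← ExteriorAlgebra.map_id]
    rfl
  exact DFunLike.congr_fun this a

variable [FiniteDimensional ℝ E]

theorem dForm_raw (w : Form E M) (p : M) : (dForm w).raw p =
    pull (chartCLM p) (coordExtDeriv (chartRep w p) (extChartAt 𝓘(ℝ, E) p p)) := rfl

theorem chartRep_mul (w w' : Form E M) (p : M) (y : E) :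
    chartRep (w * w') p y = chartRep w p y * chartRep w' p y := by
  simp only [chartRep, Form.mul_apply, map_mul]

theorem eventually_chartRep_congr {w w' : Form E M} {p x : M}
    (hx : x ∈ (extChartAt 𝓘(ℝ, E) p).source) (h : ∀ᶠ z in 𝓝 x, w z = w' z) :
    chartRep w p =ᶠ[𝓝 (extChartAt 𝓘(ℝ, E) p x)] chartRep w' p := by
  have hc := continuousAt_extChartAt_symm' (I := 𝓘(ℝ, E)) hx
  rw [ContinuousAt, (extChartAt 𝓘(ℝ, E) p).left_inv hx] at hc
  filter_upwards [hc.eventually h] with y hy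
  rw [chartRep, hy, chartRep]

theorem dForm_congr {w w' : Form E M} {p : M} (h : ∀ᶠ z in 𝓝 p, w z = w' z) :
    dForm w p = dForm w' p := by
  rw [dForm, dForm, coordExtDeriv_congr (eventually_chartRep_congr (mem_extChartAt_source p) h)]

theorem formSmoothAt_iff {w : Form E M} {p : M} : FormSmoothAt w p ↔
    ContDiffAt ℝ ∞ (chartRep w p) (extChartAt 𝓘(ℝ, E) p p) :=
  contDiffAt_coordForm_iff.symm

theorem FormSmoothAt.congr {w w' : Form E M} {p : M} (hw : FormSmoothAt w p)
    (h : ∀ᶠ z in 𝓝 p, w z = w' z) : FormSmoothAt w' p := by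
  rw [formSmoothAt_iff] at *
  exact hw.congr_of_eventuallyEq
    (eventually_chartRep_congr (mem_extChartAt_source p) h).symm

theorem FormSmoothAt.mul {w w' : Form E M} {p : M} (hw : FormSmoothAt w p)
    (hw' : FormSmoothAt w' p) : FormSmoothAt (w * w') p := by
  rw [formSmoothAt_iff] at *
  have : chartRep (w * w') p = fun y => chartRep w p y * chartRep w' p y := by
    funext y; exact chartRep_mul w w' p y
  rw [this]
  exact contDiffAt_mul hw hw'

/-- The grade involution of forms. -/
def formGradeInv (E : Type uE) [NormedAddCommGroup E] [NormedSpace ℝ E]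
    (M : Type uM) [TopologicalSpace M] [ChartedSpace E M] : Form E M →ₐ[ℂ] Form E M where
  toFun w := fun x => gradeInv _ (w x)
  map_one' := funext fun _ => map_one _
  map_mul' _ _ := funext fun _ => map_mul _ _ _
  map_zero' := funext fun _ => map_zero _
  map_add' _ _ := funext fun _ => map_add _ _ _
  commutes' c := funext fun _ => (gradeInv _).commutes c

theorem formGradeInv_apply (w : Form E M) (x : M) : formGradeInv E M w x = gradeInv _ (w x) := rfl

theorem chartRep_gradeInv (w : Form E M) (p : M) (y : E) :
    chartRep (formGradeInv E M w) p y = gradeInv _ (chartRep w p y) := by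
  simp only [chartRep, formGradeInv_apply, map_gradeInv]

theorem FormSmoothAt.gradeInv {w : Form E M} {p : M} (hw : FormSmoothAt w p) :
    FormSmoothAt (formGradeInv E M w) p := by
  intro l
  have := hw (l ∘ₗ (TwGerbe.gradeInv _).toLinearMap)
  simp only [chartRep_gradeInv]
  exact this

/-- The change of charts from the chart at `q` to the chart at `p`. -/
def transition (p q : M) (y : E) : E :=
  extChartAt 𝓘(ℝ, E) p ((extChartAt 𝓘(ℝ, E) q).symm y)

variable [IsManifold 𝓘(ℝ, E) ∞ M]

theorem transition_contDiffAt {p q x : M} (hp : x ∈ (extChartAt 𝓘(ℝ, E) p).source)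
    (hq : x ∈ (extChartAt 𝓘(ℝ, E) q).source) :
    ContDiffAt ℝ ∞ (transition p q) (extChartAt 𝓘(ℝ, E) q x) := by
  have h := contDiffWithinAt_ext_coord_change (I := 𝓘(ℝ, E)) (n := ∞) p q
    (y := extChartAt 𝓘(ℝ, E) q x) (by
      rw [PartialEquiv.trans_source, Set.mem_inter_iff, PartialEquiv.symm_source, Set.mem_preimage,
        (extChartAt 𝓘(ℝ, E) q).left_inv hq]
      exact ⟨(extChartAt 𝓘(ℝ, E) q).map_source hq, hp⟩)
  rw [modelWithCornersSelf_coe, Set.range_id, contDiffWithinAt_univ] at h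
  exact h

theorem chartInv_mdifferentiableAt {p : M} {y : E} (hy : y ∈ (extChartAt 𝓘(ℝ, E) p).target) :
    MDifferentiableAt 𝓘(ℝ, E) 𝓘(ℝ, E) (extChartAt 𝓘(ℝ, E) p).symm y := by
  have : IsManifold 𝓘(ℝ, E) 1 M := IsManifold.of_le (n := ∞) (by simp)
  have h := mdifferentiableWithinAt_extChartAt_symm (I := 𝓘(ℝ, E)) hy
  rwa [modelWithCornersSelf_coe, Set.range_id, mdifferentiableWithinAt_univ] at h

theorem chartCLM_comp_chartInvCLM (p : M) :
    (chartCLM p).comp (chartInvCLM p (extChartAt 𝓘(ℝ, E) p p)) = ContinuousLinearMap.id ℝ E := by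
  have : IsManifold 𝓘(ℝ, E) 1 M := IsManifold.of_le (n := ∞) (by simp)
  have h := mfderiv_extChartAt_comp_mfderivWithin_extChartAt_symm' (I := 𝓘(ℝ, E))
    (mem_extChartAt_source (I := 𝓘(ℝ, E)) p)
  rw [modelWithCornersSelf_coe, Set.range_id, mfderivWithin_univ] at h
  exact h

theorem chartInvCLM_comp_chartCLM (p : M) :
    (chartInvCLM p (extChartAt 𝓘(ℝ, E) p p)).comp (chartCLM p) = ContinuousLinearMap.id ℝ E := by
  have : IsManifold 𝓘(ℝ, E) 1 M := IsManifold.of_le (n := ∞) (by simp)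
  have h := mfderivWithin_extChartAt_symm_comp_mfderiv_extChartAt' (I := 𝓘(ℝ, E))
    (mem_extChartAt_source (I := 𝓘(ℝ, E)) p)
  rw [modelWithCornersSelf_coe, Set.range_id, mfderivWithin_univ] at h
  exact h

theorem pull_chartRep_self (w : Form E M) (p : M) :
    pull (chartCLM p) (chartRep w p (extChartAt 𝓘(ℝ, E) p p)) = w.raw p := by
  rw [chartRep_apply w (mem_extChartAt_source p), pull_pull, chartInvCLM_comp_chartCLM, pull_id]

theorem dForm_mul {w w' : Form E M} {p : M} (hw : FormSmoothAt w p) (hw' : FormSmoothAt w' p) :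
    dForm (w * w') p = dForm w p * w' p + gradeInv _ (w p) * dForm w' p := by
  change (dForm (w * w')).raw p =
    (dForm w).raw p * w'.raw p + gradeInv _ (w.raw p) * (dForm w').raw p
  have : chartRep (w * w') p = fun y => chartRep w p y * chartRep w' p y := by
    funext y; exact chartRep_mul w w' p y
  rw [formSmoothAt_iff] at hw hw'
  rw [dForm_raw, dForm_raw, dForm_raw, this, coordExtDeriv_mul (hw.differentiableAt (by simp))
    (hw'.differentiableAt (by simp)), map_add, map_mul, map_mul, pull, map_gradeInv, ← pull,
    pull_chartRep_self, pull_chartRep_self]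

/-- The chain rule: near the point, the inverse of the chart at `q` is the inverse of the chart at
`p` composed with the transition map. -/
theorem chartInvCLM_transition {p q x : M} (hp : x ∈ (extChartAt 𝓘(ℝ, E) p).source)
    (hq : x ∈ (extChartAt 𝓘(ℝ, E) q).source) :
    chartInvCLM q (extChartAt 𝓘(ℝ, E) q x) =
      (chartInvCLM p (extChartAt 𝓘(ℝ, E) p x)).comp
        (fderiv ℝ (transition p q) (extChartAt 𝓘(ℝ, E) q x)) := by
  have hT : transition p q (extChartAt 𝓘(ℝ, E) q x) = extChartAt 𝓘(ℝ, E) p x := by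
    rw [transition, (extChartAt 𝓘(ℝ, E) q).left_inv hq]
  have he : (extChartAt 𝓘(ℝ, E) q).symm =ᶠ[𝓝 (extChartAt 𝓘(ℝ, E) q x)]
      (extChartAt 𝓘(ℝ, E) p).symm ∘ transition p q := by
    have hc := continuousAt_extChartAt_symm' (I := 𝓘(ℝ, E)) hq
    rw [ContinuousAt, (extChartAt 𝓘(ℝ, E) q).left_inv hq] at hc
    filter_upwards [hc.eventually (extChartAt_source_mem_nhds' hp)] with y hy
    exact ((extChartAt 𝓘(ℝ, E) p).left_inv hy).symm
  have hd : MDifferentiableAt 𝓘(ℝ, E) 𝓘(ℝ, E) (transition p q) (extChartAt 𝓘(ℝ, E) q x) :=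
    ((transition_contDiffAt hp hq).differentiableAt (by simp)).mdifferentiableAt
  have hs : MDifferentiableAt 𝓘(ℝ, E) 𝓘(ℝ, E) (extChartAt 𝓘(ℝ, E) p).symm
      (transition p q (extChartAt 𝓘(ℝ, E) q x)) := by
    rw [hT]
    exact chartInv_mdifferentiableAt ((extChartAt 𝓘(ℝ, E) p).map_source hp)
  have h1 : chartInvCLM q (extChartAt 𝓘(ℝ, E) q x) =
      (chartInvCLM p (transition p q (extChartAt 𝓘(ℝ, E) q x))).comp
        (mfderiv 𝓘(ℝ, E) 𝓘(ℝ, E) (transition p q) (extChartAt 𝓘(ℝ, E) q x)) :=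
    he.mfderiv_eq.trans (mfderiv_comp _ hs hd)
  rw [h1, hT, mfderiv_eq_fderiv]
  rfl

theorem chartRep_change (w : Form E M) {p q x : M} (hp : x ∈ (extChartAt 𝓘(ℝ, E) p).source)
    (hq : x ∈ (extChartAt 𝓘(ℝ, E) q).source) :
    chartRep w q (extChartAt 𝓘(ℝ, E) q x) =
      pull (fderiv ℝ (transition p q) (extChartAt 𝓘(ℝ, E) q x))
        (chartRep w p (transition p q (extChartAt 𝓘(ℝ, E) q x))) := by
  have hT : transition p q (extChartAt 𝓘(ℝ, E) q x) = extChartAt 𝓘(ℝ, E) p x := by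
    rw [transition, (extChartAt 𝓘(ℝ, E) q).left_inv hq]
  rw [hT, chartRep_apply w hp, chartRep_apply w hq, pull_pull, chartInvCLM_transition hp hq]

theorem eventually_chartRep_change (w : Form E M) {p q x : M}
    (hp : x ∈ (extChartAt 𝓘(ℝ, E) p).source) (hq : x ∈ (extChartAt 𝓘(ℝ, E) q).source) :
    chartRep w q =ᶠ[𝓝 (extChartAt 𝓘(ℝ, E) q x)] fun y =>
      pull (fderiv ℝ (transition p q) y) (chartRep w p (transition p q y)) := by
  have hc := continuousAt_extChartAt_symm' (I := 𝓘(ℝ, E)) hq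
  rw [ContinuousAt, (extChartAt 𝓘(ℝ, E) q).left_inv hq] at hc
  filter_upwards [hc.eventually (extChartAt_source_mem_nhds' hp),
    extChartAt_target_mem_nhds' ((extChartAt 𝓘(ℝ, E) q).map_source hq)] with y hy hy'
  have := chartRep_change w hy ((extChartAt 𝓘(ℝ, E) q).map_target hy')
  rwa [(extChartAt 𝓘(ℝ, E) q).right_inv hy'] at this

theorem chartRep_contDiffAt_change {w : Form E M} {p q x : M}
    (hp : x ∈ (extChartAt 𝓘(ℝ, E) p).source) (hq : x ∈ (extChartAt 𝓘(ℝ, E) q).source)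
    (h : ContDiffAt ℝ ∞ (chartRep w p) (extChartAt 𝓘(ℝ, E) p x)) :
    ContDiffAt ℝ ∞ (chartRep w q) (extChartAt 𝓘(ℝ, E) q x) := by
  have hT : transition p q (extChartAt 𝓘(ℝ, E) q x) = extChartAt 𝓘(ℝ, E) p x := by
    rw [transition, (extChartAt 𝓘(ℝ, E) q).left_inv hq]
  rw [← hT] at h
  exact (pull_contDiffAt (transition_contDiffAt hp hq) h).congr_of_eventuallyEq
    (eventually_chartRep_change w hp hq)

theorem formSmoothAt_iff_chart {w : Form E M} {p x : M}
    (hp : x ∈ (extChartAt 𝓘(ℝ, E) p).source) :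
    FormSmoothAt w x ↔ ContDiffAt ℝ ∞ (chartRep w p) (extChartAt 𝓘(ℝ, E) p x) :=
  formSmoothAt_iff.trans ⟨chartRep_contDiffAt_change (mem_extChartAt_source x) hp,
    chartRep_contDiffAt_change hp (mem_extChartAt_source x)⟩

/-- `dForm` uses a different chart at every point, so by itself it says nothing about how `dForm w`
varies. Naturality under transition maps lets a single chart compute it on a neighbourhood;
smoothness of `dForm w` and `d² = 0` depend on this. -/
theorem chartRep_dForm {w : Form E M} {p x : M} (hp : x ∈ (extChartAt 𝓘(ℝ, E) p).source)
    (hw : FormSmoothAt w x) : chartRep (dForm w) p (extChartAt 𝓘(ℝ, E) p x) =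
      coordExtDeriv (chartRep w p) (extChartAt 𝓘(ℝ, E) p x) := by
  have hx := mem_extChartAt_source (I := 𝓘(ℝ, E)) x
  have : IsManifold 𝓘(ℝ, E) 1 M := IsManifold.of_le (n := ∞) (by simp)
  have hT : transition p x (extChartAt 𝓘(ℝ, E) x x) = extChartAt 𝓘(ℝ, E) p x := by
    rw [transition, (extChartAt 𝓘(ℝ, E) x).left_inv hx]
  have hw' := (formSmoothAt_iff_chart hp).mp hw
  rw [chartRep_apply _ hp, dForm_raw, coordExtDeriv_congr (eventually_chartRep_change w hp hx),
    coordExtDeriv_pull (transition_contDiffAt hp hx) (by rwa [hT]), hT, pull_pull, pull_pull]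
  -- The two transition maps are mutually inverse near the point, so their derivatives are too.
  have key : (fderiv ℝ (transition p x) (extChartAt 𝓘(ℝ, E) x x)).comp
      ((chartCLM x).comp (chartInvCLM p (extChartAt 𝓘(ℝ, E) p x))) =
        ContinuousLinearMap.id ℝ E := by
    have hT' : transition x p (extChartAt 𝓘(ℝ, E) p x) = extChartAt 𝓘(ℝ, E) x x := by
      rw [transition, (extChartAt 𝓘(ℝ, E) p).left_inv hp]
    rw [chartInvCLM_transition hx hp, ← ContinuousLinearMap.comp_assoc (chartCLM x),
      chartCLM_comp_chartInvCLM, ContinuousLinearMap.id_comp]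
    have h1 := ((transition_contDiffAt hx hp).differentiableAt (by simp)).hasFDerivAt
    have h2 := ((transition_contDiffAt hp hx).differentiableAt (by simp)).hasFDerivAt
    rw [← hT'] at h2
    have h3 := (h2.comp _ h1).fderiv
    rw [hT'] at h3
    rw [← h3]
    have he : transition p x ∘ transition x p =ᶠ[𝓝 (extChartAt 𝓘(ℝ, E) p x)] id := by
      have hc := continuousAt_extChartAt_symm' (I := 𝓘(ℝ, E)) hp
      rw [ContinuousAt, (extChartAt 𝓘(ℝ, E) p).left_inv hp] at hc
      filter_upwards [hc.eventually (extChartAt_source_mem_nhds' hx),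
        extChartAt_target_mem_nhds' ((extChartAt 𝓘(ℝ, E) p).map_source hp)] with y hy hy'
      rw [Function.comp_apply, transition, transition, (extChartAt 𝓘(ℝ, E) x).left_inv hy,
        (extChartAt 𝓘(ℝ, E) p).right_inv hy', id]
    rw [he.fderiv_eq, fderiv_id]
  rw [key, pull_id]

theorem eventually_chart_of_eventually {p x : M} (hp : x ∈ (extChartAt 𝓘(ℝ, E) p).source)
    {P : M → Prop} (h : ∀ᶠ z in 𝓝 x, P z) : ∀ᶠ y in 𝓝 (extChartAt 𝓘(ℝ, E) p x),
      ∃ z, z ∈ (extChartAt 𝓘(ℝ, E) p).source ∧ P z ∧ extChartAt 𝓘(ℝ, E) p z = y := by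
  have hc := continuousAt_extChartAt_symm' (I := 𝓘(ℝ, E)) hp
  rw [ContinuousAt, (extChartAt 𝓘(ℝ, E) p).left_inv hp] at hc
  filter_upwards [hc.eventually h,
    extChartAt_target_mem_nhds' ((extChartAt 𝓘(ℝ, E) p).map_source hp)] with y hy hy'
  exact ⟨_, (extChartAt 𝓘(ℝ, E) p).map_target hy', hy, (extChartAt 𝓘(ℝ, E) p).right_inv hy'⟩

theorem eventually_chartRep_dForm {w : Form E M} {p : M} (hw : ∀ᶠ x in 𝓝 p, FormSmoothAt w x) :
    chartRep (dForm w) p =ᶠ[𝓝 (extChartAt 𝓘(ℝ, E) p p)] coordExtDeriv (chartRep w p) := by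
  filter_upwards [eventually_chart_of_eventually (mem_extChartAt_source p) hw] with y hy
  obtain ⟨z, hz, hz', rfl⟩ := hy
  exact chartRep_dForm hz hz'

theorem FormSmoothAt.dForm {w : Form E M} {p : M} (hw : ∀ᶠ x in 𝓝 p, FormSmoothAt w x) :
    FormSmoothAt (dForm w) p := by
  rw [formSmoothAt_iff]
  exact (coordExtDeriv_contDiffAt (formSmoothAt_iff.mp hw.self_of_nhds)).congr_of_eventuallyEq
    (eventually_chartRep_dForm hw)

theorem dForm_dForm {w : Form E M} {p : M} (hw : ∀ᶠ x in 𝓝 p, FormSmoothAt w x) :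
    TwGerbe.dForm (TwGerbe.dForm w) p = 0 := by
  change (TwGerbe.dForm (TwGerbe.dForm w)).raw p = 0
  rw [dForm_raw, coordExtDeriv_congr (eventually_chartRep_dForm hw),
    coordExtDeriv_coordExtDeriv (formSmoothAt_iff.mp hw.self_of_nhds), map_zero]

theorem dForm_mem {k : ℕ} {w : Form E M} {p : M} (hs : FormSmoothAt w p)
    (hw : ∀ᶠ x in 𝓝 p, w x ∈ ⋀[ℂ]^k (Cotangent E x)) :
    TwGerbe.dForm w p ∈ ⋀[ℂ]^(k + 1) (Cotangent E p) := by
  rw [formSmoothAt_iff] at hs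
  refine map_mem_exteriorPower _ (coordExtDeriv_mem (hs.differentiableAt (by simp)) ?_)
  filter_upwards [eventually_chart_of_eventually (mem_extChartAt_source p) hw] with y hy
  obtain ⟨z, hz, hz', rfl⟩ := hy
  rw [chartRep_apply _ hz]
  exact map_mem_exteriorPower _ hz'

theorem coordExtDeriv_gradeInv {f : E → CoordForm E} {y : E} (hf : DifferentiableAt ℝ f y) :
    coordExtDeriv (fun z => gradeInv _ (f z)) y = -gradeInv _ (coordExtDeriv f y) := by
  let S : CoordForm E →L[ℝ] CoordForm E :=
    ((gradeInv (E →ₗ[ℝ] ℂ)).toLinearMap.restrictScalars ℝ).toContinuousLinearMap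
  have h : HasFDerivAt (fun z => gradeInv _ (f z)) (S.comp (fderiv ℝ f y)) y :=
    S.hasFDerivAt.comp y hf.hasFDerivAt
  rw [coordExtDeriv_eq hf, coordExtDeriv_eq h.differentiableAt, h.fderiv, wedgeD, wedgeD, map_sum,
    ← Finset.sum_neg_distrib]
  refine Finset.sum_congr rfl fun i _ => ?_
  rw [map_mul, dx, gradeInv_ι, neg_mul, neg_neg]
  rfl

theorem dForm_gradeInv {w : Form E M} {p : M} (hw : FormSmoothAt w p) :
    TwGerbe.dForm (formGradeInv E M w) p = -gradeInv _ (TwGerbe.dForm w p) := by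
  change (TwGerbe.dForm (formGradeInv E M w)).raw p = -gradeInv _ ((TwGerbe.dForm w).raw p)
  have : chartRep (formGradeInv E M w) p = fun y => gradeInv _ (chartRep w p y) := by
    funext y; exact chartRep_gradeInv w p y
  rw [formSmoothAt_iff] at hw
  rw [dForm_raw, dForm_raw, this, coordExtDeriv_gradeInv (hw.differentiableAt (by simp)), map_neg,
    pull, map_gradeInv]

/-- A complex-valued function, as a form of degree zero. -/
def ofFun (f : M → ℂ) : Form E M := fun x => algebraMap ℂ (ExteriorAlgebra ℂ (Cotangent E x)) (f x)

theorem chartRep_ofFun (f : M → ℂ) (p : M) (y : E) : chartRep (ofFun f : Form E M) p y =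
    algebraMap ℂ (CoordForm E) (f ((extChartAt 𝓘(ℝ, E) p).symm y)) := by
  rw [chartRep, ofFun, AlgHom.commutes]

theorem contDiffAt_chart {f : M → ℂ} {p : M} (h : ContMDiffAt 𝓘(ℝ, E) 𝓘(ℝ, ℂ) ∞ f p) :
    ContDiffAt ℝ ∞ (f ∘ (extChartAt 𝓘(ℝ, E) p).symm) (extChartAt 𝓘(ℝ, E) p p) := by
  have := (contMDiffAt_iff.mp h).2
  rw [modelWithCornersSelf_coe, Set.range_id, contDiffWithinAt_univ] at this
  exact this

theorem formSmoothAt_ofFun {f : M → ℂ} {p : M} (h : ContMDiffAt 𝓘(ℝ, E) 𝓘(ℝ, ℂ) ∞ f p) :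
    FormSmoothAt (ofFun f : Form E M) p := by
  intro l
  have h1 := contDiffAt_chart h
  have : (fun y => l (chartRep (ofFun f : Form E M) p y)) =
      fun y => (f ∘ (extChartAt 𝓘(ℝ, E) p).symm) y • l 1 := by
    funext y
    rw [chartRep_ofFun, Algebra.algebraMap_eq_smul_one, map_smul]
    rfl
  rw [this]
  exact h1.fun_smul contDiffAt_const

theorem coordExtDeriv_algebraMap {h : E → ℂ} {y : E} (hh : DifferentiableAt ℝ h y) :
    coordExtDeriv (fun z => algebraMap ℂ (CoordForm E) (h z)) y =
      ExteriorAlgebra.ι ℂ (fderiv ℝ h y).toLinearMap := by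
  have h1 : HasFDerivAt (fun z => algebraMap ℂ (CoordForm E) (h z))
      ((fderiv ℝ h y).smulRight (1 : CoordForm E)) y := by
    simp only [Algebra.algebraMap_eq_smul_one]
    exact hh.hasFDerivAt.smul_const _
  rw [coordExtDeriv_eq h1.differentiableAt, h1.fderiv, ← sum_smul_dx, wedgeD]
  refine Finset.sum_congr rfl fun i _ => ?_
  rw [ContinuousLinearMap.smulRight_apply, mul_smul_comm, mul_one]
  rfl

/-- This reconciles the two differentials in play: `dFun` from the Leibniz rule of a connection, and
the exterior derivative applied to entries of transition matrices. -/
theorem dForm_ofFun {f : M → ℂ} {p : M} (h : ContMDiffAt 𝓘(ℝ, E) 𝓘(ℝ, ℂ) ∞ f p) :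
    TwGerbe.dForm (ofFun f : Form E M) p = ExteriorAlgebra.ι ℂ (dFun f p) := by
  have : IsManifold 𝓘(ℝ, E) 1 M := IsManifold.of_le (n := ∞) (by simp)
  have hd := (contDiffAt_chart h).differentiableAt (by simp)
  have hr : chartRep (ofFun f : Form E M) p = fun y =>
      algebraMap ℂ (CoordForm E) ((f ∘ (extChartAt 𝓘(ℝ, E) p).symm) y) := by
    funext y; exact chartRep_ofFun f p y
  change (TwGerbe.dForm (ofFun f : Form E M)).raw p = _
  rw [dForm_raw, hr, coordExtDeriv_algebraMap hd, pull_ι]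
  have he : f =ᶠ[𝓝 p] (f ∘ (extChartAt 𝓘(ℝ, E) p).symm) ∘ extChartAt 𝓘(ℝ, E) p := by
    filter_upwards [extChartAt_source_mem_nhds (I := 𝓘(ℝ, E)) p] with y hy
    simp only [Function.comp_apply, (extChartAt 𝓘(ℝ, E) p).left_inv hy]
  have h1 : mfderiv 𝓘(ℝ, E) 𝓘(ℝ, ℂ) f p =
      (fderiv ℝ (f ∘ (extChartAt 𝓘(ℝ, E) p).symm) (extChartAt 𝓘(ℝ, E) p p)).comp (chartCLM p) := by
    rw [← mfderiv_eq_fderiv]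
    exact he.mfderiv_eq.trans (mfderiv_comp p hd.mdifferentiableAt
      (mdifferentiableAt_extChartAt (mem_chart_source E p)))
  have h2 : dFun f p = (fderiv ℝ (f ∘ (extChartAt 𝓘(ℝ, E) p).symm)
      (extChartAt 𝓘(ℝ, E) p p)).toLinearMap ∘ₗ (chartCLM p).toLinearMap := by
    rw [dFun, h1]
    rfl
  rw [h2]
  rfl

end ChartChange

/-! ## Graded commutative differential graded algebras -/

/-- A graded-commutative differential algebra, with the grading recorded by an involution only. -/
structure GCDGA (R : Type*) [Ring R] [Algebra ℂ R] where
  d : R →ₗ[ℂ] R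
  inv : R →ₐ[ℂ] R
  leibniz : ∀ a b, d (a * b) = d a * b + inv a * d b
  d_d : ∀ a, d (d a) = 0
  d_inv : ∀ a, d (inv a) = -inv (d a)
  even_comm : ∀ a b, inv a = a → a * b = b * a
  odd_comm : ∀ a b, inv a = -a → a * b = inv b * a

section Abstract

variable {R : Type*} [Ring R] [Algebra ℂ R] (D : GCDGA R)
variable {l m n : Type*} [Fintype l] [Fintype m] [Fintype n] [DecidableEq l] [DecidableEq m]
  [DecidableEq n]

namespace GCDGA

def IsEven (a : R) : Prop := D.inv a = a

def IsOdd (a : R) : Prop := D.inv a = -a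

def MEven {m n : Type*} (A : Matrix m n R) : Prop := ∀ i j, D.IsEven (A i j)

def MOdd {m n : Type*} (A : Matrix m n R) : Prop := ∀ i j, D.IsOdd (A i j)

/-- Entrywise differential of a matrix. -/
def dM {m n : Type*} (A : Matrix m n R) : Matrix m n R := A.map D.d

variable {D}

theorem IsEven.add {a b : R} (ha : D.IsEven a) (hb : D.IsEven b) : D.IsEven (a + b) := by
  rw [IsEven, map_add, ha, hb]

theorem IsEven.mul {a b : R} (ha : D.IsEven a) (hb : D.IsEven b) : D.IsEven (a * b) := by
  rw [IsEven, map_mul, ha, hb]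

theorem IsEven.mul_odd {a b : R} (ha : D.IsEven a) (hb : D.IsOdd b) : D.IsOdd (a * b) := by
  rw [IsOdd, map_mul, ha, hb, mul_neg]

theorem IsOdd.mul_even {a b : R} (ha : D.IsOdd a) (hb : D.IsEven b) : D.IsOdd (a * b) := by
  rw [IsOdd, map_mul, ha, hb, neg_mul]

theorem IsOdd.mul {a b : R} (ha : D.IsOdd a) (hb : D.IsOdd b) : D.IsEven (a * b) := by
  rw [IsEven, map_mul, ha, hb, neg_mul_neg]

theorem IsOdd.add {a b : R} (ha : D.IsOdd a) (hb : D.IsOdd b) : D.IsOdd (a + b) := by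
  rw [IsOdd, map_add, ha, hb, neg_add]

theorem isEven_zero : D.IsEven 0 := map_zero _

theorem isEven_one : D.IsEven 1 := map_one _

theorem IsEven.smul (c : ℂ) {a : R} (ha : D.IsEven a) : D.IsEven (c • a) := by
  rw [IsEven, map_smul, ha]

theorem IsEven.sum {ι : Type*} {s : Finset ι} {f : ι → R} (h : ∀ i ∈ s, D.IsEven (f i)) :
    D.IsEven (∑ i ∈ s, f i) := by
  rw [IsEven, map_sum]
  exact Finset.sum_congr rfl h

theorem IsOdd.sum {ι : Type*} {s : Finset ι} {f : ι → R} (h : ∀ i ∈ s, D.IsOdd (f i)) :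
    D.IsOdd (∑ i ∈ s, f i) := by
  rw [IsOdd, map_sum, ← Finset.sum_neg_distrib]
  exact Finset.sum_congr rfl h

theorem IsEven.d {a : R} (ha : D.IsEven a) : D.IsOdd (D.d a) := by
  have := D.d_inv a
  rw [ha] at this
  rw [IsOdd, ← neg_eq_iff_eq_neg.mpr this]

theorem IsOdd.d {a : R} (ha : D.IsOdd a) : D.IsEven (D.d a) := by
  have := D.d_inv a
  rw [ha, map_neg, neg_inj] at this
  exact this.symm

theorem IsEven.comm {a : R} (ha : D.IsEven a) (b : R) : a * b = b * a := D.even_comm a b ha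

theorem IsOdd.comm {a b : R} (ha : D.IsOdd a) (hb : D.IsOdd b) : a * b = -(b * a) := by
  rw [D.odd_comm a b ha, hb, neg_mul]

theorem IsOdd.mul_self {a : R} (ha : D.IsOdd a) : a * a = 0 := by
  have h := ha.comm ha
  have h2 : (2 : ℂ) • (a * a) = 0 := by
    rw [two_smul]
    exact add_eq_zero_iff_eq_neg.mpr h
  exact (smul_eq_zero_iff_right (two_ne_zero)).mp h2

theorem d_one : D.d 1 = 0 := by
  have := D.leibniz 1 1
  simpa using this

theorem IsEven.leibniz {a : R} (ha : D.IsEven a) (b : R) :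
    D.d (a * b) = D.d a * b + a * D.d b := by
  rw [D.leibniz, ha]

theorem IsOdd.leibniz {a : R} (ha : D.IsOdd a) (b : R) :
    D.d (a * b) = D.d a * b - a * D.d b := by
  rw [D.leibniz, ha, neg_mul, sub_eq_add_neg]

/-! ### Matrices -/

theorem MEven.mul {A : Matrix l m R} {B : Matrix m n R} (hA : D.MEven A) (hB : D.MEven B) :
    D.MEven (A * B) := fun i j => by
  rw [Matrix.mul_apply]; exact IsEven.sum fun k _ => (hA i k).mul (hB k j)

theorem MOdd.mul {A : Matrix l m R} {B : Matrix m n R} (hA : D.MOdd A) (hB : D.MOdd B) :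
    D.MEven (A * B) := fun i j => by
  rw [Matrix.mul_apply]; exact IsEven.sum fun k _ => (hA i k).mul (hB k j)

theorem MOdd.mul_even {A : Matrix l m R} {B : Matrix m n R} (hA : D.MOdd A) (hB : D.MEven B) :
    D.MOdd (A * B) := fun i j => by
  rw [Matrix.mul_apply]; exact IsOdd.sum fun k _ => (hA i k).mul_even (hB k j)

theorem MEven.add {A B : Matrix m n R} (hA : D.MEven A) (hB : D.MEven B) : D.MEven (A + B) :=
  fun i j => (hA i j).add (hB i j)

theorem MOdd.add {A B : Matrix m n R} (hA : D.MOdd A) (hB : D.MOdd B) : D.MOdd (A + B) :=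
  fun i j => (hA i j).add (hB i j)

theorem MOdd.dM {A : Matrix m n R} (hA : D.MOdd A) : D.MEven (D.dM A) := fun i j => (hA i j).d

theorem MEven.scalar {a : R} (ha : D.IsEven a) : D.MEven (Matrix.scalar n a) := fun i j => by
  rw [Matrix.scalar_apply, Matrix.diagonal_apply]
  split_ifs
  exacts [ha, isEven_zero]

theorem MEven.pow {A : Matrix n n R} (hA : D.MEven A) (k : ℕ) : D.MEven (A ^ k) := by
  induction k with
  | zero =>
    rw [pow_zero, ← map_one (Matrix.scalar n)]
    exact MEven.scalar isEven_one
  | succ k ih => rw [pow_succ]; exact ih.mul hA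

theorem dM_add (A B : Matrix m n R) : D.dM (A + B) = D.dM A + D.dM B := by
  ext i j; simp [dM]

theorem dM_scalar (a : R) : D.dM (Matrix.scalar n a) = Matrix.scalar n (D.d a) := by
  ext i j
  simp only [dM, Matrix.map_apply, Matrix.scalar_apply, Matrix.diagonal_apply]
  split_ifs <;> simp

theorem dM_dM (A : Matrix m n R) : D.dM (D.dM A) = 0 := by
  ext i j; simp [dM, D.d_d]

theorem MEven.leibniz {A : Matrix l m R} (hA : D.MEven A) (B : Matrix m n R) :
    D.dM (A * B) = D.dM A * B + A * D.dM B := by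
  ext i j
  simp only [dM, Matrix.map_apply, Matrix.mul_apply, Matrix.add_apply, map_sum,
    ← Finset.sum_add_distrib]
  exact Finset.sum_congr rfl fun k _ => (hA i k).leibniz _

theorem MOdd.leibniz {A : Matrix l m R} (hA : D.MOdd A) (B : Matrix m n R) :
    D.dM (A * B) = D.dM A * B - A * D.dM B := by
  ext i j
  simp only [GCDGA.dM, Matrix.map_apply, Matrix.mul_apply, Matrix.sub_apply, map_sum,
    ← Finset.sum_sub_distrib]
  exact Finset.sum_congr rfl fun k _ => (hA i k).leibniz _

theorem MEven.trace_comm {A : Matrix m n R} (hA : D.MEven A) (B : Matrix n m R) :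
    (A * B).trace = (B * A).trace := by
  simp only [Matrix.trace, Matrix.diag_apply, Matrix.mul_apply]
  rw [Finset.sum_comm]
  exact Finset.sum_congr rfl fun i _ => Finset.sum_congr rfl fun j _ => (hA j i).comm _

theorem MOdd.trace_comm {A : Matrix m n R} {B : Matrix n m R} (hA : D.MOdd A) (hB : D.MOdd B) :
    (A * B).trace = -(B * A).trace := by
  simp only [Matrix.trace, Matrix.diag_apply, Matrix.mul_apply]
  rw [Finset.sum_comm, ← Finset.sum_neg_distrib]
  refine Finset.sum_congr rfl fun i _ => ?_
  rw [← Finset.sum_neg_distrib]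
  exact Finset.sum_congr rfl fun j _ => (hA j i).comm (hB i j)

theorem d_trace (A : Matrix n n R) : D.d A.trace = (D.dM A).trace := by
  simp [Matrix.trace, dM]

theorem trace_scalar_mul (a : R) (A : Matrix n n R) :
    (Matrix.scalar n a * A).trace = a * A.trace := by
  simp [Matrix.trace, Finset.mul_sum]

theorem IsEven.scalar_mul {a : R} (ha : D.IsEven a) (A : Matrix m n R) :
    Matrix.scalar m a * A = A * Matrix.scalar n a := by
  ext i j; simp [ha.comm]

theorem IsOdd.scalar_mul_even {a : R} (A : Matrix m n R) (hA : D.MEven A) :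
    Matrix.scalar m a * A = A * Matrix.scalar n a := by
  ext i j; simp [(hA i j).comm]

theorem IsOdd.scalar_mul_odd {a : R} (ha : D.IsOdd a) {A : Matrix m n R} (hA : D.MOdd A) :
    Matrix.scalar m a * A = -(A * Matrix.scalar n a) := by
  ext i j; simp [ha.comm (hA i j)]

variable (D) in
/-- The curvature matrix of a connection matrix. -/
def curv (A : Matrix n n R) : Matrix n n R := D.dM A + A * A

theorem MOdd.curv {A : Matrix n n R} (hA : D.MOdd A) : D.MEven (D.curv A) := hA.dM.add (hA.mul hA)

/-- The cross terms cancel because odd elements anticommute, and `a² = 0`. So tensoring with a line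
bundle shifts the curvature by `da` only. -/
theorem curv_add_scalar {A : Matrix n n R} (hA : D.MOdd A) {a : R} (ha : D.IsOdd a) :
    D.curv (A + Matrix.scalar n a) = D.curv A + Matrix.scalar n (D.d a) := by
  have h : Matrix.scalar n a * Matrix.scalar n a = 0 := by
    rw [← map_mul, ha.mul_self, map_zero]
  rw [GCDGA.curv, GCDGA.curv, dM_add, dM_scalar, mul_add, add_mul, add_mul, h,
    ha.scalar_mul_odd hA]
  abel

/-- Differentiate the relation, use `d² g = 0`, and substitute `A' g = g A - dg` where needed. No
invertibility of `g` enters, and `g` may be rectangular. -/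
theorem gauge_curv {g : Matrix m n R} (hg : D.MEven g) {A' : Matrix m m R} {A : Matrix n n R}
    (hA' : D.MOdd A') (h : A' * g + D.dM g = g * A) : D.curv A' * g = g * D.curv A := by
  have h1 := congrArg D.dM h
  rw [dM_add, dM_dM, add_zero, hA'.leibniz, hg.leibniz] at h1
  have h2 : A' * g = g * A - D.dM g := eq_sub_of_add_eq h
  have h3 : A' * (A' * g) = g * A * A - D.dM g * A - A' * D.dM g := by
    rw [h2, Matrix.mul_sub, ← Matrix.mul_assoc, h2, Matrix.sub_mul]
  have h4 : D.dM A' * g = D.dM g * A + g * D.dM A + A' * D.dM g := by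
    rw [← h1]; abel
  rw [GCDGA.curv, GCDGA.curv, Matrix.add_mul, Matrix.mul_add, Matrix.mul_assoc A', h3, h4,
    ← Matrix.mul_assoc]
  abel

/-- The Bianchi identity. -/
theorem dM_curv {A : Matrix n n R} (hA : D.MOdd A) :
    D.dM (D.curv A) = D.curv A * A - A * D.curv A := by
  rw [GCDGA.curv, dM_add, dM_dM, hA.leibniz, add_mul, mul_add, mul_assoc]
  abel

variable {A : Matrix n n R} {w : R}

/-- Both `d` and the commutator with `A` are derivations on even matrices, so the Bianchi identity
for `θ` propagates to powers; each factor contributes one `dω`, which commutes with even matrices.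
-/
theorem dM_theta_pow (hA : D.MOdd A) (hw : D.IsEven w) (k : ℕ) :
    D.dM ((D.curv A + Matrix.scalar n w) ^ (k + 1)) =
      (D.curv A + Matrix.scalar n w) ^ (k + 1) * A - A * (D.curv A + Matrix.scalar n w) ^ (k + 1) +
        (k + 1) • (Matrix.scalar n (D.d w) * (D.curv A + Matrix.scalar n w) ^ k) := by
  set T := D.curv A + Matrix.scalar n w with hT
  have hTe : D.MEven T := hA.curv.add (MEven.scalar hw)
  have h1 : D.dM T = T * A - A * T + Matrix.scalar n (D.d w) := by
    rw [hT, dM_add, dM_scalar, dM_curv hA, add_mul, mul_add, hw.scalar_mul]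
    abel
  induction k with
  | zero => simpa using h1
  | succ k ih =>
    rw [pow_succ T (k + 1), (hTe.pow (k + 1)).leibniz, ih, h1]
    clear_value T
    have h2 : T ^ (k + 1) * Matrix.scalar n (D.d w) = Matrix.scalar n (D.d w) * T ^ (k + 1) :=
      (IsOdd.scalar_mul_even _ (hTe.pow (k + 1))).symm
    rw [add_mul, sub_mul, mul_add, mul_sub, h2, smul_mul_assoc, mul_assoc _ (T ^ k) T, ← pow_succ,
      add_smul (k + 1) 1, one_smul]
    simp only [mul_assoc]
    abel

theorem d_trace_theta_pow (hA : D.MOdd A) (hw : D.IsEven w) (k : ℕ) :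
    D.d (((D.curv A + Matrix.scalar n w) ^ (k + 1)).trace) =
      (k + 1) • (D.d w * ((D.curv A + Matrix.scalar n w) ^ k).trace) := by
  have hTe : D.MEven (D.curv A + Matrix.scalar n w) := hA.curv.add (MEven.scalar hw)
  rw [d_trace, dM_theta_pow hA hw, Matrix.trace_add, Matrix.trace_sub, Matrix.trace_smul,
    trace_scalar_mul, (hTe.pow (k + 1)).trace_comm, sub_self, zero_add]

/-- The infinitesimal form of the transgression formula: the commutator with `A` moves onto `B`, and
oddness of `B` turns it into the anticommutator, giving the covariant derivative of `B`. -/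
theorem d_trace_mul_theta_pow (hA : D.MOdd A) (hw : D.IsEven w) {B : Matrix n n R}
    (hB : D.MOdd B) (k : ℕ) :
    D.d ((B * (D.curv A + Matrix.scalar n w) ^ (k + 1)).trace) =
      ((D.dM B + A * B + B * A) * (D.curv A + Matrix.scalar n w) ^ (k + 1)).trace +
      (k + 1) • (D.d w * (B * (D.curv A + Matrix.scalar n w) ^ k).trace) := by
  have hTe : D.MEven (D.curv A + Matrix.scalar n w) := hA.curv.add (MEven.scalar hw)
  rw [d_trace, hB.leibniz, dM_theta_pow hA hw]
  set T := D.curv A + Matrix.scalar n w with hT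
  -- Both `B T^(k+1)` and `A` are odd, so cyclicity of the trace costs a sign.
  have h1 : (B * (T ^ (k + 1) * A)).trace = -(A * B * T ^ (k + 1)).trace := by
    rw [← mul_assoc, (hB.mul_even (hTe.pow _)).trace_comm hA, mul_assoc]
  have h2 : B * Matrix.scalar n (D.d w) = -(Matrix.scalar n (D.d w) * B) := by
    rw [hw.d.scalar_mul_odd hB, neg_neg]
  rw [mul_add, mul_sub, mul_smul_comm, ← mul_assoc B (Matrix.scalar n _), h2, neg_mul,
    mul_assoc _ B, add_mul, add_mul, Matrix.trace_sub, Matrix.trace_add, Matrix.trace_add,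
    Matrix.trace_add, Matrix.trace_sub, h1, Matrix.trace_smul, Matrix.trace_neg,
    trace_scalar_mul, ← mul_assoc, smul_neg]
  abel

theorem d_trace_mul_theta_pow_zero (hA : D.MOdd A) {B : Matrix n n R} (hB : D.MOdd B) :
    D.d B.trace = (D.dM B + A * B + B * A).trace := by
  rw [d_trace, Matrix.trace_add, Matrix.trace_add, hA.trace_comm hB]
  abel

end GCDGA

end Abstract

/-! ### Adjoining a central closed variable, and integrating over it. -/

section PolyDGA

variable {R : Type*} [Ring R] [Algebra ℂ R]

/-- Coefficientwise application of a linear map to polynomials. -/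
def mapCoeff (f : R →ₗ[ℂ] R) : R[X] →ₗ[ℂ] R[X] :=
  Polynomial.lsum fun k => (monomial k).restrictScalars ℂ ∘ₗ f

theorem mapCoeff_apply (f : R →ₗ[ℂ] R) (ξ : R[X]) :
    mapCoeff f ξ = ξ.sum fun k a => monomial k (f a) := rfl

theorem mapCoeff_monomial (f : R →ₗ[ℂ] R) (k : ℕ) (a : R) :
    mapCoeff f (monomial k a) = monomial k (f a) := by
  rw [mapCoeff_apply, Polynomial.sum_monomial_index _ _ (by simp)]

theorem coeff_mapCoeff (f : R →ₗ[ℂ] R) (ξ : R[X]) (k : ℕ) :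
    (mapCoeff f ξ).coeff k = f (ξ.coeff k) := by
  induction ξ using Polynomial.induction_on' with
  | add p q hp hq => rw [map_add, coeff_add, coeff_add, hp, hq, map_add]
  | monomial n a =>
    rw [mapCoeff_monomial, coeff_monomial, coeff_monomial]
    split_ifs <;> simp

variable (D : GCDGA R)

/-- Polynomials over a graded-commutative differential algebra. -/
def GCDGA.poly : GCDGA R[X] where
  d := mapCoeff D.d
  inv := Polynomial.mapAlgHom D.inv
  leibniz a b := by
    ext k
    simp only [coeff_mapCoeff, coeff_add, coeff_mul, map_sum, D.leibniz, Finset.sum_add_distrib,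
      Polynomial.coe_mapAlgHom, coeff_map, RingHom.coe_coe]
  d_d a := by
    ext k
    simp only [coeff_mapCoeff, D.d_d, coeff_zero]
  d_inv a := by
    ext k
    simp only [coeff_mapCoeff, Polynomial.coe_mapAlgHom, coeff_map, RingHom.coe_coe, D.d_inv,
      coeff_neg]
  even_comm a b h := by
    have h' : ∀ k, D.inv (a.coeff k) = a.coeff k := fun k => by
      have := congrArg (fun f => Polynomial.coeff f k) h
      simpa only [Polynomial.coe_mapAlgHom, coeff_map, RingHom.coe_coe] using this
    ext k
    rw [coeff_mul, coeff_mul, ← Finset.Nat.sum_antidiagonal_swap]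
    exact Finset.sum_congr rfl fun i _ => D.even_comm _ _ (h' _)
  odd_comm a b h := by
    have h' : ∀ k, D.inv (a.coeff k) = -a.coeff k := fun k => by
      have := congrArg (fun f => Polynomial.coeff f k) h
      simpa only [Polynomial.coe_mapAlgHom, coeff_map, RingHom.coe_coe, coeff_neg] using this
    ext k
    rw [coeff_mul, coeff_mul, ← Finset.Nat.sum_antidiagonal_swap]
    refine Finset.sum_congr rfl fun i _ => ?_
    rw [Polynomial.coe_mapAlgHom, coeff_map]
    exact D.odd_comm _ _ (h' _)

theorem GCDGA.coeff_poly_d (ξ : R[X]) (k : ℕ) : (D.poly.d ξ).coeff k = D.d (ξ.coeff k) :=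
  coeff_mapCoeff _ _ _

theorem GCDGA.coeff_poly_inv (ξ : R[X]) (k : ℕ) : (D.poly.inv ξ).coeff k = D.inv (ξ.coeff k) :=
  coeff_map _ _

theorem GCDGA.poly_d_C (a : R) : D.poly.d (C a) = C (D.d a) := mapCoeff_monomial _ 0 a

theorem GCDGA.poly_inv_C (a : R) : D.poly.inv (C a) = C (D.inv a) := by
  ext k
  rw [D.coeff_poly_inv, coeff_C, coeff_C]
  split_ifs <;> simp

theorem GCDGA.poly_d_X_mul (ξ : R[X]) : D.poly.d (X * ξ) = X * D.poly.d ξ := by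
  ext k
  cases k with
  | zero => simp [D.coeff_poly_d]
  | succ k => simp only [D.coeff_poly_d, coeff_X_mul]

theorem GCDGA.poly_inv_X : D.poly.inv X = X := Polynomial.map_X _

/-- Formal integration over the unit interval. -/
def integral01 (R : Type*) [Ring R] [Algebra ℂ R] : R[X] →ₗ[ℂ] R :=
  Polynomial.lsum fun k => ((k : ℂ) + 1)⁻¹ • LinearMap.id

theorem integral01_monomial (k : ℕ) (a : R) :
    integral01 R (monomial k a) = ((k : ℂ) + 1)⁻¹ • a :=
  Polynomial.sum_monomial_index _ _ (by simp)

/-- Evaluation of the central variable at `1`. -/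
def evalOne (R : Type*) [Ring R] [Algebra ℂ R] : R[X] →+* R :=
  eval₂RingHom' (RingHom.id R) 1 fun a => Commute.one_right a

/-- Evaluation of the central variable at `0`. -/
def evalZero (R : Type*) [Ring R] [Algebra ℂ R] : R[X] →+* R :=
  eval₂RingHom' (RingHom.id R) 0 fun a => Commute.zero_right a

/-- The fundamental theorem of calculus in the path parameter, checked on monomials. -/
theorem integral01_derivative (f : R[X]) :
    integral01 R (derivative f) = evalOne R f - evalZero R f := by
  induction f using Polynomial.induction_on' with
  | add p q hp hq => rw [derivative_add, map_add, hp, hq, map_add, map_add]; abel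
  | monomial n a =>
    have h1 : evalOne R (monomial n a) = a := by simp [evalOne]
    rw [h1, derivative_monomial, integral01_monomial]
    cases n with
    | zero => simp [evalZero]
    | succ n =>
      have h0 : evalZero R (monomial (n + 1) a) = 0 := by simp [evalZero]
      rw [h0, sub_zero, Nat.add_sub_cancel, ← nsmul_eq_mul', ← Nat.cast_smul_eq_nsmul ℂ, smul_smul,
        Nat.cast_add, Nat.cast_one, inv_mul_cancel₀ (Nat.cast_add_one_ne_zero n), one_smul]

theorem integral01_C_mul (a : R) (f : R[X]) :
    integral01 R (C a * f) = a * integral01 R f := by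
  induction f using Polynomial.induction_on' with
  | add p q hp hq => rw [mul_add, map_add, hp, hq, map_add, mul_add]
  | monomial n b => rw [C_mul_monomial, integral01_monomial, integral01_monomial, mul_smul_comm]

/-- The differential on polynomials acts on coefficients and has no `dt` component. -/
theorem integral01_d (f : R[X]) : integral01 R (D.poly.d f) = D.d (integral01 R f) := by
  induction f using Polynomial.induction_on' with
  | add p q hp hq => rw [map_add, map_add, hp, hq, map_add, map_add]
  | monomial n a =>
    rw [integral01_monomial, map_smul, ← integral01_monomial]
    exact congrArg _ (mapCoeff_monomial _ n a)

theorem integral01_map {S : Type*} [Ring S] [Algebra ℂ S] (φ : R →ₐ[ℂ] S) (f : R[X]) :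
    integral01 S (f.map φ.toRingHom) = φ (integral01 R f) := by
  induction f using Polynomial.induction_on' with
  | add p q hp hq => rw [Polynomial.map_add, map_add, hp, hq, map_add, map_add]
  | monomial n a =>
    rw [map_monomial, integral01_monomial, integral01_monomial, map_smul]
    rfl

end PolyDGA

/-! ### Chern traces and transgression forms of matrices. -/

section Transgression

variable {R : Type*} [Ring R] [Algebra ℂ R]
variable {m n : Type*} [Fintype m] [DecidableEq m] [Fintype n] [DecidableEq n]

/-- The degree `k` part of `tr exp(cT)`. -/
def chernTr (c : ℂ) (T : Matrix n n R) (k : ℕ) : R :=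
  ((k.factorial : ℂ)⁻¹ * c ^ k) • (T ^ k).trace

/-- The path `T₀ + t (T₁ - T₀ - B²) + t² B²` of curvatures between `T₀` and `T₁`. -/
def curvPath (B T₀ T₁ : Matrix n n R) : Matrix n n R[X] :=
  T₀.map C + Matrix.scalar n X * (T₁ - T₀ - B * B).map C +
    Matrix.scalar n (X * X) * (B * B).map C

/-- The transgression of the degree `k + 1` part of the Chern character along the path. -/
def transgress (c : ℂ) (B T₀ T₁ : Matrix n n R) (k : ℕ) : R :=
  ((k.factorial : ℂ)⁻¹ * c ^ (k + 1)) •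
    integral01 R ((B.map C * curvPath B T₀ T₁ ^ k).trace)

/-- Naturality, here and for `transgress`, is what allows identities to be proved for germs and then
read off at a point. -/
theorem chernTr_map {S : Type*} [Ring S] [Algebra ℂ S] (φ : R →ₐ[ℂ] S) (c : ℂ)
    (T : Matrix n n R) (k : ℕ) : chernTr c (T.map φ) k = φ (chernTr c T k) := by
  have h : (T.map φ) ^ k = (T ^ k).map φ := (map_pow φ.mapMatrix T k).symm
  rw [chernTr, chernTr, map_smul, h]
  congr 1
  exact (AddMonoidHom.map_trace φ.toRingHom.toAddMonoidHom _).symm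

theorem matrix_map_C_map {S : Type*} [Ring S] [Algebra ℂ S] (φ : R →ₐ[ℂ] S)
    (T : Matrix n n R) : (T.map φ).map C = (T.map C).map (Polynomial.mapRingHom φ.toRingHom) := by
  ext i j : 2
  simp

theorem curvPath_map {S : Type*} [Ring S] [Algebra ℂ S] (φ : R →ₐ[ℂ] S)
    (B T₀ T₁ : Matrix n n R) : curvPath (B.map φ) (T₀.map φ) (T₁.map φ) =
      (Polynomial.mapRingHom φ.toRingHom).mapMatrix (curvPath B T₀ T₁) := by
  have h1 : B.map φ * B.map φ = (B * B).map φ := (map_mul φ.mapMatrix B B).symm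
  have h2 : T₁.map φ - T₀.map φ - (B * B).map φ = (T₁ - T₀ - B * B).map φ := by
    ext i j; simp only [Matrix.sub_apply, Matrix.map_apply, map_sub]
  have h3 : ∀ s : R[X], (Polynomial.mapRingHom φ.toRingHom).mapMatrix (Matrix.scalar n s) =
      Matrix.scalar n (Polynomial.mapRingHom φ.toRingHom s) := fun s => by
    ext i j : 2
    simp only [RingHom.mapMatrix_apply, Matrix.map_apply, Matrix.scalar_apply,
      Matrix.diagonal_apply]
    split_ifs <;> simp
  rw [curvPath, curvPath, h1, h2, map_add, map_add, (RingHom.mapMatrix _).map_mul,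
    (RingHom.mapMatrix _).map_mul, h3, h3,
    matrix_map_C_map, matrix_map_C_map, matrix_map_C_map]
  simp

theorem transgress_map {S : Type*} [Ring S] [Algebra ℂ S] (φ : R →ₐ[ℂ] S) (c : ℂ)
    (B T₀ T₁ : Matrix n n R) (k : ℕ) :
    transgress c (B.map φ) (T₀.map φ) (T₁.map φ) k = φ (transgress c B T₀ T₁ k) := by
  rw [transgress, transgress, map_smul, curvPath_map, ← map_pow, matrix_map_C_map,
    ← integral01_map]
  congr 2
  rw [← RingHom.mapMatrix_apply, ← map_mul]
  exact (AddMonoidHom.map_trace (Polynomial.mapRingHom φ.toRingHom).toAddMonoidHom _).symm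

theorem derivative_trace (T : Matrix n n R[X]) :
    derivative T.trace = (T.map derivative).trace := by
  simp [Matrix.trace]

theorem map_derivative_mul (S T : Matrix n n R[X]) :
    (S * T).map derivative = S.map derivative * T + S * T.map derivative := by
  ext i j : 2
  simp only [Matrix.map_apply, Matrix.mul_apply, Matrix.add_apply, derivative_sum, derivative_mul,
    Finset.sum_add_distrib]

variable (D : GCDGA R)

/-- Although `T` need not commute with its derivative, the trace permits cyclic reordering. The
extra factor `T ^ j` is there to make the induction close; only `j = 0` is used later. -/
theorem derivative_trace_pow {T : Matrix n n R[X]} (hT : D.poly.MEven T) (k j : ℕ) :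
    ((T ^ (k + 1)).map derivative * T ^ j).trace =
      (k + 1) • (T.map derivative * T ^ (k + j)).trace := by
  induction k generalizing j with
  | zero => simp
  | succ k ih =>
    rw [pow_succ T (k + 1), map_derivative_mul, add_mul, mul_assoc _ T, ← pow_succ',
      Matrix.trace_add, ih, mul_assoc, (hT.pow (k + 1)).trace_comm, mul_assoc, ← pow_add,
      add_smul (k + 1) 1, one_smul, add_right_comm k 1 j, add_comm j (k + 1), add_right_comm k 1 j]
    rfl

end Transgression

/-! ### The affine path of connections and the transgression formula. -/

section Homotopy

variable {R : Type*} [Ring R] [Algebra ℂ R] (D : GCDGA R)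
variable {m n : Type*} [Fintype m] [DecidableEq m] [Fintype n] [DecidableEq n]

theorem GCDGA.IsOdd.poly_C {a : R} (ha : D.IsOdd a) : D.poly.IsOdd (C a) := by
  rw [IsOdd, D.poly_inv_C, ha, C_neg]

theorem GCDGA.IsEven.poly_C {a : R} (ha : D.IsEven a) : D.poly.IsEven (C a) := by
  rw [IsEven, D.poly_inv_C, ha]

theorem GCDGA.isEven_X : D.poly.IsEven (X : R[X]) := D.poly_inv_X

theorem GCDGA.MOdd.map_C {A : Matrix m n R} (hA : D.MOdd A) : D.poly.MOdd (A.map C) :=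
  fun i j => (hA i j).poly_C

theorem GCDGA.dM_map_C (A : Matrix m n R) : D.poly.dM (A.map C) = (D.dM A).map C := by
  exact Matrix.ext fun i j => D.poly_d_C _

theorem GCDGA.dM_X_mul (A : Matrix n n R[X]) :
    D.poly.dM (Matrix.scalar n X * A) = Matrix.scalar n X * D.poly.dM A := by
  ext i j : 2
  simp [GCDGA.dM, D.poly_d_X_mul]

theorem matrix_mul_map_C (A B : Matrix n n R) : (A * B).map C = A.map C * B.map C :=
  map_mul (RingHom.mapMatrix (C : R →+* R[X])) A B

theorem matrix_add_map_C (A B : Matrix n n R) : (A + B).map C = A.map C + B.map C :=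
  map_add (RingHom.mapMatrix (C : R →+* R[X])) A B

theorem scalar_X_comm (A : Matrix n n R[X]) :
    A * Matrix.scalar n X = Matrix.scalar n X * A := by
  ext i j : 2
  simp [Polynomial.X_mul]

/-- The affine path of connection matrices. -/
def connPath (A B : Matrix n n R) : Matrix n n R[X] := A.map C + Matrix.scalar n X * B.map C

variable {D} {A B : Matrix n n R} {w : R}

theorem connPath_odd (hA : D.MOdd A) (hB : D.MOdd B) : D.poly.MOdd (connPath A B) := by
  refine (GCDGA.MOdd.map_C D hA).add fun i j => ?_
  simp only [Matrix.scalar_apply, Matrix.diagonal_mul, Matrix.map_apply]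
  exact D.isEven_X.mul_odd ((hB i j).poly_C)

theorem curv_add_sub (A B : Matrix n n R) (w : R) :
    (D.curv (A + B) + Matrix.scalar n w) - (D.curv A + Matrix.scalar n w) - B * B =
      D.dM B + A * B + B * A := by
  rw [GCDGA.curv, GCDGA.curv, GCDGA.dM_add, mul_add, add_mul, add_mul]
  abel

/-- The curvature of `A + tB` is `dA + A² + t(dB + AB + BA) + t²B²`, and its middle coefficient is
`T₁ - T₀ - B²`. Writing the path through `B`, `T₀`, `T₁` alone matters because these are conjugated
under a change of frame, while `A` is not. -/
theorem curvPath_eq (A B : Matrix n n R) (w : R) :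
    curvPath B (D.curv A + Matrix.scalar n w) (D.curv (A + B) + Matrix.scalar n w) =
      D.poly.curv (connPath A B) + Matrix.scalar n (C w) := by
  have h : (Matrix.scalar n w).map C = Matrix.scalar n (C w) := by
    ext i j : 2
    simp only [Matrix.map_apply, Matrix.scalar_apply, Matrix.diagonal_apply]
    split_ifs <;> simp
  have hx : A.map C * (Matrix.scalar n X * B.map C) =
      Matrix.scalar n X * (A.map C * B.map C) := by
    rw [← mul_assoc, scalar_X_comm, mul_assoc]
  have hy : B.map C * (Matrix.scalar n X * B.map C) =
      Matrix.scalar n X * (B.map C * B.map C) := by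
    rw [← mul_assoc, scalar_X_comm, mul_assoc]
  rw [curvPath, curv_add_sub, GCDGA.curv, GCDGA.curv, connPath, GCDGA.dM_add, GCDGA.dM_map_C,
    GCDGA.dM_X_mul, GCDGA.dM_map_C]
  simp only [matrix_add_map_C, matrix_mul_map_C, h, mul_add, add_mul, mul_assoc, map_mul, hx, hy]
  abel

/-- The velocity of the curvature is the covariant derivative of `B`, precisely the factor that
appears in `GCDGA.d_trace_mul_theta_pow`. -/
theorem curvPath_derivative (A B : Matrix n n R) (w : R) :
    (curvPath B (D.curv A + Matrix.scalar n w)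
      (D.curv (A + B) + Matrix.scalar n w)).map derivative =
      D.poly.dM (B.map C) + connPath A B * B.map C + B.map C * connPath A B := by
  have hX : (Matrix.scalar n (X : R[X])).map derivative = 1 := by
    ext i j : 2
    simp only [Matrix.map_apply, Matrix.scalar_apply, Matrix.diagonal_apply, Matrix.one_apply]
    split_ifs <;> simp
  have hC : ∀ S : Matrix n n R, (S.map C).map derivative = 0 := fun S => by
    ext i j : 2
    simp
  have hadd : ∀ S T : Matrix n n R[X],
      (S + T).map derivative = S.map derivative + T.map derivative := fun S T => by
    ext i j : 2
    simp
  have hy : B.map C * (Matrix.scalar n X * B.map C) =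
      Matrix.scalar n X * (B.map C * B.map C) := by
    rw [← mul_assoc, scalar_X_comm, mul_assoc]
  rw [curvPath, curv_add_sub, connPath, GCDGA.dM_map_C, map_mul]
  simp only [hadd, map_derivative_mul, hX, hC, matrix_add_map_C, matrix_mul_map_C, mul_add, add_mul,
    mul_assoc, hy, one_mul, mul_zero, zero_mul, add_zero, zero_add]
  generalize Matrix.scalar n X * (B.map C * B.map C) = x₁
  generalize A.map C * B.map C = x₂
  generalize B.map C * A.map C = x₃
  generalize (D.dM B).map C = x₄
  abel

theorem evalOne_trace_curvPath_pow (B T₀ T₁ : Matrix n n R) (k : ℕ) :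
    evalOne R ((curvPath B T₀ T₁ ^ k).trace) = (T₁ ^ k).trace := by
  have hX : (evalOne R).mapMatrix (Matrix.scalar n (X : R[X])) = 1 := by
    refine Matrix.ext fun i j => ?_
    simp only [RingHom.mapMatrix_apply, Matrix.map_apply, Matrix.scalar_apply,
      Matrix.diagonal_apply, Matrix.one_apply]
    split_ifs <;> simp [evalOne]
  have hC : ∀ S : Matrix n n R, (evalOne R).mapMatrix (S.map C) = S := fun S => by
    refine Matrix.ext fun i j => ?_
    simp [evalOne]
  have h : (evalOne R).mapMatrix (curvPath B T₀ T₁) = T₁ := by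
    simp only [curvPath, map_add, map_mul, hX, hC]
    noncomm_ring
  have h2 : (evalOne R).mapMatrix (curvPath B T₀ T₁ ^ k) = T₁ ^ k := by
    rw [map_pow, h]
  rw [← h2]
  exact AddMonoidHom.map_trace (evalOne R).toAddMonoidHom _

theorem evalZero_trace_curvPath_pow (B T₀ T₁ : Matrix n n R) (k : ℕ) :
    evalZero R ((curvPath B T₀ T₁ ^ k).trace) = (T₀ ^ k).trace := by
  have hX : (evalZero R).mapMatrix (Matrix.scalar n (X : R[X])) = 0 := by
    refine Matrix.ext fun i j => ?_
    simp only [RingHom.mapMatrix_apply, Matrix.map_apply, Matrix.scalar_apply,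
      Matrix.diagonal_apply, Matrix.zero_apply]
    split_ifs <;> simp [evalZero]
  have hC : ∀ S : Matrix n n R, (evalZero R).mapMatrix (S.map C) = S := fun S => by
    refine Matrix.ext fun i j => ?_
    simp [evalZero]
  have h : (evalZero R).mapMatrix (curvPath B T₀ T₁) = T₀ := by
    simp only [curvPath, map_add, map_mul, hX, hC]
    noncomm_ring
  have h2 : (evalZero R).mapMatrix (curvPath B T₀ T₁ ^ k) = T₀ ^ k := by
    rw [map_pow, h]
  rw [← h2]
  exact AddMonoidHom.map_trace (evalZero R).toAddMonoidHom _

theorem d_chernTr_zero (c : ℂ) (T : Matrix n n R) : D.d (chernTr c T 0) = 0 := by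
  have : D.d ((Fintype.card n : ℕ) : R) = 0 := by
    rw [← nsmul_one (Fintype.card n), map_nsmul, GCDGA.d_one, smul_zero]
  rw [chernTr, map_smul, pow_zero T, Matrix.trace_one, this, smul_zero]

theorem factorial_coef (c : ℂ) (k : ℕ) :
    (((k + 1).factorial : ℂ)⁻¹ * c ^ (k + 1)) * ((k + 1 : ℕ) : ℂ) =
      c * ((k.factorial : ℂ)⁻¹ * c ^ k) := by
  have h : ((k + 1 : ℕ) : ℂ) ≠ 0 := Nat.cast_ne_zero.mpr (Nat.succ_ne_zero k)
  rw [Nat.factorial_succ, Nat.cast_mul, mul_inv, pow_succ]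
  field_simp

theorem d_chernTr_succ (hA : D.MOdd A) (hw : D.IsEven w) (c : ℂ) (k : ℕ) :
    D.d (chernTr c (D.curv A + Matrix.scalar n w) (k + 1)) =
      c • (D.d w * chernTr c (D.curv A + Matrix.scalar n w) k) := by
  rw [chernTr, chernTr, map_smul, GCDGA.d_trace_theta_pow hA hw, ← Nat.cast_smul_eq_nsmul ℂ,
    smul_smul, factorial_coef, mul_smul, mul_smul_comm]

/-- Integrate the `t`-derivative of the trace of the `(k+1)`-st power of the path; the factor `k +
1` turns `1/(k+1)!` into `1/k!`. -/
theorem integral01_trace_derivative (hA : D.MOdd A) (hB : D.MOdd B) (hw : D.IsEven w)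
    (c : ℂ) (k : ℕ) {T₀ T₁ : Matrix n n R} (h₀ : T₀ = D.curv A + Matrix.scalar n w)
    (h₁ : T₁ = D.curv (A + B) + Matrix.scalar n w) :
    ((k.factorial : ℂ)⁻¹ * c ^ (k + 1)) • integral01 R
      (((curvPath B T₀ T₁).map derivative * curvPath B T₀ T₁ ^ k).trace) =
      chernTr c T₁ (k + 1) - chernTr c T₀ (k + 1) := by
  subst h₀ h₁
  have hT : D.poly.MEven (curvPath B (D.curv A + Matrix.scalar n w)
      (D.curv (A + B) + Matrix.scalar n w)) := by
    rw [curvPath_eq]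
    exact (connPath_odd hA hB).curv.add (GCDGA.MEven.scalar hw.poly_C)
  have h := derivative_trace_pow D hT k 0
  rw [pow_zero, mul_one, add_zero, ← derivative_trace] at h
  have h2 := congrArg (integral01 R) h
  rw [integral01_derivative, map_nsmul, evalOne_trace_curvPath_pow,
    evalZero_trace_curvPath_pow] at h2
  rw [chernTr, chernTr, ← smul_sub, h2, ← Nat.cast_smul_eq_nsmul ℂ, smul_smul, factorial_coef,
    pow_succ, mul_comm c, mul_assoc]

/-- Move `d` under the integral. The covariant derivative of `B` yields a total `t`-derivative,
hence the difference of the end points, and the remaining term comes from `dω`, which does not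
depend on `t`. -/
theorem d_transgress_succ (hA : D.MOdd A) (hB : D.MOdd B) (hw : D.IsEven w) (c : ℂ) (k : ℕ)
    {T₀ T₁ : Matrix n n R} (h₀ : T₀ = D.curv A + Matrix.scalar n w)
    (h₁ : T₁ = D.curv (A + B) + Matrix.scalar n w) :
    D.d (transgress c B T₀ T₁ (k + 1)) = chernTr c T₁ (k + 2) - chernTr c T₀ (k + 2) +
      c • (D.d w * transgress c B T₀ T₁ k) := by
  rw [← integral01_trace_derivative hA hB hw c (k + 1) h₀ h₁]
  subst h₀ h₁
  rw [transgress, transgress, map_smul, ← integral01_d, curvPath_derivative, curvPath_eq,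
    GCDGA.d_trace_mul_theta_pow (connPath_odd hA hB) hw.poly_C (GCDGA.MOdd.map_C D hB), map_add,
    smul_add, map_nsmul, D.poly_d_C, integral01_C_mul, ← Nat.cast_smul_eq_nsmul ℂ (k + 1),
    smul_smul, pow_succ c (k + 1), ← mul_assoc, mul_right_comm _ c, factorial_coef,
    mul_smul_comm (_ * _), smul_smul, pow_succ]
  congr 2
  ring

theorem d_transgress_zero (hA : D.MOdd A) (hB : D.MOdd B) (hw : D.IsEven w) (c : ℂ)
    {T₀ T₁ : Matrix n n R} (h₀ : T₀ = D.curv A + Matrix.scalar n w)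
    (h₁ : T₁ = D.curv (A + B) + Matrix.scalar n w) :
    D.d (transgress c B T₀ T₁ 0) = chernTr c T₁ 1 - chernTr c T₀ 1 := by
  rw [← zero_add 1, ← integral01_trace_derivative hA hB hw c 0 h₀ h₁]
  subst h₀ h₁
  rw [transgress, map_smul, ← integral01_d, curvPath_derivative, pow_zero, mul_one, mul_one,
    GCDGA.d_trace_mul_theta_pow_zero (connPath_odd hA hB) (GCDGA.MOdd.map_C D hB)]

end Homotopy

/-! ### Behaviour under conjugation and under addition of a central scalar. -/

section Invariance

variable {R : Type*} [Ring R] [Algebra ℂ R]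
variable {m n : Type*} [Fintype m] [DecidableEq m] [Fintype n] [DecidableEq n]

/-- The trace over a noncommutative ring is not cyclic; centrality of the entries of `H` replaces
that. `G` is rectangular because frames at different points come with separate index types. -/
theorem trace_eq_of_conj {X' : Matrix m m R} {X : Matrix n n R} {G : Matrix m n R}
    {H : Matrix n m R} (hGH : G * H = 1) (hHG : H * G = 1) (hH : ∀ i j r, H i j * r = r * H i j)
    (h : X' * G = G * X) : X'.trace = X.trace := by
  have h1 : X' = G * X * H := by rw [← h, Matrix.mul_assoc, hGH, Matrix.mul_one]
  have h2 : (G * X * H).trace = (H * (G * X)).trace := by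
    generalize G * X = Y
    simp only [Matrix.trace, Matrix.diag_apply, Matrix.mul_apply]
    rw [Finset.sum_comm]
    exact Finset.sum_congr rfl fun i _ => Finset.sum_congr rfl fun j _ => (hH _ _ _).symm
  rw [h1, h2, ← Matrix.mul_assoc, hHG, Matrix.one_mul]

theorem pow_conj {X' : Matrix m m R} {X : Matrix n n R} {G : Matrix m n R}
    (h : X' * G = G * X) (k : ℕ) : X' ^ k * G = G * X ^ k := by
  induction k with
  | zero => simp
  | succ k ih => rw [pow_succ, pow_succ', Matrix.mul_assoc, h, ← Matrix.mul_assoc, ih,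
      Matrix.mul_assoc, ← pow_succ, pow_succ']

variable {g : Matrix m n ℂ} {h : Matrix n m ℂ}

theorem chernTr_conj (c : ℂ) (hgh : g * h = 1) (hhg : h * g = 1) {T' : Matrix m m R}
    {T : Matrix n n R} (hT : T' * g.map (algebraMap ℂ R) = g.map (algebraMap ℂ R) * T) (k : ℕ) :
    chernTr c T' k = chernTr c T k := by
  rw [chernTr, chernTr, trace_eq_of_conj (G := g.map (algebraMap ℂ R))
    (H := h.map (algebraMap ℂ R)) _ _ _ (pow_conj hT k)]
  · rw [← Matrix.map_mul, hgh, Matrix.map_one _ (map_zero _) (map_one _)]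
  · rw [← Matrix.map_mul, hhg, Matrix.map_one _ (map_zero _) (map_one _)]
  · exact fun i j r => Algebra.commutes _ _

/-- The whole path `curvPath` is conjugated by `g`, since it is polynomial in `B`, `T₀`, `T₁`. The
matrix `g` consists of complex numbers: everything happens at one point and nothing is
differentiated. -/
theorem transgress_conj (c : ℂ) (hgh : g * h = 1) (hhg : h * g = 1)
    {B' T₀' T₁' : Matrix m m R} {B T₀ T₁ : Matrix n n R}
    (hB : B' * g.map (algebraMap ℂ R) = g.map (algebraMap ℂ R) * B)
    (h₀ : T₀' * g.map (algebraMap ℂ R) = g.map (algebraMap ℂ R) * T₀)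
    (h₁ : T₁' * g.map (algebraMap ℂ R) = g.map (algebraMap ℂ R) * T₁) (k : ℕ) :
    transgress c B' T₀' T₁' k = transgress c B T₀ T₁ k := by
  set G := g.map (algebraMap ℂ R) with hG
  have hC : ∀ {Y' : Matrix m m R} {Y : Matrix n n R}, Y' * G = G * Y →
      Y'.map C * G.map C = G.map C * Y.map C := fun {Y' Y} hY => by
    rw [← Matrix.map_mul, ← Matrix.map_mul, hY]
  have hX : ∀ s : R[X], (∀ t, s * t = t * s) →
      Matrix.scalar m s * G.map C = G.map C * Matrix.scalar n s := fun s hs => by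
    ext i j : 2
    simp [hs]
  have hBB : B' * B' * G = G * (B * B) := by
    rw [Matrix.mul_assoc, hB, ← Matrix.mul_assoc, hB, Matrix.mul_assoc]
  have hd : (T₁' - T₀' - B' * B') * G = G * (T₁ - T₀ - B * B) := by
    rw [Matrix.sub_mul, Matrix.sub_mul, h₁, h₀, hBB, Matrix.mul_sub, Matrix.mul_sub]
  have hP : curvPath B' T₀' T₁' * G.map C = G.map C * curvPath B T₀ T₁ := by
    rw [curvPath, curvPath, Matrix.add_mul, Matrix.add_mul, Matrix.mul_add, Matrix.mul_add, hC h₀,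
      Matrix.mul_assoc, hC hd, Matrix.mul_assoc, hC hBB, ← Matrix.mul_assoc, ← Matrix.mul_assoc,
      hX X fun t => X_mul, hX (X * X) fun t => by rw [mul_assoc, X_mul, X_mul, X_mul, mul_assoc],
      Matrix.mul_assoc, Matrix.mul_assoc]
  have hall : (B'.map C * curvPath B' T₀' T₁' ^ k) * G.map C =
      G.map C * (B.map C * curvPath B T₀ T₁ ^ k) := by
    rw [Matrix.mul_assoc, pow_conj hP, ← Matrix.mul_assoc, hC hB, Matrix.mul_assoc]
  rw [transgress, transgress, trace_eq_of_conj (G := G.map C)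
    (H := (h.map (algebraMap ℂ R)).map C) _ _ _ hall]
  · rw [← Matrix.map_mul, hG, ← Matrix.map_mul, hgh, Matrix.map_one _ (map_zero _) (map_one _),
      Matrix.map_one _ (map_zero _) (map_one _)]
  · rw [← Matrix.map_mul, hG, ← Matrix.map_mul, hhg, Matrix.map_one _ (map_zero _) (map_one _),
      Matrix.map_one _ (map_zero _) (map_one _)]
  · intro i j r
    rw [Matrix.map_apply, Matrix.map_apply, ← Polynomial.algebraMap_apply]
    exact Algebra.commutes _ _

/-- The binomial theorem, that is `exp(T + e) = exp(e) exp(T)` for central `e`, degree by degree.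
This produces the factor `exp(-uη)`. -/
theorem chernTr_add_scalar (c : ℂ) (T : Matrix n n R) {e : R} (he : ∀ r, e * r = r * e) (k : ℕ) :
    chernTr c (T + Matrix.scalar n e) k =
      ∑ x ∈ Finset.HasAntidiagonal.antidiagonal k, (((x.1.factorial : ℂ)⁻¹ • (c • e) ^ x.1) * chernTr c T x.2) := by
  have hc : Commute (Matrix.scalar n e) T := by
    rw [commute_iff_eq]
    ext i j
    simp [he]
  rw [chernTr, add_comm, hc.add_pow', Matrix.trace_sum, Finset.smul_sum]
  refine Finset.sum_congr rfl fun x hx => ?_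
  rw [← map_pow, Matrix.trace_smul, GCDGA.trace_scalar_mul, ← Nat.cast_smul_eq_nsmul ℂ, smul_smul,
    chernTr, smul_mul_assoc, mul_smul_comm, _root_.smul_pow, smul_mul_assoc, smul_smul, smul_smul]
  congr 1
  rw [← Finset.HasAntidiagonal.mem_antidiagonal.mp hx, Nat.choose_symm_add, Nat.add_choose, Nat.cast_div
    (Nat.factorial_mul_factorial_dvd_factorial_add _ _)
    (Nat.cast_ne_zero.mpr (mul_ne_zero (Nat.factorial_ne_zero _) (Nat.factorial_ne_zero _))),
    Nat.cast_mul, pow_add]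
  have h1 : (((x.1 + x.2).factorial : ℕ) : ℂ) ≠ 0 := Nat.cast_ne_zero.mpr (Nat.factorial_ne_zero _)
  have h2 : ((x.1.factorial : ℕ) : ℂ) ≠ 0 := Nat.cast_ne_zero.mpr (Nat.factorial_ne_zero _)
  have h3 : ((x.2.factorial : ℕ) : ℂ) ≠ 0 := Nat.cast_ne_zero.mpr (Nat.factorial_ne_zero _)
  field_simp

end Invariance

/-! ### Germs of smooth forms. -/

section Germs

variable {E : Type uE} [NormedAddCommGroup E] [NormedSpace ℝ E] [FiniteDimensional ℝ E]
  {M : Type uM} [TopologicalSpace M] [ChartedSpace E M] [IsManifold 𝓘(ℝ, E) ∞ M]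

theorem formSmoothAt_algebraMap (c : ℂ) (p : M) :
    FormSmoothAt (algebraMap ℂ (Form E M) c) p := by
  intro l
  have : ∀ y, chartRep (algebraMap ℂ (Form E M) c) p y = algebraMap ℂ (CoordForm E) c := fun y => by
    rw [chartRep]
    exact AlgHom.commutes _ c
  simp only [this]
  exact contDiffAt_const

variable (E) in
/-- The forms that are smooth near `x`. -/
def smoothNear (x : M) : Subalgebra ℂ (Form E M) where
  carrier := {w | ∀ᶠ y in 𝓝 x, FormSmoothAt w y}
  mul_mem' ha hb := by
    filter_upwards [ha, hb] with y h h'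
    exact h.mul h'
  add_mem' ha hb := by
    filter_upwards [ha, hb] with y h h'
    exact h.add h'
  algebraMap_mem' c := Filter.Eventually.of_forall fun y => formSmoothAt_algebraMap c y

theorem dForm_mem_smoothNear {x : M} {w : Form E M} (hw : w ∈ smoothNear E x) :
    dForm w ∈ smoothNear E x := by
  have h : ∀ᶠ y in 𝓝 x, ∀ᶠ z in 𝓝 y, FormSmoothAt w z := eventually_eventually_nhds.mpr hw
  filter_upwards [h] with y hy
  exact FormSmoothAt.dForm hy

/-- The exterior derivative on forms smooth near a point. -/
def dNear (x : M) (w : smoothNear E x) : smoothNear E x :=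
  ⟨dForm w.1, dForm_mem_smoothNear w.2⟩

variable (E) in
/-- Equality near a point. -/
def germCon (x : M) : RingCon (smoothNear E x) where
  r a b := ∀ᶠ y in 𝓝 x, a.1 y = b.1 y
  iseqv :=
    { refl := fun _ => Filter.Eventually.of_forall fun _ => rfl
      symm := fun h => h.mono fun _ h => h.symm
      trans := fun h h' => by
        filter_upwards [h, h'] with y hy hy'
        exact hy.trans hy' }
  mul' h h' := by
    filter_upwards [h, h'] with y hy hy'
    exact congrArg₂ (· * ·) hy hy'
  add' h h' := by
    filter_upwards [h, h'] with y hy hy'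
    exact congrArg₂ (· + ·) hy hy'

variable (E) in
/-- The algebra of germs at `x` of smooth forms. -/
abbrev FormGerm (x : M) : Type (max uE uM) := (germCon E x).Quotient

/-- The germ of a form. -/
def toGerm (x : M) : smoothNear E x →ₐ[ℂ] FormGerm E x := (germCon E x).mkₐ (α := ℂ)

theorem toGerm_surjective (x : M) : Function.Surjective (toGerm (E := E) x) :=
  RingCon.mkₐ_surjective _

theorem toGerm_eq_iff {x : M} {a b : smoothNear E x} :
    toGerm x a = toGerm x b ↔ ∀ᶠ y in 𝓝 x, a.1 y = b.1 y :=
  (germCon E x).eq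

/-- The exterior derivative of germs. -/
def germD (x : M) : FormGerm E x →ₗ[ℂ] FormGerm E x where
  toFun := Quotient.map' (dNear x) fun a b (h : ∀ᶠ y in 𝓝 x, a.1 y = b.1 y) => by
    change ∀ᶠ y in 𝓝 x, dForm a.1 y = dForm b.1 y
    filter_upwards [eventually_eventually_nhds.mpr h] with y hy
    exact dForm_congr hy
  map_add' a b := by
    obtain ⟨a, rfl⟩ := toGerm_surjective x a
    obtain ⟨b, rfl⟩ := toGerm_surjective x b
    refine toGerm_eq_iff.mpr ?_
    filter_upwards [a.2, b.2] with y hy hy'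
    exact dForm_add hy hy'
  map_smul' c a := by
    obtain ⟨a, rfl⟩ := toGerm_surjective x a
    refine toGerm_eq_iff.mpr ?_
    filter_upwards [a.2] with y hy
    exact dForm_smul c hy

/-- The grade involution on forms smooth near a point. -/
def invNear (x : M) : smoothNear E x →ₐ[ℂ] smoothNear E x :=
  AlgHom.codRestrict ((formGradeInv E M).comp (smoothNear E x).val) _ fun w =>
    w.2.mono fun _ h => h.gradeInv

/-- The grade involution of germs. -/
def germInv (x : M) : FormGerm E x →ₐ[ℂ] FormGerm E x where
  toFun := Quotient.map' (invNear x) fun a b (h : ∀ᶠ y in 𝓝 x, a.1 y = b.1 y) => by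
    change ∀ᶠ y in 𝓝 x, gradeInv _ (a.1 y) = gradeInv _ (b.1 y)
    filter_upwards [h] with y hy
    rw [hy]
  map_one' := congrArg (toGerm x) (map_one (invNear x))
  map_mul' a b := by
    obtain ⟨a, rfl⟩ := toGerm_surjective x a
    obtain ⟨b, rfl⟩ := toGerm_surjective x b
    exact congrArg (toGerm x) (map_mul (invNear x) a b)
  map_zero' := congrArg (toGerm x) (map_zero (invNear x))
  map_add' a b := by
    obtain ⟨a, rfl⟩ := toGerm_surjective x a
    obtain ⟨b, rfl⟩ := toGerm_surjective x b
    exact congrArg (toGerm x) (map_add (invNear x) a b)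
  commutes' c := congrArg (toGerm x) ((invNear x).commutes c)

variable (E) in
/-- The graded-commutative differential algebra of germs of smooth forms. -/
def germDGA (x : M) : GCDGA (FormGerm E x) where
  d := germD x
  inv := germInv x
  leibniz a b := by
    obtain ⟨a, rfl⟩ := toGerm_surjective x a
    obtain ⟨b, rfl⟩ := toGerm_surjective x b
    refine (toGerm_eq_iff (b := dNear x a * b + invNear x a * dNear x b)).mpr ?_
    filter_upwards [a.2, b.2] with y hy hy'
    exact dForm_mul hy hy'
  d_d a := by
    obtain ⟨a, rfl⟩ := toGerm_surjective x a
    refine (toGerm_eq_iff (b := 0)).mpr ?_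
    filter_upwards [eventually_eventually_nhds.mpr a.2] with y hy
    exact dForm_dForm hy
  d_inv a := by
    obtain ⟨a, rfl⟩ := toGerm_surjective x a
    refine (toGerm_eq_iff (b := -invNear x (dNear x a))).mpr ?_
    filter_upwards [a.2] with y hy
    exact dForm_gradeInv hy
  even_comm a b h := by
    obtain ⟨a, rfl⟩ := toGerm_surjective x a
    obtain ⟨b, rfl⟩ := toGerm_surjective x b
    refine (toGerm_eq_iff (a := a * b) (b := b * a)).mpr ?_
    filter_upwards [toGerm_eq_iff.mp h] with y hy
    exact commute_of_gradeInv_eq hy _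
  odd_comm a b h := by
    obtain ⟨a, rfl⟩ := toGerm_surjective x a
    obtain ⟨b, rfl⟩ := toGerm_surjective x b
    refine (toGerm_eq_iff (a := a * b) (b := invNear x b * a)).mpr ?_
    filter_upwards [(toGerm_eq_iff (b := -a)).mp h] with y hy
    exact mul_eq_gradeInv_mul_of_odd hy _

variable (E) in
/-- The value of a form at a point, as an algebra homomorphism. -/
def evalForm (x : M) : Form E M →ₐ[ℂ] ExteriorAlgebra ℂ (Cotangent E x) where
  toFun w := w x
  map_one' := rfl
  map_mul' _ _ := rfl
  map_zero' := rfl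
  map_add' _ _ := rfl
  commutes' _ := rfl

/-- The value of a germ at its base point. -/
def germEval (x : M) : FormGerm E x →ₐ[ℂ] ExteriorAlgebra ℂ (Cotangent E x) where
  toFun := Quotient.lift (fun a : smoothNear E x => a.1 x) fun a b
    (h : ∀ᶠ y in 𝓝 x, a.1 y = b.1 y) => h.self_of_nhds
  map_one' := rfl
  map_mul' a b := by
    obtain ⟨a, rfl⟩ := toGerm_surjective x a
    obtain ⟨b, rfl⟩ := toGerm_surjective x b
    rfl
  map_zero' := rfl
  map_add' a b := by
    obtain ⟨a, rfl⟩ := toGerm_surjective x a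
    obtain ⟨b, rfl⟩ := toGerm_surjective x b
    rfl
  commutes' _ := rfl

/-! ### Matrices of forms near a point -/

variable {m n : Type*} [Fintype m] [DecidableEq m] [Fintype n] [DecidableEq n]

/-- All entries are smooth near `x`. -/
def MSmoothNear {m n : Type*} (x : M) (A : Matrix m n (Form E M)) : Prop :=
  ∀ i j, A i j ∈ smoothNear E x

/-- Lift of a matrix with entries that are smooth near `x`. -/
def MSmoothNear.lift {m n : Type*} {x : M} {A : Matrix m n (Form E M)} (h : MSmoothNear x A) :
    Matrix m n (smoothNear E x) := fun i j => ⟨A i j, h i j⟩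

/-- The matrix of germs. -/
def MSmoothNear.germ {m n : Type*} {x : M} {A : Matrix m n (Form E M)} (h : MSmoothNear x A) :
    Matrix m n (FormGerm E x) := h.lift.map (toGerm x)

theorem MSmoothNear.lift_map_val {m n : Type*} {x : M} {A : Matrix m n (Form E M)}
    (h : MSmoothNear x A) : h.lift.map (smoothNear E x).val = A := rfl

theorem MSmoothNear.germ_map_eval {m n : Type*} {x : M} {A : Matrix m n (Form E M)}
    (h : MSmoothNear x A) : h.germ.map (germEval x) = A.map (evalForm E x) := rfl

theorem MSmoothNear.mul {l : Type*} {x : M} {A : Matrix l m (Form E M)} {B : Matrix m n (Form E M)}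
    (hA : MSmoothNear x A) (hB : MSmoothNear x B) : MSmoothNear x (A * B) := fun i j => by
  rw [Matrix.mul_apply]
  exact sum_mem fun k _ => mul_mem (hA i k) (hB k j)

theorem MSmoothNear.add {m n : Type*} {x : M} {A B : Matrix m n (Form E M)}
    (hA : MSmoothNear x A) (hB : MSmoothNear x B) : MSmoothNear x (A + B) :=
  fun i j => add_mem (hA i j) (hB i j)

theorem MSmoothNear.scalar {x : M} {w : Form E M} (hw : w ∈ smoothNear E x) :
    MSmoothNear x (Matrix.scalar n w) := fun i j => by
  rw [Matrix.scalar_apply, Matrix.diagonal_apply]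
  split_ifs
  exacts [hw, zero_mem _]

theorem MSmoothNear.d {m n : Type*} {x : M} {A : Matrix m n (Form E M)} (hA : MSmoothNear x A) :
    MSmoothNear x (A.map dForm) := fun i j => dForm_mem_smoothNear (hA i j)

/-- The curvature matrix of a matrix of forms. -/
def curvMatrix (A : Matrix n n (Form E M)) : Matrix n n (Form E M) := A.map dForm + A * A

/-- The matrix of `dA + A² + ω`. -/
def thetaMatrix (A : Matrix n n (Form E M)) (w : Form E M) : Matrix n n (Form E M) :=
  curvMatrix A + Matrix.scalar n w

theorem MSmoothNear.theta {x : M} {A : Matrix n n (Form E M)} {w : Form E M}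
    (hA : MSmoothNear x A) (hw : w ∈ smoothNear E x) : MSmoothNear x (thetaMatrix A w) :=
  (hA.d.add (hA.mul hA)).add (.scalar hw)

theorem MSmoothNear.germ_add {m n : Type*} {x : M} {A B : Matrix m n (Form E M)}
    (hA : MSmoothNear x A) (hB : MSmoothNear x B) : (hA.add hB).germ = hA.germ + hB.germ := rfl

theorem MSmoothNear.germ_mul {l : Type*} {x : M} {A : Matrix l m (Form E M)}
    {B : Matrix m n (Form E M)} (hA : MSmoothNear x A) (hB : MSmoothNear x B) :
    (hA.mul hB).germ = hA.germ * hB.germ := by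
  have h : (hA.mul hB).lift = hA.lift * hB.lift := by
    refine Matrix.ext fun i j => Subtype.ext ?_
    rw [Matrix.mul_apply, AddSubmonoidClass.coe_finsetSum]
    rfl
  rw [germ, h]
  exact Matrix.map_mul (f := (toGerm x).toRingHom)

theorem MSmoothNear.germ_scalar {x : M} {w : Form E M} (hw : w ∈ smoothNear E x) :
    (MSmoothNear.scalar (n := n) hw).germ = Matrix.scalar n (toGerm x ⟨w, hw⟩) := by
  have h : (MSmoothNear.scalar (n := n) hw).lift = Matrix.scalar n ⟨w, hw⟩ := by
    refine Matrix.ext fun i j => Subtype.ext ?_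
    change Matrix.scalar n w i j = _
    rw [Matrix.scalar_apply, Matrix.scalar_apply, Matrix.diagonal_apply, Matrix.diagonal_apply]
    split_ifs <;> rfl
  rw [germ, h]
  refine Matrix.ext fun i j => ?_
  rw [Matrix.map_apply, Matrix.scalar_apply, Matrix.scalar_apply, Matrix.diagonal_apply,
    Matrix.diagonal_apply]
  split_ifs
  exacts [rfl, map_zero _]

theorem MSmoothNear.germ_d {m n : Type*} {x : M} {A : Matrix m n (Form E M)}
    (hA : MSmoothNear x A) : hA.d.germ = (germDGA E x).dM hA.germ := rfl

theorem MSmoothNear.germ_theta {x : M} {A : Matrix n n (Form E M)} {w : Form E M}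
    (hA : MSmoothNear x A) (hw : w ∈ smoothNear E x) :
    (hA.theta hw).germ = (germDGA E x).curv hA.germ + Matrix.scalar n (toGerm x ⟨w, hw⟩) := by
  rw [← germ_scalar, GCDGA.curv, ← germ_d, ← germ_mul]
  rfl

theorem MSmoothNear.germ_eq {m n : Type*} {x : M} {A B : Matrix m n (Form E M)}
    (hA : MSmoothNear x A) (hB : MSmoothNear x B) (h : ∀ i j, ∀ᶠ y in 𝓝 x, A i j y = B i j y) :
    hA.germ = hB.germ :=
  Matrix.ext fun i j => toGerm_eq_iff.mpr (h i j)

theorem isOdd_toGerm {x : M} {w : Form E M} (hw : w ∈ smoothNear E x)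
    (h : ∀ᶠ y in 𝓝 x, w y ∈ ⋀[ℂ]^1 (Cotangent E y)) : (germDGA E x).IsOdd (toGerm x ⟨w, hw⟩) := by
  refine (toGerm_eq_iff (b := -⟨w, hw⟩)).mpr ?_
  filter_upwards [h] with y hy
  have := gradeInv_of_mem hy
  rw [pow_one, neg_one_mul] at this
  exact this

theorem isEven_toGerm {x : M} {w : Form E M} (hw : w ∈ smoothNear E x)
    (h : ∀ᶠ y in 𝓝 x, gradeInv _ (w y) = w y) : (germDGA E x).IsEven (toGerm x ⟨w, hw⟩) :=
  (toGerm_eq_iff (b := ⟨w, hw⟩)).mpr h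

end Germs

/-! ### From germs back to matrices of forms at a point. -/

section FormMatrices

variable {E : Type uE} [NormedAddCommGroup E] [NormedSpace ℝ E] [FiniteDimensional ℝ E]
  {M : Type uM} [TopologicalSpace M] [ChartedSpace E M] [IsManifold 𝓘(ℝ, E) ∞ M]
variable {m n : Type*} [Fintype m] [DecidableEq m] [Fintype n] [DecidableEq n]

/-- All entries are one-forms near `x`. -/
def MOneNear {m n : Type*} (x : M) (A : Matrix m n (Form E M)) : Prop :=
  ∀ i j, ∀ᶠ y in 𝓝 x, A i j y ∈ ⋀[ℂ]^1 (Cotangent E y)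

theorem MOneNear.odd {m n : Type*} {x : M} {A : Matrix m n (Form E M)} (h : MOneNear x A)
    (hA : MSmoothNear x A) : (germDGA E x).MOdd hA.germ :=
  fun i j => isOdd_toGerm (hA i j) (h i j)

theorem MOneNear.add {m n : Type*} {x : M} {A B : Matrix m n (Form E M)} (hA : MOneNear x A)
    (hB : MOneNear x B) : MOneNear x (A + B) := fun i j => by
  filter_upwards [hA i j, hB i j] with y h h'
  exact add_mem h h'

section Maps

variable {x : M} {T B T₀ T₁ : Matrix n n (Form E M)}

theorem chernTr_mem_smoothNear (hT : MSmoothNear x T) (c : ℂ) (k : ℕ) :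
    chernTr c T k ∈ smoothNear E x := by
  rw [← hT.lift_map_val, chernTr_map]
  exact (chernTr c hT.lift k).2

theorem toGerm_chernTr (hT : MSmoothNear x T) (c : ℂ) (k : ℕ) :
    toGerm x ⟨chernTr c T k, chernTr_mem_smoothNear hT c k⟩ = chernTr c hT.germ k := by
  rw [MSmoothNear.germ, chernTr_map]
  congr 1
  exact Subtype.ext (chernTr_map (smoothNear E x).val c hT.lift k)

theorem transgress_mem_smoothNear (hB : MSmoothNear x B) (h₀ : MSmoothNear x T₀)
    (h₁ : MSmoothNear x T₁) (c : ℂ) (k : ℕ) : transgress c B T₀ T₁ k ∈ smoothNear E x := by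
  rw [← hB.lift_map_val, ← h₀.lift_map_val, ← h₁.lift_map_val, transgress_map]
  exact (transgress c hB.lift h₀.lift h₁.lift k).2

theorem toGerm_transgress (hB : MSmoothNear x B) (h₀ : MSmoothNear x T₀)
    (h₁ : MSmoothNear x T₁) (c : ℂ) (k : ℕ) :
    toGerm x ⟨transgress c B T₀ T₁ k, transgress_mem_smoothNear hB h₀ h₁ c k⟩ =
      transgress c hB.germ h₀.germ h₁.germ k := by
  rw [MSmoothNear.germ, MSmoothNear.germ, MSmoothNear.germ, transgress_map]
  congr 1
  exact Subtype.ext (transgress_map (smoothNear E x).val c hB.lift h₀.lift h₁.lift k)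

theorem chernTr_apply (T : Matrix n n (Form E M)) (c : ℂ) (k : ℕ) (x : M) :
    chernTr c T k x = chernTr c (T.map (evalForm E x)) k :=
  (chernTr_map (evalForm E x) c T k).symm

theorem transgress_apply (B T₀ T₁ : Matrix n n (Form E M)) (c : ℂ) (k : ℕ) (x : M) :
    transgress c B T₀ T₁ k x = transgress c (B.map (evalForm E x)) (T₀.map (evalForm E x))
      (T₁.map (evalForm E x)) k :=
  (transgress_map (evalForm E x) c B T₀ T₁ k).symm

theorem dForm_eq_germEval {w : Form E M} (hw : w ∈ smoothNear E x) :
    dForm w x = germEval x ((germDGA E x).d (toGerm x ⟨w, hw⟩)) := rfl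

end Maps

variable {x : M} {A B : Matrix n n (Form E M)} {w : Form E M}

theorem dForm_chernTr_zero {T : Matrix n n (Form E M)} (hT : MSmoothNear x T) (c : ℂ) :
    dForm (chernTr c T 0) x = 0 := by
  rw [dForm_eq_germEval (chernTr_mem_smoothNear hT c 0), toGerm_chernTr hT,
    d_chernTr_zero, map_zero]

/-- Pass to germs at `x`, where `d_chernTr_succ` applies, then evaluate at `x`. The two
transgression formulas below are transported in the same way. -/
theorem dForm_chernTr_succ (hA : MSmoothNear x A) (hA1 : MOneNear x A) (hw : w ∈ smoothNear E x)
    (hw2 : ∀ᶠ y in 𝓝 x, gradeInv _ (w y) = w y) (c : ℂ) (k : ℕ) :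
    dForm (chernTr c (thetaMatrix A w) (k + 1)) x =
      c • (dForm w x * chernTr c (thetaMatrix A w) k x) := by
  rw [dForm_eq_germEval (chernTr_mem_smoothNear (hA.theta hw) c _), toGerm_chernTr (hA.theta hw),
    hA.germ_theta hw, d_chernTr_succ (hA1.odd hA) (isEven_toGerm hw hw2), ← hA.germ_theta hw,
    ← toGerm_chernTr (hA.theta hw), map_smul, map_mul]
  rfl

theorem dForm_transgress_zero (hA : MSmoothNear x A) (hA1 : MOneNear x A) (hB : MSmoothNear x B)
    (hB1 : MOneNear x B) (hw : w ∈ smoothNear E x)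
    (hw2 : ∀ᶠ y in 𝓝 x, gradeInv _ (w y) = w y) (c : ℂ) :
    dForm (transgress c B (thetaMatrix A w) (thetaMatrix (A + B) w) 0) x =
      chernTr c (thetaMatrix (A + B) w) 1 x - chernTr c (thetaMatrix A w) 1 x := by
  have h₀ := hA.theta hw
  have h₁ := (hA.add hB).theta hw
  rw [dForm_eq_germEval (transgress_mem_smoothNear hB h₀ h₁ c _), toGerm_transgress hB h₀ h₁,
    d_transgress_zero (hA1.odd hA) (hB1.odd hB) (isEven_toGerm hw hw2) c (hA.germ_theta hw)
      ((hA.add hB).germ_theta hw), ← toGerm_chernTr h₀, ← toGerm_chernTr h₁, map_sub]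
  rfl

theorem dForm_transgress_succ (hA : MSmoothNear x A) (hA1 : MOneNear x A) (hB : MSmoothNear x B)
    (hB1 : MOneNear x B) (hw : w ∈ smoothNear E x)
    (hw2 : ∀ᶠ y in 𝓝 x, gradeInv _ (w y) = w y) (c : ℂ) (k : ℕ) :
    dForm (transgress c B (thetaMatrix A w) (thetaMatrix (A + B) w) (k + 1)) x =
      chernTr c (thetaMatrix (A + B) w) (k + 2) x - chernTr c (thetaMatrix A w) (k + 2) x +
        c • (dForm w x * transgress c B (thetaMatrix A w) (thetaMatrix (A + B) w) k x) := by
  have h₀ := hA.theta hw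
  have h₁ := (hA.add hB).theta hw
  rw [dForm_eq_germEval (transgress_mem_smoothNear hB h₀ h₁ c _), toGerm_transgress hB h₀ h₁,
    d_transgress_succ (hA1.odd hA) (hB1.odd hB) (isEven_toGerm hw hw2) c k (hA.germ_theta hw)
      ((hA.add hB).germ_theta hw), ← toGerm_chernTr h₀, ← toGerm_chernTr h₁,
      ← toGerm_transgress hB h₀ h₁, map_add, map_sub, map_smul, map_mul]
  rfl

theorem ofFun_mem_smoothNear {f : M → ℂ} {x : M}
    (h : ∀ᶠ y in 𝓝 x, ContMDiffAt 𝓘(ℝ, E) 𝓘(ℝ, ℂ) ∞ f y) : (ofFun f : Form E M) ∈ smoothNear E x :=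
  h.mono fun _ h => formSmoothAt_ofFun h

theorem form_matrix_mul_apply {l : Type*} (A : Matrix l m (Form E M)) (B : Matrix m n (Form E M))
    (i : l) (j : n) (y : M) : (A * B) i j y = ∑ k, A i k y * B k j y := by
  rw [Matrix.mul_apply]
  exact map_sum (evalForm E y) _ _

theorem scalar_map_eval {R S : Type*} [Ring R] [Algebra ℂ R] [Ring S] [Algebra ℂ S]
    (f : R →ₐ[ℂ] S) (a : R) : (Matrix.scalar n a).map f = Matrix.scalar n (f a) := by
  refine Matrix.ext fun i j => ?_
  rw [Matrix.map_apply, Matrix.scalar_apply, Matrix.scalar_apply, Matrix.diagonal_apply,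
    Matrix.diagonal_apply]
  split_ifs
  exacts [rfl, map_zero _]

theorem thetaMatrix_map_eval (hA : MSmoothNear x A) : (thetaMatrix A w).map (evalForm E x) =
    ((germDGA E x).curv hA.germ).map (germEval x) + Matrix.scalar n (w x) := by
  have h1 : (germDGA E x).curv hA.germ = (hA.d.add (hA.mul hA)).germ := by
    rw [MSmoothNear.germ_add hA.d (hA.mul hA), MSmoothNear.germ_mul hA hA]
    rfl
  rw [h1, MSmoothNear.germ_map_eval, thetaMatrix, Matrix.map_add _ (map_add _), scalar_map_eval]
  rfl

/-- The gauge relation is required near `x`, since it gets differentiated, whereas `w = w' + da` is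
used at `x` only. -/
theorem theta_gauge {A' : Matrix m m (Form E M)} {w' a : Form E M} {g : Matrix m n (M → ℂ)}
    (hA' : MSmoothNear x A') (hA1' : MOneNear x A') (hA : MSmoothNear x A) (hA1 : MOneNear x A)
    (ha : a ∈ smoothNear E x) (ha1 : ∀ᶠ y in 𝓝 x, a y ∈ ⋀[ℂ]^1 (Cotangent E y))
    (hg : ∀ i j, ∀ᶠ y in 𝓝 x, ContMDiffAt 𝓘(ℝ, E) 𝓘(ℝ, ℂ) ∞ (g i j) y)
    (h : ∀ i j, ∀ᶠ y in 𝓝 x,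
      ∑ k, A' i k y * algebraMap ℂ _ (g k j y) + ExteriorAlgebra.ι ℂ (dFun (g i j) y) =
        ∑ k, algebraMap ℂ _ (g i k y) * A k j y + algebraMap ℂ _ (g i j y) * a y)
    (hw : w x = w' x + dForm a x) :
    (thetaMatrix A' w').map (evalForm E x) *
        (g.map fun f => f x).map (algebraMap ℂ (ExteriorAlgebra ℂ (Cotangent E x))) =
      (g.map fun f => f x).map (algebraMap ℂ (ExteriorAlgebra ℂ (Cotangent E x))) *
        (thetaMatrix A w).map (evalForm E x) := by
  have hgs : MSmoothNear x (g.map (ofFun (E := E))) := fun i j => ofFun_mem_smoothNear (hg i j)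
  have hge : (germDGA E x).MEven hgs.germ := fun i j =>
    isEven_toGerm _ (Filter.Eventually.of_forall fun y => AlgHom.commutes _ _)
  -- Absorbing `a` into the connection matrix gives the plain gauge relation for `A + a`; afterwards
  -- `GCDGA.curv_add_scalar` separates `da` from the curvature again.
  have hrel : hA'.germ * hgs.germ + (germDGA E x).dM hgs.germ =
      hgs.germ * (hA.germ + Matrix.scalar n (toGerm x ⟨a, ha⟩)) := by
    rw [← MSmoothNear.germ_scalar, ← MSmoothNear.germ_d, ← MSmoothNear.germ_mul,
      ← MSmoothNear.germ_add, ← MSmoothNear.germ_add, ← MSmoothNear.germ_mul]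
    refine MSmoothNear.germ_eq _ _ fun i j => ?_
    filter_upwards [h i j, hg i j] with y hy hy'
    rw [Matrix.mul_add, Matrix.add_apply, Matrix.add_apply, Form.add_apply, Form.add_apply,
      form_matrix_mul_apply, form_matrix_mul_apply, Matrix.map_apply, Matrix.map_apply,
      dForm_ofFun hy', Matrix.scalar_apply, Matrix.mul_diagonal]
    exact hy
  have hc := GCDGA.gauge_curv hge (hA1'.odd hA') hrel
  rw [GCDGA.curv_add_scalar (hA1.odd hA) (isOdd_toGerm ha ha1)] at hc
  have hev : hgs.germ.map (germEval x) =
      (g.map fun f => f x).map (algebraMap ℂ (ExteriorAlgebra ℂ (Cotangent E x))) := rfl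
  have hc' := congrArg (fun Y : Matrix m n (FormGerm E x) => Y.map (germEval x)) hc
  simp only [Matrix.map_mul, hev] at hc'
  rw [Matrix.map_add _ (map_add _)] at hc'
  have hsc : (Matrix.scalar n ((germDGA E x).d (toGerm x ⟨a, ha⟩))).map (germEval x) =
      Matrix.scalar n (dForm a x) := scalar_map_eval _ _
  rw [hsc] at hc'
  rw [thetaMatrix_map_eval hA', thetaMatrix_map_eval hA, hw, Matrix.add_mul, hc', map_add, Matrix.mul_add, Matrix.mul_add,
    Matrix.mul_add, add_assoc]
  congr 1
  rw [add_comm]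
  congr 1
  refine Matrix.ext fun i j => ?_
  simp only [Matrix.scalar_apply, Matrix.diagonal_mul, Matrix.mul_diagonal, Matrix.map_apply]
  exact (Algebra.commutes _ _).symm

theorem thetaMatrix_add_scalar {e d : Form E M} (hA : MSmoothNear x A) (hA1 : MOneNear x A)
    (hd : d ∈ smoothNear E x) (hd1 : ∀ᶠ y in 𝓝 x, d y ∈ ⋀[ℂ]^1 (Cotangent E y))
    {w' : Form E M} (he : w' x + dForm d x = w x + e x) :
    (thetaMatrix (A + Matrix.scalar n d) w').map (evalForm E x) =
      (thetaMatrix A w).map (evalForm E x) + Matrix.scalar n (e x) := by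
  rw [thetaMatrix_map_eval (hA.add (MSmoothNear.scalar hd)), thetaMatrix_map_eval hA,
    MSmoothNear.germ_add hA (MSmoothNear.scalar hd), MSmoothNear.germ_scalar hd,
    GCDGA.curv_add_scalar (hA1.odd hA) (isOdd_toGerm hd hd1), Matrix.map_add _ (map_add _),
    scalar_map_eval, add_assoc, add_assoc, ← map_add, ← map_add, ← he, add_comm (w' x)]
  rfl

end FormMatrices

/-! ### Exponentials and the twisted differential, algebraically. -/

section TwistAlgebra

variable {R : Type*} [Ring R] [Algebra ℂ R]

/-- The truncated exponential series of `u a`. -/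
def expP (N : ℕ) (a : R) : R[X] :=
  ∑ k ∈ Finset.range N, monomial k ((k.factorial : ℂ)⁻¹ • a ^ k)

/-- Nilpotency makes the truncation invisible: the formula holds for all `k`, and identities between
exponentials may be compared coefficient by coefficient. -/
theorem coeff_expP {N : ℕ} {a : R} (ha : a ^ N = 0) (k : ℕ) :
    (expP N a).coeff k = (k.factorial : ℂ)⁻¹ • a ^ k := by
  rw [expP, finsetSum_coeff]
  simp only [coeff_monomial]
  rw [Finset.sum_ite_eq']
  split_ifs with h
  · rfl
  · rw [Finset.mem_range, not_lt] at h
    rw [pow_eq_zero_of_le h ha, smul_zero]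

theorem factorial_smul_add_pow {a b : R} (h : Commute a b) (k : ℕ) :
    (k.factorial : ℂ)⁻¹ • (a + b) ^ k = ∑ x ∈ Finset.HasAntidiagonal.antidiagonal k,
      ((x.1.factorial : ℂ)⁻¹ • a ^ x.1) * ((x.2.factorial : ℂ)⁻¹ • b ^ x.2) := by
  rw [h.add_pow', Finset.smul_sum]
  refine Finset.sum_congr rfl fun x hx => ?_
  rw [← Nat.cast_smul_eq_nsmul ℂ, smul_smul, smul_mul_assoc, mul_smul_comm, smul_smul]
  congr 1
  rw [← Finset.HasAntidiagonal.mem_antidiagonal.mp hx, Nat.choose_symm_add, Nat.add_choose,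
    Nat.cast_div (Nat.factorial_mul_factorial_dvd_factorial_add _ _)
    (Nat.cast_ne_zero.mpr (mul_ne_zero (Nat.factorial_ne_zero _) (Nat.factorial_ne_zero _))),
    Nat.cast_mul]
  have h1 : (((x.1 + x.2).factorial : ℕ) : ℂ) ≠ 0 := Nat.cast_ne_zero.mpr (Nat.factorial_ne_zero _)
  field_simp

theorem expP_add {N : ℕ} {a b : R} (h : Commute a b) (ha : a ^ N = 0) (hb : b ^ N = 0)
    (hab : (a + b) ^ N = 0) : expP N (a + b) = expP N a * expP N b := by
  ext k
  rw [coeff_expP hab, factorial_smul_add_pow h, coeff_mul]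
  simp only [coeff_expP ha, coeff_expP hb]

theorem expP_zero {N : ℕ} (hN : N ≠ 0) : expP N (0 : R) = 1 := by
  ext k
  rw [coeff_expP (zero_pow hN), coeff_one]
  rcases Nat.eq_zero_or_pos k with rfl | hk
  · simp
  · rw [zero_pow hk.ne', smul_zero, if_neg hk.ne']

theorem expP_map {S : Type*} [Ring S] [Algebra ℂ S] (φ : R →ₐ[ℂ] S) (N : ℕ) (a : R) :
    (expP N a).map φ.toRingHom = expP N (φ a) := by
  rw [expP, expP, Polynomial.map_sum]
  refine Finset.sum_congr rfl fun k _ => ?_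
  rw [map_monomial, ← map_pow, ← map_smul]
  rfl

variable {D : GCDGA R}

theorem GCDGA.IsEven.pow {a : R} (ha : D.IsEven a) (k : ℕ) : D.IsEven (a ^ k) := by
  rw [IsEven, map_pow, ha]

theorem GCDGA.IsEven.d_pow {a : R} (ha : D.IsEven a) (k : ℕ) :
    D.d (a ^ (k + 1)) = (k + 1) • (D.d a * a ^ k) := by
  induction k with
  | zero => simp
  | succ k ih =>
    rw [pow_succ, (ha.pow (k + 1)).leibniz, ih, (ha.pow (k + 1)).comm, smul_mul_assoc, mul_assoc,
      ← pow_succ, add_smul (k + 1) 1, one_smul]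

theorem isEven_poly_iff {f : R[X]} : D.poly.IsEven f ↔ ∀ k, D.IsEven (f.coeff k) := by
  constructor
  · intro h k
    rw [GCDGA.IsEven, ← D.coeff_poly_inv, h]
  · intro h
    ext k
    rw [D.coeff_poly_inv, h]

theorem expP_even {N : ℕ} {a : R} (ha : D.IsEven a) (hN : a ^ N = 0) :
    D.poly.IsEven (expP N a) :=
  isEven_poly_iff.mpr fun k => by
    rw [coeff_expP hN]
    exact (ha.pow k).smul _

theorem factorial_succ_inv_mul (k : ℕ) :
    (((k + 1).factorial : ℂ)⁻¹) * ((k + 1 : ℕ) : ℂ) = (k.factorial : ℂ)⁻¹ := by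
  have h : ((k + 1 : ℕ) : ℂ) ≠ 0 := Nat.cast_ne_zero.mpr (Nat.succ_ne_zero k)
  rw [Nat.factorial_succ, Nat.cast_mul, mul_inv]
  field_simp

theorem d_expP {N : ℕ} {a : R} (ha : D.IsEven a) (hN : a ^ N = 0) :
    D.poly.d (expP N a) = X * (C (D.d a) * expP N a) := by
  ext k
  rw [D.coeff_poly_d, coeff_expP hN]
  cases k with
  | zero => rw [pow_zero, map_smul, GCDGA.d_one, smul_zero, coeff_X_mul_zero]
  | succ k =>
    rw [coeff_X_mul, coeff_C_mul, coeff_expP hN, map_smul, ha.d_pow, ← Nat.cast_smul_eq_nsmul ℂ,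
      smul_smul, factorial_succ_inv_mul, mul_smul_comm]

variable (D) in
/-- The twisted differential of polynomials. -/
def GCDGA.tw (Om : R) (ξ : R[X]) : R[X] := X * D.poly.d ξ + X ^ 2 * (C Om * ξ)

/-- The cross terms `d(Ω ξ) = -Ω dξ` and `Ω dξ` cancel because `Ω` is odd and closed, and `Ω² = 0`
again by oddness. -/
theorem tw_tw {Om : R} (hO : D.IsOdd Om) (hd : D.d Om = 0) (ξ : R[X]) :
    D.tw Om (D.tw Om ξ) = 0 := by
  have hC : D.poly.IsOdd (C Om) := hO.poly_C
  have h1 : D.poly.d (D.tw Om ξ) = -(X ^ 2 * (C Om * D.poly.d ξ)) := by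
    rw [GCDGA.tw, map_add, D.poly_d_X_mul, D.poly.d_d, mul_zero, zero_add, pow_two, mul_assoc,
      D.poly_d_X_mul, D.poly_d_X_mul, hC.leibniz, D.poly_d_C, hd, C_0, zero_mul, zero_sub]
    noncomm_ring
  have hz : C Om * (C Om * ξ) = 0 := by rw [← mul_assoc, hC.mul_self, zero_mul]
  have hX : ∀ f : R[X], C Om * (X * f) = X * (C Om * f) := fun f => by
    rw [← mul_assoc, ← X_mul, mul_assoc]
  have hX2 : ∀ f : R[X], C Om * (X ^ 2 * f) = X ^ 2 * (C Om * f) := fun f => by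
    rw [pow_two, mul_assoc, hX, hX, ← mul_assoc]
  rw [GCDGA.tw, h1, GCDGA.tw, mul_add (C Om), hX2, hz, hX, mul_zero, add_zero]
  simp only [pow_two]
  noncomm_ring

/-- Multiplication by `exp(-uη)` intertwines the twisted differentials. -/
theorem tw_expP_mul {N : ℕ} {η Om : R} (hη : D.IsEven η) (hN : η ^ N = 0) (ξ : R[X]) :
    D.tw (Om + D.d η) (expP N (-η) * ξ) = expP N (-η) * D.tw Om ξ := by
  have hη' : D.IsEven (-η) := by rw [GCDGA.IsEven, map_neg, hη]
  have hN' : (-η) ^ N = 0 := by rw [neg_pow, hN, mul_zero]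
  have he := expP_even hη' hN'
  -- Differentiating the exponential gives `-u dη`; with the outer factor `u` this cancels the
  -- additional twist `u² dη`.
  rw [GCDGA.tw, GCDGA.tw, he.leibniz, d_expP hη' hN', map_neg, C_neg, C_add]
  set e := expP N (-η)
  have hX : e * X = X * e := X_mul.symm
  have h1 : e * (X * D.poly.d ξ) = X * (e * D.poly.d ξ) := by
    rw [← mul_assoc, hX, mul_assoc]
  have h2 : e * (X ^ 2 * (C Om * ξ)) = X ^ 2 * (C Om * (e * ξ)) := by
    rw [← mul_assoc, he.comm, mul_assoc, ← mul_assoc e, he.comm, mul_assoc]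
  rw [mul_add e, h1, h2]
  simp only [pow_two]
  noncomm_ring

/-- The series `∑ uᵏ aᵏ / (k + 1)!`. -/
def expQ (N : ℕ) (a : R) : R[X] :=
  ∑ k ∈ Finset.range N, monomial k (((k + 1).factorial : ℂ)⁻¹ • a ^ k)

theorem coeff_expQ {N : ℕ} {a : R} (ha : a ^ N = 0) (k : ℕ) :
    (expQ N a).coeff k = ((k + 1).factorial : ℂ)⁻¹ • a ^ k := by
  rw [expQ, finsetSum_coeff]
  simp only [coeff_monomial]
  rw [Finset.sum_ite_eq']
  split_ifs with h
  · rfl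
  · rw [Finset.mem_range, not_lt] at h
    rw [pow_eq_zero_of_le h ha, smul_zero]

theorem expP_eq_one_add {N : ℕ} {a : R} (ha : a ^ N = 0) :
    expP N a = 1 + X * (C a * expQ N a) := by
  ext k
  cases k with
  | zero => simp [coeff_expP ha]
  | succ k =>
    rw [coeff_expP ha, coeff_add, coeff_X_mul, coeff_C_mul, coeff_expQ ha, coeff_one,
      if_neg (Nat.succ_ne_zero k), zero_add, mul_smul_comm, pow_succ']

/-- Independence of the choice of `η` in its class modulo exact forms. -/
theorem expP_sub_mul_eq_tw {N : ℕ} {η τ Om : R} (hO : D.IsOdd Om) (hη : D.IsEven η) (hτ : D.IsOdd τ)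
    (hN : η ^ N = 0) (hτN : (D.d τ) ^ N = 0) (hsum : (η + D.d τ) ^ N = 0) {ξ : R[X]}
    (hξ : D.tw Om ξ = 0) :
    expP N (-(η + D.d τ)) * ξ - expP N (-η) * ξ =
      -D.tw (Om + D.d η) (expP N (-η) * (C τ * (expQ N (-D.d τ) * ξ))) := by
  have hb : D.IsEven (-D.d τ) := by rw [GCDGA.IsEven, map_neg, hτ.d]
  have hbN : (-D.d τ) ^ N = 0 := by rw [neg_pow, hτN, mul_zero]
  have hN' : (-η) ^ N = 0 := by rw [neg_pow, hN, mul_zero]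
  have hη' : D.IsEven (-η) := by rw [GCDGA.IsEven, map_neg, hη]
  have hsum' : (-η + -D.d τ) ^ N = 0 := by rw [← neg_add, neg_pow, hsum, mul_zero]
  -- Since `exp(-u dτ) = 1 - u dτ q`, it remains to recognise `u dτ q ξ` as the twisted differential
  -- of `τ q ξ`.
  rw [tw_expP_mul hη hN, neg_add, expP_add (hη'.comm _) hN' hbN hsum', expP_eq_one_add hbN]
  set e := expP N (-η)
  set q := expQ N (-D.d τ) with hq
  have hqe : D.poly.IsEven q := isEven_poly_iff.mpr fun k => by
    rw [hq, coeff_expQ hbN]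
    exact (hb.pow k).smul _
  -- `q` is a power series in the closed element `dτ`.
  have hdq : D.poly.d q = 0 := by
    ext k
    rw [D.coeff_poly_d, hq, coeff_expQ hbN, map_smul, coeff_zero]
    cases k with
    | zero => rw [pow_zero, GCDGA.d_one, smul_zero]
    | succ k => rw [hb.d_pow, map_neg, D.d_d, neg_zero, zero_mul, smul_zero, smul_zero]
  have hτC : D.poly.IsOdd (C τ) := hτ.poly_C
  have h1 : D.poly.d (C τ * (q * ξ)) = C (D.d τ) * (q * ξ) - C τ * (q * D.poly.d ξ) := by
    rw [hτC.leibniz, hqe.leibniz, hdq, zero_mul, zero_add, D.poly_d_C]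
  have hX : ∀ f g : R[X], f * (X * g) = X * (f * g) := fun f g => by
    rw [← mul_assoc, ← X_mul, mul_assoc]
  have h2 : C Om * (C τ * (q * ξ)) = -(C τ * (q * (C Om * ξ))) := by
    have hOC : D.poly.IsOdd (C Om) := hO.poly_C
    rw [← mul_assoc, hOC.comm hτC, neg_mul, mul_assoc, ← mul_assoc (C Om), ← hqe.comm, mul_assoc]
  have h3 : X * D.poly.d ξ + X * (X * (C Om * ξ)) = 0 := by
    rw [← mul_assoc X X, ← pow_two]
    exact hξ
  -- Besides the wanted term, only a multiple of the twisted differential of `ξ` survives, and that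
  -- is zero.
  have h4 : D.tw Om (C τ * (q * ξ)) = X * (C (D.d τ) * (q * ξ)) -
      C τ * (q * (X * D.poly.d ξ + X * (X * (C Om * ξ)))) := by
    rw [GCDGA.tw, h1, h2, mul_add q, mul_add (C τ), hX, hX, hX q, hX (C τ), hX q, hX (C τ)]
    simp only [pow_two]
    noncomm_ring
  rw [h4, h3, mul_zero, mul_zero, sub_zero, C_neg]
  noncomm_ring

end TwistAlgebra

/-! ### Global smooth forms and twisted cohomology. -/

section Global

variable {E : Type uE} [NormedAddCommGroup E] [NormedSpace ℝ E] [FiniteDimensional ℝ E]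
  {M : Type uM} [TopologicalSpace M] [ChartedSpace E M] [IsManifold 𝓘(ℝ, E) ∞ M]

theorem form_eq_zero_of_mem {k : ℕ} (hk : Module.finrank ℝ E < k) {x : M}
    {a : ExteriorAlgebra ℂ (Cotangent E x)} (ha : a ∈ ⋀[ℂ]^k (Cotangent E x)) : a = 0 := by
  have : Module.Finite ℂ (Cotangent E x) := instFiniteDual E
  refine eq_zero_of_mem_exteriorPower ?_ ha
  exact (finrank_dual E).trans_lt hk

theorem form_pow_apply (w : Form E M) (k : ℕ) (x : M) : (w ^ k) x = w x ^ k :=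
  map_pow (evalForm E x) w k

theorem pow_eq_zero_of_homogeneous {w : Form E M} (hw : IsHomogeneousOn 2 w Set.univ) :
    w ^ (Module.finrank ℝ E + 1) = 0 := by
  funext x
  rw [form_pow_apply]
  exact form_eq_zero_of_mem (by lia) (pow_mem_exteriorPower (hw x trivial) _)

variable (E M) in
/-- The algebra of smooth forms. -/
def smoothForms : Subalgebra ℂ (Form E M) where
  carrier := {w | FormSmoothOn w Set.univ}
  mul_mem' ha hb p hp := (ha p hp).mul (hb p hp)
  add_mem' ha hb p hp := (ha p hp).add (hb p hp)
  algebraMap_mem' c p _ := formSmoothAt_algebraMap c p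

theorem FormSmoothOn.eventually {w : Form E M} {V : Set M} (hV : IsOpen V) (h : FormSmoothOn w V)
    {x : M} (hx : x ∈ V) : ∀ᶠ y in 𝓝 x, FormSmoothAt w y :=
  Filter.mem_of_superset (hV.mem_nhds hx) h

theorem FormSmoothOn.dForm_univ {w : Form E M} (h : FormSmoothOn w Set.univ) :
    FormSmoothOn (dForm w) Set.univ :=
  fun _ hp => FormSmoothAt.dForm (h.eventually isOpen_univ hp)

variable (E M) in
/-- The differential graded algebra of smooth forms. -/
def formDGA : GCDGA (smoothForms E M) where
  d :=
    { toFun w := ⟨dForm w.1, FormSmoothOn.dForm_univ w.2⟩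
      map_add' a b := Subtype.ext (funext fun p => dForm_add (a.2 p trivial) (b.2 p trivial))
      map_smul' c a := Subtype.ext (funext fun p => dForm_smul c (a.2 p trivial)) }
  inv := AlgHom.codRestrict ((formGradeInv E M).comp (smoothForms E M).val) _ fun w p hp =>
    (w.2 p hp).gradeInv
  leibniz a b := Subtype.ext (funext fun p => dForm_mul (a.2 p trivial) (b.2 p trivial))
  d_d a := Subtype.ext (funext fun p => dForm_dForm
    (FormSmoothOn.eventually isOpen_univ a.2 (x := p) trivial))
  d_inv a := Subtype.ext (funext fun p => dForm_gradeInv (a.2 p trivial))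
  even_comm _ _ h := Subtype.ext (funext fun p =>
    commute_of_gradeInv_eq (congrFun (congrArg Subtype.val h) p) _)
  odd_comm _ _ h := Subtype.ext (funext fun p =>
    mul_eq_gradeInv_mul_of_odd (congrFun (congrArg Subtype.val h) p) _)

variable (E M) in
/-- Polynomials with smooth coefficients, as polynomials. -/
def embPoly : (smoothForms E M)[X] →+* (Form E M)[X] :=
  Polynomial.mapRingHom (smoothForms E M).val.toRingHom

theorem coeff_embPoly (ξ : (smoothForms E M)[X]) (k : ℕ) :
    (embPoly E M ξ).coeff k = (ξ.coeff k).1 := coeff_map _ _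

theorem embPoly_mem (ξ : (smoothForms E M)[X]) : embPoly E M ξ ∈ smoothPoly E M := fun k => by
  rw [coeff_embPoly]
  exact (ξ.coeff k).2

theorem exists_embPoly {ξ : (Form E M)[X]} (h : ξ ∈ smoothPoly E M) : ∃ ζ, embPoly E M ζ = ξ := by
  have : ξ ∈ Polynomial.lifts (smoothForms E M).val.toRingHom :=
    (Polynomial.lifts_iff_coeff_lifts _).mpr fun k => ⟨⟨ξ.coeff k, h k⟩, rfl⟩
  exact (Polynomial.mem_lifts _).mp this

/-- The dictionary between the concrete differential on `Ω*(M)[u]` and the abstract one over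
`formDGA`, where the Leibniz rule and `d² = 0` are available unconditionally. -/
theorem dTwist_embPoly (Om : smoothForms E M) (ξ : (smoothForms E M)[X]) :
    dTwist Om.1 (embPoly E M ξ) = embPoly E M ((formDGA E M).tw Om ξ) := by
  have h1 : ((embPoly E M ξ).sum fun k a => monomial k (dForm a)) =
      embPoly E M ((formDGA E M).poly.d ξ) := by
    ext k : 1
    rw [coeff_dPoly, coeff_embPoly, coeff_embPoly, GCDGA.coeff_poly_d]
    rfl
  have h2 : embPoly E M (C Om) = C Om.1 := Polynomial.map_C _
  have h3 : embPoly E M X = X := Polynomial.map_X _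
  rw [dTwist, h1, GCDGA.tw, map_add, map_mul, map_mul, map_mul, map_pow, h2, h3]

theorem expP_val (N : ℕ) (a : smoothForms E M) : embPoly E M (expP N a) = expP N a.1 :=
  expP_map (smoothForms E M).val N a

theorem mem_twCocycles {Om : Form E M} {ξ : (Form E M)[X]} :
    ξ ∈ twCocycles Om ↔ ξ ∈ smoothPoly E M ∧ dTwist Om ξ = 0 := by
  constructor
  · rintro ⟨ζ, hζ, rfl⟩
    exact ⟨ζ.2, hζ⟩
  · rintro ⟨h, h'⟩
    exact ⟨⟨ξ, h⟩, h', rfl⟩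

theorem mem_twCoboundaries {Om : Form E M} {ξ : (Form E M)[X]} :
    ξ ∈ twCoboundaries Om ↔ ∃ ζ ∈ smoothPoly E M, dTwist Om ζ = ξ := by
  constructor
  · rintro ⟨ζ, rfl⟩
    exact ⟨ζ.1, ζ.2, rfl⟩
  · rintro ⟨ζ, h, rfl⟩
    exact ⟨⟨ζ, h⟩, rfl⟩

theorem isOdd_of_homogeneous {k : ℕ} (hk : Odd k) (w : smoothForms E M)
    (h : IsHomogeneousOn k w.1 Set.univ) : (formDGA E M).IsOdd w :=
  Subtype.ext (funext fun p => by
    have := gradeInv_of_mem (h p trivial)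
    rw [hk.neg_one_pow, neg_one_mul] at this
    exact this)

theorem isEven_of_homogeneous {k : ℕ} (hk : Even k) (w : smoothForms E M)
    (h : IsHomogeneousOn k w.1 Set.univ) : (formDGA E M).IsEven w :=
  Subtype.ext (funext fun p => by
    have := gradeInv_of_mem (h p trivial)
    rw [hk.neg_one_pow, one_mul] at this
    exact this)

/-- `(Ω*(M)[u], d_Ω)` is a complex. -/
theorem twCoboundaries_le_twCocycles {Om : Form E M} (hs : FormSmoothOn Om Set.univ)
    (h3 : IsHomogeneousOn 3 Om Set.univ) (hd : dForm Om = 0) :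
    twCoboundaries Om ≤ twCocycles Om := by
  intro ξ hξ
  obtain ⟨ζ, hζ, rfl⟩ := mem_twCoboundaries.mp hξ
  obtain ⟨z, rfl⟩ := exists_embPoly hζ
  have h := dTwist_embPoly ⟨Om, hs⟩ z
  rw [mem_twCocycles, h]
  refine ⟨embPoly_mem _, ?_⟩
  rw [dTwist_embPoly ⟨Om, hs⟩, tw_tw (isOdd_of_homogeneous (by decide) ⟨Om, hs⟩ h3)
    (Subtype.ext hd), map_zero]

theorem twistMap_smooth {η : Form E M} (hs : FormSmoothOn η Set.univ) {ξ : (Form E M)[X]}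
    (hξ : ξ ∈ smoothPoly E M) : twistMap η ξ ∈ smoothPoly E M := by
  obtain ⟨z, rfl⟩ := exists_embPoly hξ
  have : twistMap η (embPoly E M z) =
      embPoly E M (expP (Module.finrank ℝ E + 1) (-⟨η, hs⟩ : smoothForms E M) * z) := by
    rw [map_mul, expP_val]
    rfl
  rw [this]
  exact embPoly_mem _

theorem dTwist_twistMap {η Om : Form E M} (hO : FormSmoothOn Om Set.univ)
    (hs : FormSmoothOn η Set.univ) (h2 : IsHomogeneousOn 2 η Set.univ) {ξ : (Form E M)[X]}
    (hξ : ξ ∈ smoothPoly E M) :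
    dTwist (Om + dForm η) (twistMap η ξ) = twistMap η (dTwist Om ξ) := by
  obtain ⟨z, rfl⟩ := exists_embPoly hξ
  have ht : ∀ z, twistMap η (embPoly E M z) =
      embPoly E M (expP (Module.finrank ℝ E + 1) (-⟨η, hs⟩ : smoothForms E M) * z) := fun z => by
    rw [map_mul, expP_val]
    rfl
  have h := dTwist_embPoly (⟨Om, hO⟩ + (formDGA E M).d ⟨η, hs⟩)
    (expP (Module.finrank ℝ E + 1) (-⟨η, hs⟩ : smoothForms E M) * z)
  rw [tw_expP_mul (isEven_of_homogeneous (by decide) ⟨η, hs⟩ h2)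
    (Subtype.ext (pow_eq_zero_of_homogeneous h2)), ← ht, ← ht, ← dTwist_embPoly] at h
  exact h

theorem twistMap_neg_twistMap {η : Form E M} (h2 : IsHomogeneousOn 2 η Set.univ)
    (ξ : (Form E M)[X]) : twistMap (-η) (twistMap η ξ) = ξ := by
  have h0 := pow_eq_zero_of_homogeneous h2
  have hn : (-η) ^ (Module.finrank ℝ E + 1) = 0 := by rw [neg_pow, h0, mul_zero]
  have h1 : expU (η) * expU (-η) = 1 := by
    rw [← expP_zero (R := Form E M) (Nat.succ_ne_zero (Module.finrank ℝ E)), ← add_neg_cancel η]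
    refine (expP_add (Commute.neg_right (Commute.refl η)) h0 hn ?_).symm
    rw [add_neg_cancel, zero_pow (Nat.succ_ne_zero _)]
  rw [twistMap, twistMap, neg_neg, ← mul_assoc, h1, one_mul]

theorem twistMap_embPoly (a : smoothForms E M) (z : (smoothForms E M)[X]) :
    twistMap a.1 (embPoly E M z) =
      embPoly E M (expP (Module.finrank ℝ E + 1) (-a) * z) := by
  rw [map_mul, expP_val]
  rfl

theorem pow_eq_zero_of_val {w : smoothForms E M} (hw : IsHomogeneousOn 2 w.1 Set.univ) :
    w ^ (Module.finrank ℝ E + 1) = 0 :=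
  Subtype.ext (pow_eq_zero_of_homogeneous hw)

theorem twistMap_sub_mem_aux {η τ Om : smoothForms E M}
    (hO3 : IsHomogeneousOn 3 Om.1 Set.univ) (h2 : IsHomogeneousOn 2 η.1 Set.univ)
    (hτ1 : IsHomogeneousOn 1 τ.1 Set.univ)
    (hdτ : IsHomogeneousOn 2 ((formDGA E M).d τ).1 Set.univ)
    (hsum : IsHomogeneousOn 2 (η + (formDGA E M).d τ).1 Set.univ)
    {z : (smoothForms E M)[X]} (hz : (formDGA E M).tw Om z = 0) :
    twistMap (η + (formDGA E M).d τ).1 (embPoly E M z) - twistMap η.1 (embPoly E M z) ∈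
      twCoboundaries (Om + (formDGA E M).d η).1 := by
  have key := expP_sub_mul_eq_tw (N := Module.finrank ℝ E + 1)
    (isOdd_of_homogeneous (by decide) Om hO3)
    (isEven_of_homogeneous (by decide) η h2) (isOdd_of_homogeneous (by decide) τ hτ1)
    (pow_eq_zero_of_val h2) (pow_eq_zero_of_val hdτ) (pow_eq_zero_of_val hsum) hz
  rw [twistMap_embPoly, twistMap_embPoly, ← map_sub, key, map_neg, ← dTwist_embPoly]
  exact neg_mem (mem_twCoboundaries.mpr ⟨_, embPoly_mem _, rfl⟩)

theorem twistMap_sub_mem {η τ Om : Form E M} (hO : FormSmoothOn Om Set.univ)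
    (hO3 : IsHomogeneousOn 3 Om Set.univ)
    (hs : FormSmoothOn η Set.univ) (h2 : IsHomogeneousOn 2 η Set.univ)
    (hτ : FormSmoothOn τ Set.univ) (hτ1 : IsHomogeneousOn 1 τ Set.univ) {ξ : (Form E M)[X]}
    (hξ : ξ ∈ twCocycles Om) :
    twistMap (η + dForm τ) ξ - twistMap η ξ ∈ twCoboundaries (Om + dForm η) := by
  obtain ⟨hξs, hξd⟩ := mem_twCocycles.mp hξ
  obtain ⟨z, rfl⟩ := exists_embPoly hξs
  have hdτ : IsHomogeneousOn 2 (dForm τ) Set.univ := fun p _ =>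
    dForm_mem (hτ p trivial) (Filter.Eventually.of_forall fun x => hτ1 x trivial)
  have hsum : IsHomogeneousOn 2 (η + dForm τ) Set.univ := fun p hp =>
    add_mem (h2 p hp) (hdτ p hp)
  have hz : (formDGA E M).tw ⟨Om, hO⟩ z = 0 := by
    have hinj : Function.Injective (embPoly E M) :=
      Polynomial.map_injective _ Subtype.val_injective
    apply hinj
    rw [← dTwist_embPoly, map_zero]
    exact hξd
  exact twistMap_sub_mem_aux (η := ⟨η, hs⟩) (τ := ⟨τ, hτ⟩) (Om := ⟨Om, hO⟩) hO3 h2 hτ1 hdτ hsum hz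

/-! ### The induced isomorphism -/

/-- Multiplication by `exp(-uη)` as a linear map. -/
def twistLin (η : Form E M) : (Form E M)[X] →ₗ[ℂ] (Form E M)[X] where
  toFun := twistMap η
  map_add' _ _ := mul_add _ _ _
  map_smul' _ _ := mul_smul_comm _ _ _

theorem twistMap_mem_twCocycles {η Om Om' : Form E M} (hO : FormSmoothOn Om Set.univ)
    (hs : FormSmoothOn η Set.univ) (h2 : IsHomogeneousOn 2 η Set.univ)
    (h : Om' = Om + dForm η) {ξ : (Form E M)[X]} (hξ : ξ ∈ twCocycles Om) :
    twistMap η ξ ∈ twCocycles Om' := by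
  obtain ⟨h1, h1'⟩ := mem_twCocycles.mp hξ
  rw [mem_twCocycles, h, dTwist_twistMap hO hs h2 h1, h1']
  exact ⟨twistMap_smooth hs h1, mul_zero _⟩

theorem twistMap_mem_twCoboundaries {η Om Om' : Form E M} (hO : FormSmoothOn Om Set.univ)
    (hs : FormSmoothOn η Set.univ) (h2 : IsHomogeneousOn 2 η Set.univ)
    (h : Om' = Om + dForm η) {ξ : (Form E M)[X]} (hξ : ξ ∈ twCoboundaries Om) :
    twistMap η ξ ∈ twCoboundaries Om' := by
  obtain ⟨ζ, hζ, rfl⟩ := mem_twCoboundaries.mp hξ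
  rw [mem_twCoboundaries, h, ← dTwist_twistMap hO hs h2 hζ]
  exact ⟨_, twistMap_smooth hs hζ, rfl⟩

/-- The map induced on cohomology by `ξ ↦ exp(-uη) ξ`. -/
def twistCohomology {η Om Om' : Form E M} (hO : FormSmoothOn Om Set.univ)
    (hs : FormSmoothOn η Set.univ) (h2 : IsHomogeneousOn 2 η Set.univ)
    (h : Om' = Om + dForm η) : TwCohomology Om →ₗ[ℂ] TwCohomology Om' :=
  Submodule.mapQ _ _ ((twistLin η).restrict fun _ hξ => twistMap_mem_twCocycles hO hs h2 h hξ)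
    fun _ hξ => twistMap_mem_twCoboundaries hO hs h2 h hξ

theorem twistCohomology_twClass {η Om Om' : Form E M} (hO : FormSmoothOn Om Set.univ)
    (hs : FormSmoothOn η Set.univ) (h2 : IsHomogeneousOn 2 η Set.univ)
    (h : Om' = Om + dForm η) (ξ : (Form E M)[X]) (hξ : ξ ∈ twCocycles Om) :
    twistCohomology hO hs h2 h (twClass Om ξ hξ) =
      twClass Om' (twistMap η ξ) (twistMap_mem_twCocycles hO hs h2 h hξ) := rfl

theorem twClass_eq_iff {Om : Form E M} {ξ ζ : (Form E M)[X]} (hξ : ξ ∈ twCocycles Om)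
    (hζ : ζ ∈ twCocycles Om) :
    twClass Om ξ hξ = twClass Om ζ hζ ↔ ξ - ζ ∈ twCoboundaries Om :=
  Submodule.Quotient.eq _

/-- The inverse is induced by `-η`, which compares in the opposite direction because `Ω = Ω' +
d(-η)`. -/
theorem twistCohomology_bijective {η Om Om' : Form E M} (hO : FormSmoothOn Om Set.univ)
    (hs : FormSmoothOn η Set.univ) (h2 : IsHomogeneousOn 2 η Set.univ)
    (h : Om' = Om + dForm η) : Function.Bijective (twistCohomology hO hs h2 h) := by
  have hs' : FormSmoothOn (-η) Set.univ := (smoothForms E M).neg_mem hs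
  have h2' : IsHomogeneousOn 2 (-η) Set.univ := fun x hx => neg_mem (h2 x hx)
  have hdneg : dForm (-η) = -dForm η := by
    funext p
    have := dForm_smul (-1) (hs p trivial)
    rw [neg_one_smul, neg_one_smul] at this
    exact this
  have h' : Om = Om' + dForm (-η) := by rw [h, hdneg]; abel
  have hO' : FormSmoothOn Om' Set.univ := by
    rw [h]
    exact (smoothForms E M).add_mem hO (FormSmoothOn.dForm_univ hs)
  refine Function.bijective_iff_has_inverse.mpr ⟨twistCohomology hO' hs' h2' h', ?_, ?_⟩
  · intro c
    obtain ⟨⟨ξ, hξ⟩, rfl⟩ := Submodule.Quotient.mk_surjective _ c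
    refine congrArg (Submodule.Quotient.mk (p := (twCoboundaries Om).submoduleOf _))
      (Subtype.ext ?_)
    exact twistMap_neg_twistMap h2 ξ
  · intro c
    obtain ⟨⟨ξ, hξ⟩, rfl⟩ := Submodule.Quotient.mk_surjective _ c
    refine congrArg (Submodule.Quotient.mk (p := (twCoboundaries Om').submoduleOf _))
      (Subtype.ext ?_)
    have := twistMap_neg_twistMap h2' ξ
    rw [neg_neg] at this
    exact this

end Global

/-! ### Sections, frames and locality of connections. -/

section BundleCalculus

variable {E : Type uE} [NormedAddCommGroup E] [NormedSpace ℝ E]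
  {M : Type uM} [TopologicalSpace M] [ChartedSpace E M] {U : Opens M}
  {B : CxBundle.{uE, uM, uV} E U}

theorem contMDiffAt_sum' {κ : Type*} (t : Finset κ) {f : κ → M → ℂ} {x : M}
    (h : ∀ i ∈ t, ContMDiffAt 𝓘(ℝ, E) 𝓘(ℝ, ℂ) ∞ (f i) x) :
    ContMDiffAt 𝓘(ℝ, E) 𝓘(ℝ, ℂ) ∞ (fun y => ∑ i ∈ t, f i y) x := by
  classical
  induction t using Finset.induction_on with
  | empty => simpa using contMDiffAt_const
  | insert i t hi ih =>
    simp only [Finset.sum_insert hi]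
    exact (h i (Finset.mem_insert_self _ _)).add
      (ih fun j hj => h j (Finset.mem_insert_of_mem hj))

theorem contMDiffAt_mul' {f g : M → ℂ} {x : M} (hf : ContMDiffAt 𝓘(ℝ, E) 𝓘(ℝ, ℂ) ∞ f x)
    (hg : ContMDiffAt 𝓘(ℝ, E) 𝓘(ℝ, ℂ) ∞ g x) :
    ContMDiffAt 𝓘(ℝ, E) 𝓘(ℝ, ℂ) ∞ (fun y => f y * g y) x :=
  ContDiffAt.comp_contMDiffAt (g := fun p : ℂ × ℂ => p.1 * p.2) contDiff_mul.contDiffAt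
    (hf.prodMk_space hg)

theorem SectionSmoothOn.mono {s : ∀ x, B.Fiber x} {V W : Set M} (h : SectionSmoothOn B s W)
    (hV : V ⊆ W) : SectionSmoothOn B s V := fun p hp a => h p (hV hp) a

theorem SectionSmoothOn.add {s t : ∀ x, B.Fiber x} {V : Set M} (hs : SectionSmoothOn B s V)
    (ht : SectionSmoothOn B t V) : SectionSmoothOn B (fun y => s y + t y) V := fun p hp a => by
  simp only [map_add]
  exact (hs p hp a).add (ht p hp a)

theorem SectionSmoothOn.smul {f : M → ℂ} {s : ∀ x, B.Fiber x} {V : Set M}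
    (hf : ∀ x ∈ V, ContMDiffAt 𝓘(ℝ, E) 𝓘(ℝ, ℂ) ∞ f x) (hs : SectionSmoothOn B s V) :
    SectionSmoothOn B (fun y => f y • s y) V := fun p hp a => by
  simp only [map_smul]
  exact contMDiffAt_mul' (hf p hp) (hs p hp a)

theorem sectionSmoothOn_zero (V : Set M) : SectionSmoothOn B (fun _ => 0) V := fun p _ a => by
  simp only [map_zero]
  exact contMDiffAt_const

theorem SectionSmoothOn.congr {s t : ∀ x, B.Fiber x} {V : Opens M} (hs : SectionSmoothOn B s V)
    (h : ∀ x ∈ V, s x = t x) : SectionSmoothOn B t V := fun p hp a =>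
  (hs p hp a).congr_of_eventuallyEq (Filter.mem_of_superset (V.isOpen.mem_nhds hp) fun x hx => by
    simp only [Set.mem_ofPred_eq, h x hx])

theorem SectionSmoothOn.sum {κ : Type*} (t : Finset κ) {s : κ → ∀ x, B.Fiber x} {V : Set M}
    (h : ∀ i, SectionSmoothOn B (s i) V) : SectionSmoothOn B (fun y => ∑ i ∈ t, s i y) V := by
  classical
  induction t using Finset.induction_on with
  | empty => simpa using sectionSmoothOn_zero V
  | insert i t hi ih =>
    simp only [Finset.sum_insert hi]
    exact (h i).add ih

theorem sectionSmoothOn_frame (p : M) (b : Fin (B.rank p)) :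
    SectionSmoothOn B (B.frame p b) (B.dom p) := fun q hq a =>
  (B.smooth_change q p a b).contMDiffAt (((B.dom q).isOpen.inter (B.dom p).isOpen).mem_nhds
    ⟨B.mem_dom q (B.dom_le p hq), hq⟩)

theorem coframe_expand {p q y : M} (hq : y ∈ B.dom q) (a : Fin (B.rank p)) (v : B.Fiber y) :
    B.coframe p a y v = ∑ c, B.coframe q c y v * B.coframe p a y (B.frame q c y) := by
  conv_lhs => rw [← B.sum_coframe q y hq v, map_sum]
  simp only [map_smul, smul_eq_mul]

theorem contMDiffAt_change {p q x : M} (hp : x ∈ B.dom p) (hq : x ∈ B.dom q) (a b) :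
    ContMDiffAt 𝓘(ℝ, E) 𝓘(ℝ, ℂ) ∞ (fun x => B.coframe p a x (B.frame q b x)) x :=
  (B.smooth_change p q a b).contMDiffAt
    (((B.dom p).isOpen.inter (B.dom q).isOpen).mem_nhds ⟨hp, hq⟩)

/-- The components of a smooth section in any frame are smooth. -/
theorem SectionSmoothOn.coframe {s : ∀ x, B.Fiber x} {V : Set M} (hs : SectionSmoothOn B s V)
    {p x : M} (hx : x ∈ V) (hp : x ∈ B.dom p) (a : Fin (B.rank p)) :
    ContMDiffAt 𝓘(ℝ, E) 𝓘(ℝ, ℂ) ∞ (fun y => B.coframe p a y (s y)) x := by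
  have hxx : x ∈ B.dom x := B.mem_dom x (B.dom_le p hp)
  have h : ContMDiffAt 𝓘(ℝ, E) 𝓘(ℝ, ℂ) ∞
      (fun y => ∑ c, B.coframe x c y (s y) * B.coframe p a y (B.frame x c y)) x :=
    contMDiffAt_sum' _ fun c _ => contMDiffAt_mul' (hs x hx c) (contMDiffAt_change hp hxx a c)
  refine h.congr_of_eventuallyEq
    (Filter.mem_of_superset ((B.dom x).isOpen.mem_nhds hxx) fun y hy => ?_)
  exact coframe_expand hy a _

namespace Connection

variable (nab : Connection B)

theorem D_zero {x : M} (hx : x ∈ U) : nab.D (fun _ => 0) x = 0 := by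
  have h := nab.add U le_rfl (fun _ => 0) (fun _ => 0) (sectionSmoothOn_zero _)
    (sectionSmoothOn_zero _) x hx
  simpa using h

/-- Connections are local operators. -/
theorem D_congr {V : Opens M} (hV : V ≤ U) {s t : ∀ x, B.Fiber x} (hs : SectionSmoothOn B s V)
    (h : ∀ x ∈ V, s x = t x) {x : M} (hx : x ∈ V) : nab.D s x = nab.D t x := by
  classical
  have hr : SectionSmoothOn B (fun y => t y - s y) V :=
    (sectionSmoothOn_zero _).congr fun y hy => by rw [h y hy, sub_self]
  have hrx : t x - s x = 0 := by rw [h x hx, sub_self]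
  -- The difference `r = t - s` vanishes on `V`, so `f r = r` everywhere, while `f` is smooth on `V`
  -- and zero there. The Leibniz rule then gives `∇r = 0` on `V`, without bump functions.
  set f : M → ℂ := fun y => if y ∈ V then 0 else 1 with hf
  have hfs : ContMDiffOn 𝓘(ℝ, E) 𝓘(ℝ, ℂ) ∞ f V :=
    (contMDiffOn_const (c := (0 : ℂ))).congr fun y hy => if_pos hy
  have hfr : (fun y => f y • (t y - s y)) = fun y => t y - s y := by
    funext y
    by_cases hy : y ∈ V
    · rw [h y hy, sub_self, smul_zero]
    · simp only [hf, if_neg hy, one_smul]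
  have h0 : nab.D (fun y => t y - s y) x = 0 := by
    ext v
    have := nab.leibniz V hV f _ hfs hr x hx v
    rw [hfr, hrx, smul_zero, add_zero] at this
    rw [this, hf]
    simp only [if_pos hx, zero_smul, LinearMap.zero_apply]
  have h1 := nab.add V hV s (fun y => t y - s y) hs hr x hx
  rw [h0, add_zero] at h1
  rw [← h1]
  congr 1
  funext y
  rw [add_sub_cancel]

/-- The Leibniz rule for finite linear combinations. -/
theorem D_sum {V : Opens M} (hV : V ≤ U) {κ : Type*} (t : Finset κ) {f : κ → M → ℂ}
    {s : κ → ∀ x, B.Fiber x} (hf : ∀ i, ∀ x ∈ V, ContMDiffAt 𝓘(ℝ, E) 𝓘(ℝ, ℂ) ∞ (f i) x)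
    (hs : ∀ i, SectionSmoothOn B (s i) V) {x : M} (hx : x ∈ V) (v : TangentSpace 𝓘(ℝ, E) x) :
    nab.D (fun y => ∑ i ∈ t, f i y • s i y) x v =
      ∑ i ∈ t, (f i x • nab.D (s i) x v + dFun (f i) x v • s i x) := by
  classical
  induction t using Finset.induction_on with
  | empty => simp [D_zero nab (hV hx)]
  | insert i t hi ih =>
    simp only [Finset.sum_insert hi]
    rw [nab.add V hV _ _ ((hs i).smul (hf i)) (SectionSmoothOn.sum t fun j => (hs j).smul (hf j))
      x hx, LinearMap.add_apply, ih,
      nab.leibniz V hV _ _ (fun y hy => (hf i y hy).contMDiffWithinAt) (hs i) x hx v]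

/-- The entry `A_ab` of the connection matrix as a covector. -/
def coeff (p : M) (a b : Fin (B.rank p)) (y : M) : Cotangent E y :=
  (B.coframe p a y).restrictScalars ℝ ∘ₗ nab.D (B.frame p b) y

theorem matrix_apply (p : M) (a b : Fin (B.rank p)) (y : M) :
    nab.matrix p a b y = ExteriorAlgebra.ι ℂ (nab.coeff p a b y) := rfl

theorem D_frame {p y : M} (hy : y ∈ B.dom p) (b : Fin (B.rank p)) (v : TangentSpace 𝓘(ℝ, E) y) :
    nab.D (B.frame p b) y v = ∑ a, nab.coeff p a b y v • B.frame p a y :=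
  (B.sum_coframe p y hy _).symm

end Connection

theorem ofCovector_sum_smul {κ : Type*} [Fintype κ] (g : κ → ℂ) {y : M} (c : κ → Cotangent E y) :
    ExteriorAlgebra.ι ℂ (∑ i, g i • c i) =
      ∑ i, algebraMap ℂ (ExteriorAlgebra ℂ (Cotangent E y)) (g i) * ExteriorAlgebra.ι ℂ (c i) := by
  simp only [map_sum, map_smul, Algebra.smul_def]

end BundleCalculus

/-! ### Smoothness of connection matrices in arbitrary local frames. -/

section BundleForms

variable {E : Type uE} [NormedAddCommGroup E] [NormedSpace ℝ E] [FiniteDimensional ℝ E]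
  {M : Type uM} [TopologicalSpace M] [ChartedSpace E M] [IsManifold 𝓘(ℝ, E) ∞ M]
  {U : Opens M} {B : CxBundle.{uE, uM, uV} E U}

theorem FormSmoothAt.sum {κ : Type*} (t : Finset κ) {w : κ → Form E M} {x : M}
    (h : ∀ i, FormSmoothAt (w i) x) : FormSmoothAt (∑ i ∈ t, w i) x := by
  classical
  induction t using Finset.induction_on with
  | empty => simpa using formSmoothAt_zero x
  | insert i t hi ih => rw [Finset.sum_insert hi]; exact (h i).add ih

theorem form_sum_apply {κ : Type*} (t : Finset κ) (w : κ → Form E M) (x : M) :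
    (∑ i ∈ t, w i) x = ∑ i ∈ t, w i x := map_sum (evalForm E x) w t

/-- The definition tests smoothness at `x` in the frame centred at `x` only. To differentiate
connection matrices, one fixed frame must work at all points nearby; the smooth changes of frame
provide this. -/
theorem OneFormSmoothOn.comp {t : ∀ x : M, TangentSpace 𝓘(ℝ, E) x →ₗ[ℝ] B.Fiber x} {V : Set M}
    (ht : OneFormSmoothOn B t V) {p x : M} (hx : x ∈ V) (hp : x ∈ B.dom p) (a : Fin (B.rank p)) :
    FormSmoothAt (oneFormComp B t p a) x := by
  have hxx : x ∈ B.dom x := B.mem_dom x (B.dom_le p hp)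
  have h : FormSmoothAt (∑ c, ofFun (fun y => B.coframe p a y (B.frame x c y)) *
      oneFormComp B t x c) x :=
    FormSmoothAt.sum _ fun c => (formSmoothAt_ofFun (contMDiffAt_change hp hxx a c)).mul (ht x hx c)
  refine h.congr (Filter.mem_of_superset ((B.dom x).isOpen.mem_nhds hxx) fun y hy => ?_)
  rw [Set.mem_ofPred_eq, form_sum_apply]
  refine (ofCovector_sum_smul _ _).symm.trans (congrArg _ ?_)
  ext v
  simp only [LinearMap.sum_apply, LinearMap.smul_apply, LinearMap.comp_apply,
    LinearMap.restrictScalars_apply, smul_eq_mul]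
  rw [coframe_expand hy a]
  exact Finset.sum_congr rfl fun c _ => mul_comm _ _

namespace Connection

theorem matrix_smoothNear (nab : Connection B) {p x : M} (hx : x ∈ B.dom p) :
    MSmoothNear x (nab.matrix p : Matrix _ _ (Form E M)) := fun a b =>
  Filter.mem_of_superset ((B.dom p).isOpen.mem_nhds hx) fun _ hy =>
    (nab.smooth (B.dom p) (B.dom_le p) _ (sectionSmoothOn_frame p b)).comp hy hy a

theorem matrix_oneNear (nab : Connection B) (p x : M) :
    MOneNear x (nab.matrix p : Matrix _ _ (Form E M)) := fun _ _ =>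
  Filter.Eventually.of_forall fun _ => ι_mem_exteriorPower _

end Connection

end BundleForms

/-! ### Bundle maps that intertwine connections. -/

section Gauge

variable {E : Type uE} [NormedAddCommGroup E] [NormedSpace ℝ E]
  {M : Type uM} [TopologicalSpace M] [ChartedSpace E M]
  {U U' : Opens M} {B : CxBundle.{uE, uM, uV} E U} {B' : CxBundle.{uE, uM, uV} E U'}

/-- Over the open set `W`, the fibrewise linear map `ψ` intertwines `∇ + a` and `∇'`. -/
structure Intertwines (nab : Connection B) (nab' : Connection B')
    (ψ : ∀ y, B.Fiber y →ₗ[ℂ] B'.Fiber y) (a : ∀ y : M, Cotangent E y) (W : Opens M) : Prop where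
  le' : W ≤ U'
  smooth : ∀ V : Opens M, V ≤ W → ∀ s, SectionSmoothOn B s V →
    SectionSmoothOn B' (fun y => ψ y (s y)) V
  D_eq : ∀ V : Opens M, V ≤ W → ∀ s, SectionSmoothOn B s V → ∀ y ∈ V,
    ∀ v : TangentSpace 𝓘(ℝ, E) y,
      nab'.D (fun y => ψ y (s y)) y v = ψ y (nab.D s y v) + a y v • ψ y (s y)

theorem intertwines_id (nab : Connection B) :
    Intertwines nab nab (fun _ => LinearMap.id) (fun _ => 0) U where
  le' := le_rfl
  smooth _ _ _ hs := hs
  D_eq V hV s hs y hy v := by simp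

/-- The matrix of `ψ` in local frames. -/
def transMatrix (ψ : ∀ y, B.Fiber y →ₗ[ℂ] B'.Fiber y) (p' p : M) :
    Matrix (Fin (B'.rank p')) (Fin (B.rank p)) (M → ℂ) :=
  fun i j y => B'.coframe p' i y (ψ y (B.frame p j y))

theorem transMatrix_smooth {nab : Connection B} {nab' : Connection B'}
    {ψ : ∀ y, B.Fiber y →ₗ[ℂ] B'.Fiber y} {a : ∀ y : M, Cotangent E y} {W : Opens M}
    (h : Intertwines nab nab' ψ a W) {p p' y : M} (hy : y ∈ W ⊓ B.dom p ⊓ B'.dom p') (i j) :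
    ContMDiffAt 𝓘(ℝ, E) 𝓘(ℝ, ℂ) ∞ (transMatrix ψ p' p i j) y := by
  refine SectionSmoothOn.coframe (V := (W ⊓ B.dom p : Opens M)) ?_ hy.1 hy.2 i
  exact h.smooth _ inf_le_left _ ((sectionSmoothOn_frame p j).mono fun _ hz => hz.2)

/-- Compute `∇'(ψ e_j)` twice: by the intertwining property, and by expanding `ψ e_j` in the frame
of `B'` and applying the Leibniz rule; then compare components. -/
theorem gauge_relation {nab : Connection B} {nab' : Connection B'}
    {ψ : ∀ y, B.Fiber y →ₗ[ℂ] B'.Fiber y} {a : ∀ y : M, Cotangent E y} {W : Opens M}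
    (h : Intertwines nab nab' ψ a W) {p p' y : M} (hy : y ∈ W ⊓ B.dom p ⊓ B'.dom p') (i j) :
    ∑ k, transMatrix ψ p' p k j y • nab'.coeff p' i k y + dFun (transMatrix ψ p' p i j) y =
      ∑ k, transMatrix ψ p' p i k y • nab.coeff p k j y + transMatrix ψ p' p i j y • a y := by
  ext v
  have hVU' : W ⊓ B.dom p ⊓ B'.dom p' ≤ U' := (inf_le_left.trans inf_le_left).trans h.le'
  have hs : SectionSmoothOn B (B.frame p j) (W ⊓ B.dom p ⊓ B'.dom p' : Opens M) :=
    (sectionSmoothOn_frame p j).mono fun _ hz => hz.1.2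
  have hψ := h.smooth _ (inf_le_left.trans inf_le_left) _ hs
  have h1 := h.D_eq _ (inf_le_left.trans inf_le_left) _ hs y hy v
  have h2 := nab'.D_congr hVU' (t := fun z => ∑ k, transMatrix ψ p' p k j z • B'.frame p' k z)
    hψ (fun z hz => (B'.sum_coframe p' z hz.2 _).symm) hy
  have h3 := nab'.D_sum hVU' Finset.univ (fun k z hz => transMatrix_smooth h hz k j)
    (fun k => (sectionSmoothOn_frame (B := B') p' k).mono fun _ hz => hz.2) hy v
  rw [h2, h3, nab.D_frame hy.1.2] at h1
  have h4 := congrArg (B'.coframe p' i y) h1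
  simp only [map_sum, map_add, map_smul, smul_eq_mul, B'.coframe_frame p' y hy.2, mul_ite, mul_one,
    mul_zero, Finset.sum_add_distrib, Finset.sum_ite_eq, Finset.mem_univ, if_true] at h4
  simp only [LinearMap.add_apply, LinearMap.sum_apply, LinearMap.smul_apply, smul_eq_mul]
  refine h4.trans (congrArg₂ _ ?_ (mul_comm _ _))
  exact Finset.sum_congr rfl fun k _ => mul_comm _ _

/-- The matrix of a bijective `ψ` is invertible. -/
theorem transMatrix_inverse {ψ : ∀ y, B.Fiber y →ₗ[ℂ] B'.Fiber y} {p p' y : M}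
    (hp : y ∈ B.dom p) (hp' : y ∈ B'.dom p') (h : Function.Bijective (ψ y)) :
    ∃ g : Matrix (Fin (B.rank p)) (Fin (B'.rank p')) ℂ,
      ((transMatrix ψ p' p).map fun f => f y) * g = 1 ∧
      g * ((transMatrix ψ p' p).map fun f => f y) = 1 := by
  set e := LinearEquiv.ofBijective (ψ y) h
  refine ⟨Matrix.of fun j i => B.coframe p j y (e.symm (B'.frame p' i y)), ?_, ?_⟩
  · ext i j
    rw [Matrix.mul_apply, Matrix.one_apply, ← B'.coframe_frame p' y hp' i j]
    have h1 : ψ y (e.symm (B'.frame p' j y)) = B'.frame p' j y := e.apply_symm_apply _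
    conv_rhs => rw [← h1, ← B.sum_coframe p y hp (e.symm (B'.frame p' j y))]
    simp only [map_sum, map_smul, smul_eq_mul]
    exact Finset.sum_congr rfl fun k _ => mul_comm _ _
  · ext i j
    rw [Matrix.mul_apply, Matrix.one_apply, ← B.coframe_frame p y hp i j]
    have h1 : e.symm (ψ y (B.frame p j y)) = B.frame p j y := e.symm_apply_apply _
    conv_rhs => rw [← h1, ← B'.sum_coframe p' y hp' (ψ y (B.frame p j y))]
    simp only [map_sum, map_smul, smul_eq_mul]
    exact Finset.sum_congr rfl fun k _ => mul_comm _ _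

end Gauge

/-! ### Gauge covariance of the twisted curvature. -/

section GaugeTheta

variable {E : Type uE} [NormedAddCommGroup E] [NormedSpace ℝ E] [FiniteDimensional ℝ E]
  {M : Type uM} [TopologicalSpace M] [ChartedSpace E M] [IsManifold 𝓘(ℝ, E) ∞ M]
  {U U' : Opens M} {B : CxBundle.{uE, uM, uV} E U} {B' : CxBundle.{uE, uM, uV} E U'}

/-- Used in two ways: with `a` the connection form of `L_αβ` and `w`, `w'` equal to `ω_α`, `ω_β`,
for the passage from `E_α` to `E_β`; and with `a = 0` and `ψ` the identity, for a change of frame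
within one line bundle. -/
theorem Intertwines.theta {nab : Connection B} {nab' : Connection B'}
    {ψ : ∀ y, B.Fiber y →ₗ[ℂ] B'.Fiber y} {a : ∀ y : M, Cotangent E y} {W : Opens M}
    (h : Intertwines nab nab' ψ a W) {p p' x : M} (hx : x ∈ W ⊓ B.dom p ⊓ B'.dom p')
    (ha : ofCovector a ∈ smoothNear E x) {w w' : Form E M}
    (hw : w x = w' x + dForm (ofCovector a) x) :
    (thetaMatrix (nab'.matrix p') w').map (evalForm E x) *
        ((transMatrix ψ p' p).map fun f => f x).map
          (algebraMap ℂ (ExteriorAlgebra ℂ (Cotangent E x))) =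
      ((transMatrix ψ p' p).map fun f => f x).map
          (algebraMap ℂ (ExteriorAlgebra ℂ (Cotangent E x))) *
        (thetaMatrix (nab.matrix p) w).map (evalForm E x) := by
  have hnear : ∀ᶠ y in 𝓝 x, y ∈ W ⊓ B.dom p ⊓ B'.dom p' := (Opens.isOpen _).mem_nhds hx
  refine theta_gauge (nab'.matrix_smoothNear hx.2) (nab'.matrix_oneNear p' x)
    (nab.matrix_smoothNear hx.1.2) (nab.matrix_oneNear p x) ha
    (Filter.Eventually.of_forall fun _ => ι_mem_exteriorPower _)
    (fun i j => hnear.mono fun y hy => transMatrix_smooth h hy i j)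
    (fun i j => hnear.mono fun y hy => ?_) hw
  have := congrArg (ExteriorAlgebra.ι ℂ) (gauge_relation h hy i j)
  rw [map_add, map_add, ofCovector_sum_smul, ofCovector_sum_smul, map_smul, Algebra.smul_def] at this
  refine Eq.trans ?_ this
  congr 1
  exact Finset.sum_congr rfl fun k _ => (Algebra.commutes _ _).symm

end GaugeTheta

/-! ### Endomorphism-valued forms as matrices. -/

section EndMatrix

variable {E : Type uE} [NormedAddCommGroup E] [NormedSpace ℝ E]
  {M : Type uM} [TopologicalSpace M] [ChartedSpace E M] {U : Opens M}
  (B : CxBundle.{uE, uM, uV} E U)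

/-- The basis of a fibre given by a local frame. -/
def frameBasis {p x : M} (hx : x ∈ B.dom p) : Module.Basis (Fin (B.rank p)) ℂ (B.Fiber x) :=
  Module.Basis.ofEquivFun
    { toFun := fun v a => B.coframe p a x v
      map_add' := fun v w => funext fun a => map_add _ _ _
      map_smul' := fun c v => funext fun a => map_smul _ _ _
      invFun := fun c => ∑ a, c a • B.frame p a x
      left_inv := fun v => B.sum_coframe p x hx v
      right_inv := fun c => funext fun a => by
        simp [map_sum, B.coframe_frame p x hx] }

theorem frameBasis_repr {p x : M} (hx : x ∈ B.dom p) (v : B.Fiber x) (a : Fin (B.rank p)) :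
    (frameBasis B hx).repr v a = B.coframe p a x v := rfl

theorem frameBasis_apply {p x : M} (hx : x ∈ B.dom p) (b : Fin (B.rank p)) :
    frameBasis B hx b = B.frame p b x := by
  apply (frameBasis B hx).repr.injective
  ext a
  rw [Module.Basis.repr_self, Finsupp.single_apply, frameBasis_repr, B.coframe_frame p x hx]
  simp only [eq_comm]

/-- The matrix of an endomorphism-valued form in a local frame. -/
def endMat {p x : M} (hx : x ∈ B.dom p) : EndForm B x →ₐ[ℂ]
    Matrix (Fin (B.rank p)) (Fin (B.rank p)) (ExteriorAlgebra ℂ (Cotangent E x)) :=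
  Algebra.TensorProduct.lift
    ((Algebra.ofId ℂ (ExteriorAlgebra ℂ (Cotangent E x))).mapMatrix.comp
      (LinearMap.toMatrixAlgEquiv (frameBasis B hx)).toAlgHom)
    (Matrix.scalarAlgHom _ ℂ) fun T w => by
      rw [commute_iff_eq]
      ext i j
      simp [Algebra.ofId_apply, Algebra.commutes]

theorem endMat_tmul {p x : M} (hx : x ∈ B.dom p) (T : Module.End ℂ (B.Fiber x))
    (w : ExteriorAlgebra ℂ (Cotangent E x)) (i j : Fin (B.rank p)) :
    endMat B hx (T ⊗ₜ[ℂ] w) i j = algebraMap ℂ _ (B.coframe p i x (T (B.frame p j x))) * w := by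
  rw [endMat, Algebra.TensorProduct.lift_tmul]
  simp [Algebra.ofId_apply, LinearMap.toMatrixAlgEquiv_apply, frameBasis_repr, frameBasis_apply]

theorem endMat_scalarForm {p x : M} (hx : x ∈ B.dom p)
    (w : ExteriorAlgebra ℂ (Cotangent E x)) :
    endMat B hx (scalarForm B w) = Matrix.scalar (Fin (B.rank p)) w := by
  rw [scalarForm, endMat, Algebra.TensorProduct.lift_tmul, map_one, one_mul]
  rfl

theorem trForm_eq_trace {p x : M} (hx : x ∈ B.dom p) (t : EndForm B x) :
    trForm B x t = (endMat B hx t).trace := by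
  induction t using TensorProduct.induction_on with
  | zero => simp
  | add s t hs ht => rw [map_add, map_add, hs, ht, Matrix.trace_add]
  | tmul T w =>
    have h : (endMat B hx (T ⊗ₜ[ℂ] w)).trace =
        algebraMap ℂ _ (∑ i, B.coframe p i x (T (B.frame p i x))) * w := by
      rw [map_sum, Finset.sum_mul]
      exact Finset.sum_congr rfl fun i _ => endMat_tmul B hx T w i i
    rw [h, trForm, LinearMap.comp_apply, LinearMap.rTensor_tmul, LinearEquiv.coe_coe,
      TensorProduct.lid_tmul, Algebra.smul_def,
      LinearMap.trace_eq_matrix_trace ℂ (frameBasis B hx)]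
    simp [Matrix.trace, LinearMap.toMatrix_apply, frameBasis_repr, frameBasis_apply]

variable [FiniteDimensional ℝ E] [IsManifold 𝓘(ℝ, E) ∞ M] {B}

theorem curvMatrix_apply {n : Type*} [Fintype n] [DecidableEq n] (A : Matrix n n (Form E M))
    (i j : n) (y : M) : curvMatrix A i j y = dForm (A i j) y + ∑ c, A i c y * A c j y :=
  congrArg (dForm (A i j) y + ·) (form_matrix_mul_apply A A i j y)

theorem endMat_pow {p x : M} (hx : x ∈ B.dom p) (t : EndForm B x) (k : ℕ) :
    endMat B hx (t ^ k) = endMat B hx t ^ k := by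
  induction k with
  | zero => rw [pow_zero, pow_zero]; exact (endMat B hx).map_one'
  | succ k ih => rw [pow_succ, pow_succ, ← ih]; exact map_mul _ _ _

/-- Only the frame centred at `x` is treated, since the curvature at `x` is defined through it;
other frames are reached by conjugation. -/
theorem endMat_curvature (nab : Connection B) {x : M} (hx : x ∈ B.dom x) :
    endMat B hx (nab.curvature x) =
      (curvMatrix (nab.matrix x : Matrix _ _ (Form E M))).map (evalForm E x) := by
  ext i j
  rw [Connection.curvature]
  simp only [map_sum, Matrix.sum_apply, endMat_tmul, LinearMap.smulRight_apply, map_smul,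
    B.coframe_frame x x hx, smul_eq_mul]
  rw [Finset.sum_eq_single i, Finset.sum_eq_single j]
  · simp only [if_true, mul_one, map_one, one_mul, Matrix.map_apply]
    exact (curvMatrix_apply (nab.matrix x) i j x).symm
  · intro b _ hb
    simp [hb]
  · simp
  · intro a _ ha
    simp [ha.symm]
  · simp

end EndMatrix

/-! ### The line bundles `L_αβ`, the maps `φ_αβ`, and invariance of Chern forms. -/

section Twisted

variable {E : Type uE} [NormedAddCommGroup E] [NormedSpace ℝ E] [FiniteDimensional ℝ E]
  {M : Type uM} [TopologicalSpace M] [ChartedSpace E M] [IsManifold 𝓘(ℝ, E) ∞ M] {ι : Type uI}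
  {G : GerbeDatum.{uE, uM, uV, uI} E M ι}

/-- The rank of a frame is constrained only through a point of its domain, hence the witness `x`. -/
theorem GerbeDatum.line_rank (G : GerbeDatum.{uE, uM, uV, uI} E M ι) {α β : ι} {p x : M}
    (hx : x ∈ (G.L α β).dom p) : (G.L α β).rank p = 1 := by
  rw [← G.line α β x ((G.L α β).dom_le p hx),
    Module.finrank_eq_card_basis (frameBasis (G.L α β) hx), Fintype.card_fin]

theorem GerbeDatum.line_subsingleton (G : GerbeDatum.{uE, uM, uV, uI} E M ι) {α β : ι} {p x : M}
    (hx : x ∈ (G.L α β).dom p) : Subsingleton (Fin ((G.L α β).rank p)) := by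
  rw [G.line_rank hx]
  infer_instance

/-- The index of the frame of a line bundle. -/
def GerbeDatum.lineIdx (G : GerbeDatum.{uE, uM, uV, uI} E M ι) {α β : ι} {p x : M}
    (hx : x ∈ (G.L α β).dom p) : Fin ((G.L α β).rank p) :=
  ⟨0, by rw [G.line_rank hx]; exact one_pos⟩

theorem GerbeDatum.line_expand (G : GerbeDatum.{uE, uM, uV, uI} E M ι) {α β : ι} {p x : M}
    (hx : x ∈ (G.L α β).dom p) (i : Fin ((G.L α β).rank p)) (v : (G.L α β).Fiber x) :
    (G.L α β).coframe p i x v • (G.L α β).frame p i x = v := by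
  have := G.line_subsingleton hx
  have h := (G.L α β).sum_coframe p x hx v
  rwa [Fintype.sum_subsingleton _ i] at h

theorem GerbeDatum.D_line_frame {α β : ι} (nab : Connection (G.L α β)) {p x : M}
    (hx : x ∈ (G.L α β).dom p) (i : Fin ((G.L α β).rank p)) (v : TangentSpace 𝓘(ℝ, E) x) :
    nab.D ((G.L α β).frame p i) x v = nab.coeff p i i x v • (G.L α β).frame p i x :=
  (G.line_expand hx i _).symm

/-- On a line bundle `A ∧ A = 0`, so the curvature is `dA`. At this stage the identity is known only
at the centre of the frame. -/
theorem GerbeConnection.dForm_coeff (nab : GerbeConnection G) {α β : ι} {x : M}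
    (hx : x ∈ (G.L α β).dom x) (i : Fin ((G.L α β).rank x)) :
    dForm (ofCovector ((nab.conn α β).coeff x i i)) x = nab.omega α x - nab.omega β x := by
  have h := congrArg (fun t => endMat (G.L α β) hx t i i)
    (nab.curvature_eq α β x ((G.L α β).dom_le x hx))
  have := G.line_subsingleton hx
  simp only [endMat_curvature, endMat_scalarForm, Matrix.scalar_apply, Matrix.diagonal_apply_eq,
    Matrix.map_apply] at h
  rw [← h]
  refine ((curvMatrix_apply ((nab.conn α β).matrix x) i i x).trans ?_).symm
  rw [Fintype.sum_subsingleton _ i, Connection.matrix_apply, ExteriorAlgebra.ι_sq_zero, add_zero]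
  rfl

variable {T : TwistedBundle G}

/-- The map `e ↦ φ_αβ(e ⊗ l)` given by a section `l` of `L_αβ`. -/
def TwistedBundle.trans (T : TwistedBundle G) {α β : ι} (l : ∀ y, (G.L α β).Fiber y) (y : M) :
    (T.bundle α).Fiber y →ₗ[ℂ] (T.bundle β).Fiber y :=
  T.phi α β y ∘ₗ (TensorProduct.mk ℂ _ _).flip (l y)

theorem TwistedBundle.trans_bijective (T : TwistedBundle G) {α β : ι} {p x : M}
    (hx : x ∈ (G.L α β).dom p) (i : Fin ((G.L α β).rank p)) :
    Function.Bijective (T.trans ((G.L α β).frame p i) x) := by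
  -- The frame spans the line, so `e ↦ e ⊗ l` is invertible; the coframe supplies the inverse.
  refine (T.phi_bijective α β x ((G.L α β).dom_le p hx)).comp
    (Function.bijective_iff_has_inverse.mpr
      ⟨(TensorProduct.rid ℂ _).toLinearMap ∘ₗ LinearMap.lTensor _ ((G.L α β).coframe p i x), fun e => ?_,
        fun t => ?_⟩)
  · simp [(G.L α β).coframe_frame p x hx]
  · induction t using TensorProduct.induction_on with
    | zero => simp
    | add s t hs ht => rw [map_add, map_add, hs, ht]
    | tmul e m =>
      simp only [LinearMap.comp_apply, LinearMap.lTensor_tmul, LinearEquiv.coe_coe,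
        TensorProduct.rid_tmul, LinearMap.flip_apply, TensorProduct.mk_apply]
      rw [TensorProduct.smul_tmul, G.line_expand hx]

/-- Compatibility with `φ_αβ`, tested on `s ⊗ l` for a frame `l` with `∇l = a l`. -/
theorem TwistedConnection.intertwines (nab : TwistedConnection T) {α β : ι} (p : M)
    (i : Fin ((G.L α β).rank p)) :
    Intertwines (nab.nab α) (nab.nab β) (T.trans ((G.L α β).frame p i))
      ((nab.conn α β).coeff p i i) ((G.L α β).dom p) where
  le' := ((G.L α β).dom_le p).trans inf_le_right
  smooth V hV s hs := T.phi_smooth α β V (hV.trans ((G.L α β).dom_le p)) s _ hs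
    ((sectionSmoothOn_frame p i).mono hV)
  D_eq V hV s hs y hy v := by
    have h := nab.compat_phi α β V (hV.trans ((G.L α β).dom_le p)) s _ hs
      ((sectionSmoothOn_frame p i).mono hV) y hy v
    refine h.trans ?_
    rw [GerbeDatum.D_line_frame _ (hV hy), TensorProduct.tmul_smul, map_add, map_smul]
    rfl

theorem GerbeConnection.omega_near (nab : GerbeConnection G) {α : ι} {x : M} (hx : x ∈ G.U α) :
    nab.omega α ∈ smoothNear E x :=
  (nab.omega_smooth α).eventually (G.U α).isOpen hx

theorem GerbeConnection.omega_even (nab : GerbeConnection G) {α : ι} {x : M} (hx : x ∈ G.U α) :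
    ∀ᶠ y in 𝓝 x, gradeInv _ (nab.omega α y) = nab.omega α y :=
  Filter.mem_of_superset ((G.U α).isOpen.mem_nhds hx) fun y hy => by
    have := gradeInv_of_mem (nab.omega_degree α y hy)
    rwa [even_two.neg_one_pow, one_mul] at this

/-- The matrix of `θ` in a local frame of `E_α`. -/
def TwistedConnection.thetaMat (nab : TwistedConnection T) (α : ι) (p : M) :
    Matrix (Fin ((T.bundle α).rank p)) (Fin ((T.bundle α).rank p)) (Form E M) :=
  thetaMatrix ((nab.nab α).matrix p) (nab.omega α)

/-- The constant `-1 / 2πi`. -/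
def chernConst : ℂ := -(2 * Real.pi * Complex.I : ℂ)⁻¹

theorem TwistedConnection.localChern_eq_self (nab : TwistedConnection T) {α : ι} {x : M}
    (hx : x ∈ G.U α) (k : ℕ) :
    nab.localChern α k x = chernTr chernConst (nab.thetaMat α x) k x := by
  have hxx := (T.bundle α).mem_dom x hx
  have h : endMat _ hxx (nab.theta α x) = (nab.thetaMat α x).map (evalForm E x) := by
    rw [TwistedConnection.theta, map_add, endMat_curvature, endMat_scalarForm]
    have h1 := scalar_map_eval (n := Fin ((T.bundle α).rank x)) (evalForm E x) (nab.omega α)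
    refine (congrArg _ h1.symm).trans ?_
    exact (Matrix.map_add _ (map_add _) _ _).symm
  have h2 : endMat _ hxx (-(2 * Real.pi * Complex.I : ℂ)⁻¹ • nab.theta α x) =
      chernConst • (nab.thetaMat α x).map (evalForm E x) := by
    rw [← h]
    exact map_smul _ _ _
  rw [TwistedConnection.localChern, trForm_eq_trace _ hxx, endMat_pow, h2, chernTr_apply, chernTr,
    _root_.smul_pow, Matrix.trace_smul, smul_smul]

theorem TwistedConnection.thetaMat_conj (nab : TwistedConnection T) {α β : ι} {x p p' : M}
    (hx : x ∈ (G.L α β).dom x) (i : Fin ((G.L α β).rank x))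
    (hp : x ∈ (T.bundle α).dom p) (hp' : x ∈ (T.bundle β).dom p') :
    (nab.thetaMat β p').map (evalForm E x) *
        ((transMatrix (T.trans ((G.L α β).frame x i)) p' p).map fun f => f x).map
          (algebraMap ℂ (ExteriorAlgebra ℂ (Cotangent E x))) =
      ((transMatrix (T.trans ((G.L α β).frame x i)) p' p).map fun f => f x).map
          (algebraMap ℂ (ExteriorAlgebra ℂ (Cotangent E x))) *
        (nab.thetaMat α p).map (evalForm E x) :=
  (nab.intertwines x i).theta ⟨⟨hx, hp⟩, hp'⟩ ((nab.conn α β).matrix_smoothNear hx i i)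
    (by rw [nab.dForm_coeff hx i, add_sub_cancel])

/-- The Chern forms do not depend on the local trivializations. -/
theorem TwistedConnection.chernTr_thetaMat (nab : TwistedConnection T) {α β : ι} {x p p' : M}
    (hp : x ∈ (T.bundle α).dom p) (hp' : x ∈ (T.bundle β).dom p') (c : ℂ) (k : ℕ) :
    chernTr c (nab.thetaMat β p') k x = chernTr c (nab.thetaMat α p) k x := by
  have hx : x ∈ (G.L α β).dom x :=
    (G.L α β).mem_dom x ⟨(T.bundle α).dom_le p hp, (T.bundle β).dom_le p' hp'⟩
  obtain ⟨h, hgh, hhg⟩ := transMatrix_inverse hp hp' (T.trans_bijective hx (G.lineIdx hx))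
  rw [chernTr_apply, chernTr_apply]
  exact chernTr_conj c hgh hhg (nab.thetaMat_conj hx (G.lineIdx hx) hp hp') k

theorem TwistedConnection.localChern_eq (nab : TwistedConnection T) {α β : ι} {x p : M}
    (hx : x ∈ G.U α) (hp : x ∈ (T.bundle β).dom p) (k : ℕ) :
    nab.localChern α k x = chernTr chernConst (nab.thetaMat β p) k x := by
  rw [nab.localChern_eq_self hx, nab.chernTr_thetaMat hp ((T.bundle α).mem_dom x hx)]

end Twisted

/-! ### Degrees of products and powers of matrices. -/

section GradedMatrices

variable {R : Type*} [Ring R] [Algebra ℂ R] {S : ℕ → Submodule ℂ R}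
  {n : Type*} [Fintype n] [DecidableEq n]

theorem matrix_mul_mem (hmul : ∀ {j k : ℕ} {a b : R}, a ∈ S j → b ∈ S k → a * b ∈ S (j + k))
    {A B : Matrix n n R} {j k : ℕ} (hA : ∀ a b, A a b ∈ S j) (hB : ∀ a b, B a b ∈ S k) (a b : n) :
    (A * B) a b ∈ S (j + k) := by
  rw [Matrix.mul_apply]
  exact sum_mem fun c _ => hmul (hA a c) (hB c b)

theorem matrix_pow_mem (h1 : (1 : R) ∈ S 0)
    (hmul : ∀ {j k : ℕ} {a b : R}, a ∈ S j → b ∈ S k → a * b ∈ S (j + k))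
    {A : Matrix n n R} {j : ℕ} (hA : ∀ a b, A a b ∈ S j) (k : ℕ) (a b : n) :
    (A ^ k) a b ∈ S (j * k) := by
  induction k generalizing a b with
  | zero =>
    rw [pow_zero, mul_zero, Matrix.one_apply]
    split_ifs
    · exact h1
    · exact zero_mem _
  | succ k ih =>
    rw [pow_succ, mul_add_one]
    exact matrix_mul_mem hmul ih hA a b

end GradedMatrices

/-! ### The curvature 3-form and closedness of the Chern character. -/

section Chern

theorem one_mem_exteriorPower {V : Type*} [AddCommGroup V] [Module ℂ V] :
    (1 : ExteriorAlgebra ℂ V) ∈ ⋀[ℂ]^0 V := by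
  rw [ExteriorAlgebra.exteriorPower, pow_zero]
  exact Submodule.one_le.mp le_rfl

theorem chernTr_mem_exteriorPower {V : Type*} [AddCommGroup V] [Module ℂ V] {n : Type*} [Fintype n]
    [DecidableEq n] {T : Matrix n n (ExteriorAlgebra ℂ V)} (hT : ∀ i j, T i j ∈ ⋀[ℂ]^2 V) (c : ℂ)
    (k : ℕ) : chernTr c T k ∈ ⋀[ℂ]^(2 * k) V :=
  Submodule.smul_mem _ _ (sum_mem fun i _ =>
    matrix_pow_mem (S := fun k => ⋀[ℂ]^k V) one_mem_exteriorPower mul_mem_exteriorPower hT k i i)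

variable {E : Type uE} [NormedAddCommGroup E] [NormedSpace ℝ E] [FiniteDimensional ℝ E]
  {M : Type uM} [TopologicalSpace M] [ChartedSpace E M] [IsManifold 𝓘(ℝ, E) ∞ M]

theorem thetaMatrix_mem {n : Type*} [Fintype n] [DecidableEq n] {A : Matrix n n (Form E M)}
    {w : Form E M} {x : M} (hA : MSmoothNear x A) (hA1 : MOneNear x A)
    (hw : w x ∈ ⋀[ℂ]^2 (Cotangent E x)) (i j : n) :
    (thetaMatrix A w).map (evalForm E x) i j ∈ ⋀[ℂ]^2 (Cotangent E x) := by
  have h : (thetaMatrix A w).map (evalForm E x) i j =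
      (dForm (A i j) x + ∑ c, A i c x * A c j x) + Matrix.scalar n (w x) i j := by
    rw [thetaMatrix, Matrix.map_add _ (map_add _), Matrix.add_apply, scalar_map_eval]
    exact congrArg (· + _) (curvMatrix_apply A i j x)
  rw [h]
  refine add_mem (add_mem (dForm_mem (hA i j).self_of_nhds (hA1 i j))
    (sum_mem fun c _ => mul_mem_exteriorPower (hA1 i c).self_of_nhds (hA1 c j).self_of_nhds)) ?_
  rw [Matrix.scalar_apply, Matrix.diagonal_apply]
  split_ifs
  · exact hw
  · exact zero_mem _

variable {ι : Type uI} {G : GerbeDatum.{uE, uM, uV, uI} E M ι} {T : TwistedBundle G}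

/-- The curvature of a line bundle is rewritten as a Chern trace, so that frame independence can be
borrowed from `chernTr_conj`. -/
theorem GerbeConnection.chernTr_line (nab : GerbeConnection G) {α β : ι} {p x : M}
    (hx : x ∈ (G.L α β).dom p) (i : Fin ((G.L α β).rank p)) :
    chernTr 1 (thetaMatrix ((nab.conn α β).matrix p) 0) 1 x =
      dForm (ofCovector ((nab.conn α β).coeff p i i)) x := by
  have := G.line_subsingleton hx
  rw [chernTr, pow_one, Matrix.trace, Fintype.sum_subsingleton _ i,
    Nat.factorial_one, Nat.cast_one, inv_one, one_mul, one_smul, pow_one, Matrix.diag_apply]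
  have h0 : thetaMatrix ((nab.conn α β).matrix p) (0 : Form E M) =
      curvMatrix ((nab.conn α β).matrix p) :=
    (congrArg (curvMatrix ((nab.conn α β).matrix p) + ·) (map_zero (Matrix.scalar _))).trans
      (add_zero _)
  rw [h0]
  refine (curvMatrix_apply ((nab.conn α β).matrix p) i i x).trans ?_
  rw [Fintype.sum_subsingleton _ i, Connection.matrix_apply, ExteriorAlgebra.ι_sq_zero, add_zero]
  rfl

/-- The differential of the connection form of `L_αβ` in any local frame. -/
theorem GerbeConnection.dForm_coeff_frame (nab : GerbeConnection G) {α β : ι} {p x : M}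
    (hx : x ∈ (G.L α β).dom p) (i : Fin ((G.L α β).rank p)) :
    dForm (ofCovector ((nab.conn α β).coeff p i i)) x = nab.omega α x - nab.omega β x := by
  have hU := (G.L α β).dom_le p hx
  have hxx := (G.L α β).mem_dom x hU
  rw [← nab.dForm_coeff hxx (G.lineIdx hxx), ← nab.chernTr_line hx, ← nab.chernTr_line hxx,
    chernTr_apply, chernTr_apply]
  have hid := intertwines_id (nab.conn α β)
  obtain ⟨h, hgh, hhg⟩ := transMatrix_inverse (ψ := fun _ => LinearMap.id) hxx hx
    Function.bijective_id
  have hz : ofCovector (E := E) (M := M) (fun _ => 0) = 0 := funext fun y => map_zero _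
  refine chernTr_conj 1 hgh hhg (hid.theta ⟨⟨hU, hxx⟩, hx⟩ ?_ ?_) 1
  · rw [hz]
    exact zero_mem _
  · rw [hz, dForm_zero]
    exact (add_zero _).symm

/-- Near `x` one has `ω_α = ω_β + da` with `a` the connection form in a single fixed frame; hence
the need for `GerbeConnection.dForm_coeff_frame`. Then `d² a = 0`. -/
theorem GerbeConnection.dForm_omega (nab : GerbeConnection G) {α β : ι} {x : M}
    (hx : x ∈ G.U α ⊓ G.U β) : dForm (nab.omega α) x = dForm (nab.omega β) x := by
  have hxx := (G.L α β).mem_dom x hx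
  have hs : ofCovector ((nab.conn α β).coeff x (G.lineIdx hxx) (G.lineIdx hxx)) ∈ smoothNear E x :=
    (nab.conn α β).matrix_smoothNear hxx (G.lineIdx hxx) (G.lineIdx hxx)
  have h : dForm (nab.omega α) x =
      dForm (nab.omega β + dForm (ofCovector ((nab.conn α β).coeff x (G.lineIdx hxx)
        (G.lineIdx hxx)))) x :=
    dForm_congr (Filter.mem_of_superset (((G.L α β).dom x).isOpen.mem_nhds hxx) fun y hy => by
      rw [Set.mem_ofPred_eq, Form.add_apply, nab.dForm_coeff_frame hy, add_sub_cancel])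
  have h0 := dForm_dForm hs
  rw [h, dForm_add (nab.omega_smooth β x hx.2) (FormSmoothAt.dForm hs)]
  exact (congrArg _ h0).trans (add_zero _)

theorem GerbeConnection.curv3_eq (nab : GerbeConnection G) {α : ι} {x : M} (hx : x ∈ G.U α) :
    nab.curv3 x = nab.localCurv3 α x := by
  have h := nab.dForm_omega (α := G.idx x) (β := α) ⟨(G.cover x).choose_spec, hx⟩
  rw [curv3, localCurv3, localCurv3, Form.smul_apply, Form.smul_apply, h]

theorem GerbeConnection.curv3_near (nab : GerbeConnection G) {α : ι} {x : M} (hx : x ∈ G.U α) :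
    ∀ᶠ y in 𝓝 x, nab.localCurv3 α y = nab.curv3 y :=
  Filter.mem_of_superset ((G.U α).isOpen.mem_nhds hx) fun _ hy => (nab.curv3_eq hy).symm

theorem GerbeConnection.curv3_smooth (nab : GerbeConnection G) :
    FormSmoothOn nab.curv3 Set.univ := fun x _ => by
  obtain ⟨α, hα⟩ := G.cover x
  exact FormSmoothAt.congr ((FormSmoothAt.dForm (nab.omega_near hα)).smul _) (nab.curv3_near hα)

theorem GerbeConnection.curv3_degree (nab : GerbeConnection G) :
    IsHomogeneousOn 3 nab.curv3 Set.univ := fun x _ => by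
  obtain ⟨α, hα⟩ := G.cover x
  rw [nab.curv3_eq hα]
  exact Submodule.smul_mem _ _ (dForm_mem (nab.omega_smooth α x hα)
    (Filter.mem_of_superset ((G.U α).isOpen.mem_nhds hα) fun y hy => nab.omega_degree α y hy))

theorem GerbeConnection.dForm_curv3 (nab : GerbeConnection G) : dForm nab.curv3 = 0 := by
  funext x
  obtain ⟨α, hα⟩ := G.cover x
  have h := nab.omega_near hα
  rw [← dForm_congr (nab.curv3_near hα), localCurv3, dForm_smul _ (FormSmoothAt.dForm h)]
  exact (congrArg _ (dForm_dForm h)).trans (smul_zero _)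

namespace TwistedConnection

variable (nab : TwistedConnection T)

theorem thetaMat_near {α : ι} {p x : M} (hp : x ∈ (T.bundle α).dom p) :
    MSmoothNear x (nab.thetaMat α p) :=
  ((nab.nab α).matrix_smoothNear hp).theta (nab.omega_near ((T.bundle α).dom_le p hp))

theorem chernTr_thetaMat_mem {α : ι} {p x : M} (hp : x ∈ (T.bundle α).dom p) (c : ℂ) (k : ℕ) :
    chernTr c (nab.thetaMat α p) k x ∈ ⋀[ℂ]^(2 * k) (Cotangent E x) := by
  rw [chernTr_apply]
  exact chernTr_mem_exteriorPower (thetaMatrix_mem ((nab.nab α).matrix_smoothNear hp)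
    ((nab.nab α).matrix_oneNear p x) (nab.omega_degree α x ((T.bundle α).dom_le p hp))) c k

/-- The coefficients of the Chern character in local frames. -/
theorem coeff_chern {α : ι} {p x : M} (hp : x ∈ (T.bundle α).dom p) (k : ℕ) :
    nab.chern.coeff k x = chernTr chernConst (nab.thetaMat α p) k x := by
  have h : nab.chern.coeff k =
      if k < Module.finrank ℝ E + 1 then (fun x => nab.localChern (G.idx x) k x) else 0 := by
    rw [chern, Polynomial.finsetSum_coeff]
    refine (Finset.sum_congr rfl fun j _ => Polynomial.coeff_monomial).trans
      ((Finset.sum_ite_eq' _ k _).trans ?_)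
    exact if_congr Finset.mem_range rfl rfl
  rw [h]
  split_ifs with hk
  · exact nab.localChern_eq (G.cover x).choose_spec hp k
  -- Beyond the cut-off the local Chern form has degree `2k > dim M` and vanishes.
  · exact (form_eq_zero_of_mem (by lia) (nab.chernTr_thetaMat_mem hp chernConst k)).symm

theorem coeff_chern_eq_localChern {α : ι} {x : M} (hx : x ∈ G.U α) (k : ℕ) :
    nab.chern.coeff k x = nab.localChern α k x := by
  rw [nab.localChern_eq_self hx, nab.coeff_chern ((T.bundle α).mem_dom x hx)]

theorem coeff_chern_near {α : ι} {p x : M} (hp : x ∈ (T.bundle α).dom p) (k : ℕ) :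
    ∀ᶠ y in 𝓝 x, chernTr chernConst (nab.thetaMat α p) k y = nab.chern.coeff k y :=
  Filter.mem_of_superset (((T.bundle α).dom p).isOpen.mem_nhds hp) fun _ hy =>
    (nab.coeff_chern hy k).symm

theorem chern_smooth : nab.chern ∈ smoothPoly E M := fun k x _ => by
  obtain ⟨α, hα⟩ := G.cover x
  have hp := (T.bundle α).mem_dom x hα
  exact FormSmoothAt.congr (chernTr_mem_smoothNear (nab.thetaMat_near hp) chernConst k).self_of_nhds
    (nab.coeff_chern_near hp k)

end TwistedConnection

theorem coeff_dTwist_zero (Om : Form E M) (ξ : (Form E M)[X]) : (dTwist Om ξ).coeff 0 = 0 := by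
  rw [dTwist, coeff_add, coeff_X_mul_zero, pow_succ', mul_assoc, coeff_X_mul_zero, add_zero]

theorem coeff_dTwist_one (Om : Form E M) (ξ : (Form E M)[X]) :
    (dTwist Om ξ).coeff 1 = dForm (ξ.coeff 0) := by
  rw [dTwist, coeff_add, coeff_X_mul, pow_succ', mul_assoc, coeff_X_mul, pow_one,
    coeff_X_mul_zero, add_zero, coeff_dPoly]

theorem coeff_dTwist_add_two (Om : Form E M) (ξ : (Form E M)[X]) (k : ℕ) :
    (dTwist Om ξ).coeff (k + 2) = dForm (ξ.coeff (k + 1)) + Om * ξ.coeff k := by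
  rw [dTwist, coeff_add, coeff_X_mul, pow_succ', mul_assoc, coeff_X_mul, pow_one, coeff_X_mul,
    coeff_C_mul, coeff_dPoly]

/-- In the coefficient of `u^(k+2)`, `d ch_(k+1)` contributes `-1/2πi` times `dω_α ch_k` and `Ω
ch_k` contributes the opposite. The coefficients of `1` and `u` need separate treatment, as no twist
reaches them. -/
theorem TwistedConnection.dTwist_chern (nab : TwistedConnection T) :
    dTwist nab.curv3 nab.chern = 0 := by
  ext k : 1
  funext x
  obtain ⟨α, hα⟩ := G.cover x
  have hp := (T.bundle α).mem_dom x hα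
  have hA := (nab.nab α).matrix_smoothNear hp
  match k with
  | 0 => rw [coeff_dTwist_zero, coeff_zero]
  | 1 =>
    rw [coeff_dTwist_one, ← dForm_congr (nab.coeff_chern_near hp 0),
      dForm_chernTr_zero (nab.thetaMat_near hp), coeff_zero, Form.zero_apply]
  | k + 2 =>
    have h := dForm_chernTr_succ hA ((nab.nab α).matrix_oneNear x x) (nab.omega_near hα)
      (nab.omega_even hα) chernConst k
    rw [coeff_dTwist_add_two, Form.add_apply, Form.mul_apply,
      ← dForm_congr (nab.coeff_chern_near hp (k + 1)), nab.coeff_chern hp, nab.curv3_eq hα,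
      GerbeConnection.localCurv3, Form.smul_apply, coeff_zero, Form.zero_apply,
      TwistedConnection.thetaMat, h, chernConst, smul_mul_assoc, ← add_smul, neg_add_cancel,
      zero_smul]

end Chern

/-! ### Comparison forms: existence, gluing and uniqueness up to exact forms. -/

section Comparison

variable {E : Type uE} [NormedAddCommGroup E] [NormedSpace ℝ E] [FiniteDimensional ℝ E]
  {M : Type uM} [TopologicalSpace M] [ChartedSpace E M] [IsManifold 𝓘(ℝ, E) ∞ M]
  {ι : Type uI} {G : GerbeDatum.{uE, uM, uV, uI} E M ι}

theorem FormSmoothAt.sub {w w' : Form E M} {p : M} (h : FormSmoothAt w p)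
    (h' : FormSmoothAt w' p) : FormSmoothAt (w - w') p := by
  rw [sub_eq_add_neg, ← neg_one_smul ℂ w']
  exact h.add (h'.smul _)

theorem dForm_sub {w w' : Form E M} {p : M} (h : FormSmoothAt w p)
    (h' : FormSmoothAt w' p) : dForm (w - w') p = dForm w p - dForm w' p := by
  rw [sub_eq_add_neg, ← neg_one_smul ℂ w', dForm_add h (h'.smul _), dForm_smul _ h',
    neg_one_smul, sub_eq_add_neg]

theorem ofCovector_sub (a b : ∀ x : M, Cotangent E x) :
    ofCovector (fun x => a x - b x) = ofCovector a - ofCovector b :=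
  funext fun _ => map_sub _ _ _

theorem ofCovector_smul (c : ℂ) (a : ∀ x : M, Cotangent E x) :
    ofCovector (fun x => c • a x) = c • ofCovector a :=
  funext fun _ => map_smul _ _ _

/-! ### The difference of two connections on a line bundle -/

/-- The 1-form `∇'_αβ - ∇_αβ`. -/
def connDiff (nab nab' : GerbeConnection G) (α β : ι) (x : M) : Cotangent E x :=
  ∑ i, ((nab'.conn α β).coeff x i i x - (nab.conn α β).coeff x i i x)

theorem D_line {α β : ι} (nab : Connection (G.L α β)) {V : Opens M} (hV : V ≤ G.U α ⊓ G.U β)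
    {s : ∀ x, (G.L α β).Fiber x} (hs : SectionSmoothOn (G.L α β) s V) {p x : M} (hx : x ∈ V)
    (hp : x ∈ (G.L α β).dom p) (i : Fin ((G.L α β).rank p)) (v : TangentSpace 𝓘(ℝ, E) x) :
    nab.D s x v = nab.coeff p i i x v • s x +
      dFun (fun y => (G.L α β).coframe p i y (s y)) x v • (G.L α β).frame p i x := by
  set W : Opens M := V ⊓ (G.L α β).dom p
  have hW : x ∈ W := ⟨hx, hp⟩
  have hWU : W ≤ G.U α ⊓ G.U β := inf_le_left.trans hV
  have h1 := nab.D_congr hWU (t := fun y => (G.L α β).coframe p i y (s y) • (G.L α β).frame p i y)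
    (hs.mono fun _ hy => hy.1) (fun y hy => (G.line_expand hy.2 i (s y)).symm) hW
  rw [h1, nab.leibniz W hWU _ _
    (fun y hy => (SectionSmoothOn.coframe hs hy.1 hy.2 i).contMDiffWithinAt)
    ((sectionSmoothOn_frame p i).mono fun _ hy => hy.2) x hW v, GerbeDatum.D_line_frame nab hp,
    smul_comm, G.line_expand hp]

/-- In a local frame the derivative of the component function is common to both connections, so only
the connection forms contribute to the difference. -/
theorem D_eq_add_connDiff (nab nab' : GerbeConnection G) {α β : ι} {V : Opens M}
    (hV : V ≤ G.U α ⊓ G.U β) {s : ∀ x, (G.L α β).Fiber x} (hs : SectionSmoothOn (G.L α β) s V)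
    {x : M} (hx : x ∈ V) (v : TangentSpace 𝓘(ℝ, E) x) :
    (nab'.conn α β).D s x v = (nab.conn α β).D s x v + connDiff nab nab' α β x v • s x := by
  have hp := (G.L α β).mem_dom x (hV hx)
  have := G.line_subsingleton hp
  rw [D_line _ hV hs hx hp (G.lineIdx hp), D_line _ hV hs hx hp (G.lineIdx hp), connDiff,
    Fintype.sum_subsingleton _ (G.lineIdx hp), LinearMap.sub_apply, sub_smul]
  abel

theorem coeff_eq_of_D_eq {nab nab' : GerbeConnection G} {α β : ι} {p x : M}
    (hx : x ∈ (G.L α β).dom p) (i : Fin ((G.L α β).rank p)) {a : Cotangent E x}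
    (h : ∀ v : TangentSpace 𝓘(ℝ, E) x, (nab'.conn α β).D ((G.L α β).frame p i) x v =
      (nab.conn α β).D ((G.L α β).frame p i) x v + a v • (G.L α β).frame p i x) :
    (nab'.conn α β).coeff p i i x = (nab.conn α β).coeff p i i x + a := by
  ext v
  have := congrArg ((G.L α β).coframe p i x) (h v)
  rw [map_add, map_smul, (G.L α β).coframe_frame p x hx, if_pos rfl, smul_eq_mul, mul_one] at this
  exact this

theorem coeff_eq_add_connDiff (nab nab' : GerbeConnection G) {α β : ι} {p x : M}
    (hx : x ∈ (G.L α β).dom p) (i : Fin ((G.L α β).rank p)) :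
    (nab'.conn α β).coeff p i i x =
      (nab.conn α β).coeff p i i x + connDiff nab nab' α β x :=
  coeff_eq_of_D_eq hx i fun v =>
    D_eq_add_connDiff nab nab' ((G.L α β).dom_le p) (sectionSmoothOn_frame p i) hx v

theorem connDiff_smooth (nab nab' : GerbeConnection G) {α β : ι} {x : M}
    (hx : x ∈ G.U α ⊓ G.U β) : FormSmoothAt (ofCovector (connDiff nab nab' α β)) x := by
  have hp := (G.L α β).mem_dom x hx
  set i := G.lineIdx hp
  have h1 : FormSmoothAt (ofCovector ((nab.conn α β).coeff x i i)) x :=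
    ((nab.conn α β).matrix_smoothNear hp i i).self_of_nhds
  have h2 : FormSmoothAt (ofCovector ((nab'.conn α β).coeff x i i)) x :=
    ((nab'.conn α β).matrix_smoothNear hp i i).self_of_nhds
  refine (h2.sub h1).congr (Filter.mem_of_superset (((G.L α β).dom x).isOpen.mem_nhds hp)
    fun y hy => ?_)
  rw [Set.mem_ofPred_eq, ← ofCovector_sub, ofCovector, ofCovector,
    coeff_eq_add_connDiff nab nab' hy i, add_sub_cancel_left]

/-- Subtract the two compatibilities with `μ` on a product of frames; the resulting scalar identity
can be read off because that product does not vanish. -/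
theorem connDiff_cocycle (nab nab' : GerbeConnection G) {α β γ : ι} {x : M}
    (hx : x ∈ G.U α ⊓ G.U β ⊓ G.U γ) :
    connDiff nab nab' α γ x = connDiff nab nab' α β x + connDiff nab nab' β γ x := by
  have hp := (G.L α β).mem_dom x hx.1
  have hq := (G.L β γ).mem_dom x ⟨hx.1.2, hx.2⟩
  set s := (G.L α β).frame x (G.lineIdx hp) with hs
  set t := (G.L β γ).frame x (G.lineIdx hq) with ht
  set V : Opens M := G.U α ⊓ G.U β ⊓ G.U γ ⊓ ((G.L α β).dom x ⊓ (G.L β γ).dom x)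
  have hV : V ≤ G.U α ⊓ G.U β ⊓ G.U γ := inf_le_left
  have hxV : x ∈ V := ⟨hx, hp, hq⟩
  have hsV : SectionSmoothOn (G.L α β) s V := (sectionSmoothOn_frame x _).mono fun _ hy => hy.2.1
  have htV : SectionSmoothOn (G.L β γ) t V := (sectionSmoothOn_frame x _).mono fun _ hy => hy.2.2
  have hm := G.mu_smooth α β γ V hV s t hsV htV
  have hne : G.mu α β γ x (s x ⊗ₜ[ℂ] t x) ≠ 0 := fun h0 => by
    have h1 : s x ⊗ₜ[ℂ] t x = 0 := (G.mu_bijective α β γ x hx).1 (h0.trans (map_zero _).symm)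
    have h2 := congrArg (TensorProduct.lid ℂ ℂ ∘ TensorProduct.map
      ((G.L α β).coframe x (G.lineIdx hp) x) ((G.L β γ).coframe x (G.lineIdx hq) x)) h1
    simp [hs, ht, (G.L α β).coframe_frame x x hp, (G.L β γ).coframe_frame x x hq] at h2
  ext v
  have h1 := nab.compat α β γ V hV s t hsV htV x hxV v
  have h2 := nab'.compat α β γ V hV s t hsV htV x hxV v
  rw [D_eq_add_connDiff nab nab' (fun y hy => ⟨(hV hy).1.1, (hV hy).2⟩) hm hxV,
    D_eq_add_connDiff nab nab' (fun y hy => (hV hy).1) hsV hxV,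
    D_eq_add_connDiff nab nab' (fun y hy => ⟨(hV hy).1.2, (hV hy).2⟩) htV hxV, h1] at h2
  simp only [TensorProduct.add_tmul, TensorProduct.tmul_add, TensorProduct.tmul_smul,
    ← TensorProduct.smul_tmul', map_add, map_smul] at h2
  have h3 : (connDiff nab nab' α γ x v - (connDiff nab nab' α β x v + connDiff nab nab' β γ x v)) •
      G.mu α β γ x (s x ⊗ₜ[ℂ] t x) = 0 := by
    rw [sub_smul, add_smul, sub_eq_zero]
    have h4 := h2
    rw [add_add_add_comm] at h4
    exact add_left_cancel h4
  exact sub_eq_zero.mp ((smul_eq_zero.mp h3).resolve_right hne)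

/-- `δ` is a family of smooth 1-forms with `∇'_αβ - ∇_αβ = δ_α - δ_β`. -/
def IsConnDiff (nab nab' : GerbeConnection G) (δ : ι → ∀ x : M, Cotangent E x) : Prop :=
  (∀ α, FormSmoothOn (ofCovector (δ α)) (G.U α)) ∧
    (∀ α β, ∀ V : Opens M, V ≤ G.U α ⊓ G.U β → ∀ s, SectionSmoothOn (G.L α β) s V →
      ∀ x ∈ V, ∀ v : TangentSpace 𝓘(ℝ, E) x,
        (nab'.conn α β).D s x v = (nab.conn α β).D s x v + (δ α x v - δ β x v) • s x)

theorem IsConnDiff.coeff_eq {nab nab' : GerbeConnection G} {δ : ι → ∀ x : M, Cotangent E x}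
    (h : IsConnDiff nab nab' δ) {α β : ι} {p x : M} (hx : x ∈ (G.L α β).dom p)
    (i : Fin ((G.L α β).rank p)) :
    (nab'.conn α β).coeff p i i x = (nab.conn α β).coeff p i i x + (δ α x - δ β x) :=
  coeff_eq_of_D_eq hx i fun v =>
    h.2 α β _ ((G.L α β).dom_le p) _ (sectionSmoothOn_frame p i) x hx v

theorem IsConnDiff.sub_eq {nab nab' : GerbeConnection G} {δ : ι → ∀ x : M, Cotangent E x}
    (h : IsConnDiff nab nab' δ) {α β : ι} {x : M} (hx : x ∈ G.U α ⊓ G.U β) :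
    δ α x - δ β x = connDiff nab nab' α β x := by
  have hp := (G.L α β).mem_dom x hx
  exact add_left_cancel ((h.coeff_eq hp (G.lineIdx hp)).symm.trans
    (coeff_eq_add_connDiff nab nab' hp (G.lineIdx hp)))

theorem dForm_connDiff (nab nab' : GerbeConnection G) {α β : ι} {x : M}
    (hx : x ∈ G.U α ⊓ G.U β) : dForm (ofCovector (connDiff nab nab' α β)) x =
      (nab'.omega α x - nab'.omega β x) - (nab.omega α x - nab.omega β x) := by
  have hp := (G.L α β).mem_dom x hx
  set i := G.lineIdx hp
  have h1 : FormSmoothAt (ofCovector ((nab.conn α β).coeff x i i)) x :=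
    ((nab.conn α β).matrix_smoothNear hp i i).self_of_nhds
  have h2 : FormSmoothAt (ofCovector ((nab'.conn α β).coeff x i i)) x :=
    ((nab'.conn α β).matrix_smoothNear hp i i).self_of_nhds
  rw [← nab.dForm_coeff hp i, ← nab'.dForm_coeff hp i, ← dForm_sub h2 h1]
  refine dForm_congr (Filter.mem_of_superset (((G.L α β).dom x).isOpen.mem_nhds hp)
    fun y hy => ?_)
  rw [Set.mem_ofPred_eq, ← ofCovector_sub, ofCovector, ofCovector,
    coeff_eq_add_connDiff nab nab' hy i, add_sub_cancel_left]

theorem IsConnDiff.near {nab nab' : GerbeConnection G} {δ : ι → ∀ x : M, Cotangent E x}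
    (h : IsConnDiff nab nab' δ) {α : ι} {x : M} (hx : x ∈ G.U α) :
    ofCovector (δ α) ∈ smoothNear E x :=
  (h.1 α).eventually (G.U α).isOpen hx

/-- The forms `ω'_α - ω_α - dδ_α` agree on overlaps. -/
theorem IsConnDiff.omega_sub_eq {nab nab' : GerbeConnection G} {δ : ι → ∀ x : M, Cotangent E x}
    (h : IsConnDiff nab nab' δ) {α β : ι} {x : M} (hx : x ∈ G.U α ⊓ G.U β) :
    nab'.omega α x - nab.omega α x - dForm (ofCovector (δ α)) x =
      nab'.omega β x - nab.omega β x - dForm (ofCovector (δ β)) x := by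
  have h1 : dForm (ofCovector (δ α) - ofCovector (δ β)) x = _ :=
    (dForm_congr (Filter.mem_of_superset ((G.U α ⊓ G.U β).isOpen.mem_nhds hx) fun y hy => by
      rw [Set.mem_ofPred_eq, ← ofCovector_sub, ofCovector, ofCovector, h.sub_eq hy])).trans
      (dForm_connDiff nab nab' hx)
  rw [dForm_sub (h.1 α x hx.1) (h.1 β x hx.2)] at h1
  rw [sub_eq_iff_eq_add.mp h1]
  abel

/-- The standard vanishing argument for cocycles in a fine sheaf: `δ_α` is the sum over `γ` of `ρ_γ
(∇'_αγ - ∇_αγ)`, and the cocycle identity together with `∑ ρ_γ = 1` gives the difference. -/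
theorem exists_isConnDiff [T2Space M] [SecondCountableTopology M] (nab nab' : GerbeConnection G) :
    ∃ δ, IsConnDiff nab nab' δ := by
  have : LocallyCompactSpace M := ChartedSpace.locallyCompactSpace E M
  obtain ⟨ρ, hρ⟩ := SmoothPartitionOfUnity.exists_isSubordinate 𝓘(ℝ, E) isClosed_univ
    (fun α => (G.U α : Set M)) (fun α => (G.U α).isOpen) fun x _ => Set.mem_iUnion.mpr (G.cover x)
  have hmem : ∀ x γ, ρ γ x ≠ 0 → x ∈ G.U γ := fun x γ h => hρ γ (subset_tsupport _ h)
  have hsub : ∀ x α β, x ∈ G.U α ⊓ G.U β →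
      (∑ γ ∈ ρ.finsupport x, (ρ γ x : ℂ) • connDiff nab nab' α γ x) -
        (∑ γ ∈ ρ.finsupport x, (ρ γ x : ℂ) • connDiff nab nab' β γ x) =
          connDiff nab nab' α β x := fun x α β hx => by
    have h1 : (∑ γ ∈ ρ.finsupport x, (ρ γ x : ℂ)) = 1 := by
      rw [← Complex.ofReal_sum, ρ.sum_finsupport x (Set.mem_univ x), Complex.ofReal_one]
    rw [← Finset.sum_sub_distrib, ← one_smul ℂ (connDiff nab nab' α β x), ← h1, Finset.sum_smul]
    refine Finset.sum_congr rfl fun γ hγ => ?_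
    rw [← smul_sub, connDiff_cocycle nab nab' ⟨hx, hmem x γ ((ρ.mem_finsupport x).mp hγ)⟩,
      add_sub_cancel_right]
  refine ⟨fun α x => ∑ γ ∈ ρ.finsupport x, (ρ γ x : ℂ) • connDiff nab nab' α γ x, ?_, ?_⟩
  · intro α x hx
    have hf : ∀ γ, FormSmoothAt (ofFun fun y => ((ρ γ y : ℝ) : ℂ) : Form E M) x := fun γ =>
      formSmoothAt_ofFun (Complex.ofRealCLM.contDiff.contDiffAt.comp_contMDiffAt
        ((ρ γ).contMDiff x))
    -- The index set `finsupport y` varies with `y`. Near `x` it lies in the fixed finite set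
    -- `fintsupport x`, all of whose members have `x` in `U_γ`, and the extra terms vanish.
    have h : FormSmoothAt (∑ γ : ρ.fintsupport x, ofFun (fun y => ((ρ γ.1 y : ℝ) : ℂ)) *
        ofCovector (connDiff nab nab' α γ)) x :=
      FormSmoothAt.sum _ fun γ => (hf γ).mul (connDiff_smooth nab nab'
        ⟨hx, hρ γ ((ρ.mem_fintsupport_iff x γ).mp γ.2)⟩)
    refine h.congr ((ρ.eventually_finsupport_subset x).mono fun y hy => ?_)
    rw [form_sum_apply]
    refine (ofCovector_sum_smul _ _).symm.trans (congrArg (ExteriorAlgebra.ι ℂ) ?_)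
    rw [Finset.sum_coe_sort (ρ.fintsupport x)
      (fun γ => (ρ γ y : ℂ) • connDiff nab nab' α γ y)]
    refine (Finset.sum_subset hy fun γ _ hγ => ?_).symm
    have h0 : ρ γ y = 0 := by
      by_contra h0
      exact hγ ((ρ.mem_finsupport y).mpr h0)
    rw [h0, Complex.ofReal_zero, zero_smul]
  · intro α β V hV s hs x hx v
    rw [D_eq_add_connDiff nab nab' hV hs hx, ← hsub x α β (hV hx), LinearMap.sub_apply]

theorem exists_isComparison [T2Space M] [SecondCountableTopology M] (nab nab' : GerbeConnection G) :
    ∃ η, IsComparison nab nab' η := by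
  obtain ⟨δ, hδ⟩ := exists_isConnDiff nab nab'
  refine ⟨fun x => (2 * Real.pi * Complex.I : ℂ)⁻¹ • (nab'.omega (G.idx x) x -
    nab.omega (G.idx x) x - dForm (ofCovector (δ (G.idx x))) x), δ, hδ.1, hδ.2, fun α x hx => ?_⟩
  exact congrArg _ (hδ.omega_sub_eq ⟨(G.cover x).choose_spec, hx⟩)

/-- The local formula for a comparison form. -/
def IsCompForm (nab nab' : GerbeConnection G) (δ : ι → ∀ x : M, Cotangent E x)
    (η : Form E M) : Prop :=
  ∀ α, ∀ x ∈ G.U α, η x = (2 * Real.pi * Complex.I : ℂ)⁻¹ •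
    (nab'.omega α x - nab.omega α x - dForm (ofCovector (δ α)) x)

section

variable {nab nab' : GerbeConnection G} {δ δ₂ : ι → ∀ x : M, Cotangent E x} {η η₂ : Form E M}

theorem IsCompForm.near (hη : IsCompForm nab nab' δ η) {α : ι} {x : M} (hx : x ∈ G.U α) :
    ∀ᶠ y in 𝓝 x, ((2 * Real.pi * Complex.I : ℂ)⁻¹ •
      (nab'.omega α - nab.omega α - dForm (ofCovector (δ α)))) y = η y :=
  Filter.mem_of_superset ((G.U α).isOpen.mem_nhds hx) fun y hy => (hη α y hy).symm

theorem IsCompForm.smooth (hδ : IsConnDiff nab nab' δ) (hη : IsCompForm nab nab' δ η) :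
    FormSmoothOn η Set.univ := fun x _ => by
  obtain ⟨α, hα⟩ := G.cover x
  exact FormSmoothAt.congr ((((nab'.omega_smooth α x hα).sub (nab.omega_smooth α x hα)).sub
    (FormSmoothAt.dForm (hδ.near hα))).smul _) (hη.near hα)

theorem IsCompForm.degree (hδ : IsConnDiff nab nab' δ) (hη : IsCompForm nab nab' δ η) :
    IsHomogeneousOn 2 η Set.univ := fun x _ => by
  obtain ⟨α, hα⟩ := G.cover x
  rw [hη α x hα]
  exact Submodule.smul_mem _ _ (sub_mem (sub_mem (nab'.omega_degree α x hα)
    (nab.omega_degree α x hα)) (dForm_mem (hδ.1 α x hα)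
      (Filter.Eventually.of_forall fun y => ι_mem_exteriorPower _)))

/-- Differentiate the local formula for `η`; the contribution of `δ_α` dies by `d² = 0`. -/
theorem IsCompForm.curv3_eq (hδ : IsConnDiff nab nab' δ) (hη : IsCompForm nab nab' δ η) :
    nab'.curv3 = nab.curv3 + dForm η := by
  funext x
  obtain ⟨α, hα⟩ := G.cover x
  have h1 := nab'.omega_smooth α x hα
  have h2 := nab.omega_smooth α x hα
  have h3 := FormSmoothAt.dForm (hδ.near hα)
  have h4 := dForm_dForm (hδ.near hα)
  rw [Form.add_apply, nab'.curv3_eq hα, nab.curv3_eq hα, ← dForm_congr (hη.near hα),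
    dForm_smul _ ((h1.sub h2).sub h3), dForm_sub (h1.sub h2) h3, dForm_sub h1 h2,
    GerbeConnection.localCurv3, GerbeConnection.localCurv3, Form.smul_apply, Form.smul_apply,
    ← smul_add]
  refine congrArg _ ?_
  rw [h4]
  abel

/-- Two comparison forms differ by the differential of a global 1-form. -/
theorem IsCompForm.exists_eq_add (hδ : IsConnDiff nab nab' δ) (hη : IsCompForm nab nab' δ η)
    (hδ₂ : IsConnDiff nab nab' δ₂) (hη₂ : IsCompForm nab nab' δ₂ η₂) :
    ∃ τ : Form E M, FormSmoothOn τ Set.univ ∧ IsHomogeneousOn 1 τ Set.univ ∧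
      η₂ = η + dForm τ := by
  -- The sign is that of `dδ_α` in the formula for `η`.
  set c : ℂ := -(2 * Real.pi * Complex.I : ℂ)⁻¹ with hc
  set τ : Form E M := ofCovector fun x => c • (δ₂ (G.idx x) x - δ (G.idx x) x) with hτ
  have hτα : ∀ α x, x ∈ G.U α → (c • (ofCovector (δ₂ α) - ofCovector (δ α))) x = τ x :=
    fun α x hx => by
      have hi : x ∈ G.U (G.idx x) ⊓ G.U α := ⟨(G.cover x).choose_spec, hx⟩
      -- Both families have the same differences on overlaps, so `δ₂ - δ` does not depend on the
      -- index.
      have h1 := (hδ.sub_eq hi).trans (hδ₂.sub_eq hi).symm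
      have h2 : δ₂ (G.idx x) x - δ (G.idx x) x = δ₂ α x - δ α x := by
        rw [sub_eq_sub_iff_add_eq_add] at h1 ⊢
        rw [← h1, add_comm]
      rw [hτ, ← ofCovector_sub, ← ofCovector_smul, ofCovector, ofCovector, h2]
  have hnear : ∀ α x, x ∈ G.U α → ∀ᶠ y in 𝓝 x,
      (c • (ofCovector (δ₂ α) - ofCovector (δ α))) y = τ y := fun α x hx =>
    Filter.mem_of_superset ((G.U α).isOpen.mem_nhds hx) fun y hy => hτα α y hy
  refine ⟨τ, fun x _ => ?_, fun x _ => ι_mem_exteriorPower _, funext fun x => ?_⟩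
  · obtain ⟨α, hα⟩ := G.cover x
    exact (((hδ₂.1 α x hα).sub (hδ.1 α x hα)).smul c).congr (hnear α x hα)
  · obtain ⟨α, hα⟩ := G.cover x
    rw [Form.add_apply, ← dForm_congr (hnear α x hα),
      dForm_smul _ ((hδ₂.1 α x hα).sub (hδ.1 α x hα)), dForm_sub (hδ₂.1 α x hα) (hδ.1 α x hα),
      hη α x hα, hη₂ α x hα, hc, neg_smul, ← sub_eq_add_neg, ← smul_sub]
    refine congrArg _ ?_
    abel

end

end Comparison

/-! ### Degrees of transgression forms. -/

section PolyGrade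

variable {V : Type*} [AddCommGroup V] [Module ℂ V]

variable (V) in
/-- The polynomials with coefficients of degree `k`. -/
def polyGrade (k : ℕ) : Submodule ℂ (ExteriorAlgebra ℂ V)[X] where
  carrier := {f | ∀ i, f.coeff i ∈ ⋀[ℂ]^k V}
  add_mem' hf hg i := by
    rw [coeff_add]
    exact add_mem (hf i) (hg i)
  zero_mem' i := by
    rw [coeff_zero]
    exact zero_mem _
  smul_mem' c f hf i := by
    rw [coeff_smul]
    exact Submodule.smul_mem _ _ (hf i)

theorem mul_mem_polyGrade {j k : ℕ} {f g : (ExteriorAlgebra ℂ V)[X]} (hf : f ∈ polyGrade V j)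
    (hg : g ∈ polyGrade V k) : f * g ∈ polyGrade V (j + k) := fun i => by
  rw [coeff_mul]
  exact sum_mem fun x _ => mul_mem_exteriorPower (hf x.1) (hg x.2)

theorem C_mem_polyGrade {k : ℕ} {a : ExteriorAlgebra ℂ V} (ha : a ∈ ⋀[ℂ]^k V) :
    C a ∈ polyGrade V k := fun i => by
  rw [coeff_C]
  split_ifs
  · exact ha
  · exact zero_mem _

theorem X_mem_polyGrade : (X : (ExteriorAlgebra ℂ V)[X]) ∈ polyGrade V 0 := fun i => by
  rw [coeff_X]
  split_ifs
  · exact one_mem_exteriorPower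
  · exact zero_mem _

theorem integral01_mem {k : ℕ} {f : (ExteriorAlgebra ℂ V)[X]} (hf : f ∈ polyGrade V k) :
    integral01 _ f ∈ ⋀[ℂ]^k V := by
  rw [integral01, Polynomial.lsum_apply]
  exact sum_mem fun i _ => Submodule.smul_mem _ _ (hf i)

/-- The path parameter has degree zero and `B` has degree one. The degree is needed to see that
truncating the transgression polynomial at `dim M` is harmless. -/
theorem transgress_mem_exteriorPower {n : Type*} [Fintype n] [DecidableEq n]
    {B T₀ T₁ : Matrix n n (ExteriorAlgebra ℂ V)} (hB : ∀ i j, B i j ∈ ⋀[ℂ]^1 V)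
    (h₀ : ∀ i j, T₀ i j ∈ ⋀[ℂ]^2 V) (h₁ : ∀ i j, T₁ i j ∈ ⋀[ℂ]^2 V) (c : ℂ) (k : ℕ) :
    transgress c B T₀ T₁ k ∈ ⋀[ℂ]^(1 + 2 * k) V := by
  have hBB : ∀ i j, (B * B) i j ∈ ⋀[ℂ]^2 V :=
    matrix_mul_mem (S := fun k => ⋀[ℂ]^k V) mul_mem_exteriorPower hB hB
  have hC : ∀ i j, curvPath B T₀ T₁ i j ∈ polyGrade V 2 := fun i j => by
    rw [curvPath, Matrix.add_apply, Matrix.add_apply, Matrix.scalar_apply, Matrix.scalar_apply,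
      Matrix.diagonal_mul, Matrix.diagonal_mul]
    refine add_mem (add_mem (C_mem_polyGrade (h₀ i j)) ?_) ?_
    · have := mul_mem_polyGrade X_mem_polyGrade
        (C_mem_polyGrade (sub_mem (sub_mem (h₁ i j) (h₀ i j)) (hBB i j)))
      rwa [zero_add] at this
    · have := mul_mem_polyGrade (mul_mem_polyGrade X_mem_polyGrade X_mem_polyGrade)
        (C_mem_polyGrade (hBB i j))
      rwa [zero_add, zero_add] at this
  exact Submodule.smul_mem _ _ (integral01_mem (sum_mem fun i _ =>
    matrix_mul_mem (S := polyGrade V) mul_mem_polyGrade (fun i j => C_mem_polyGrade (hB i j))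
      (matrix_pow_mem (S := polyGrade V) (C_mem_polyGrade one_mem_exteriorPower)
        mul_mem_polyGrade hC k) i i))

end PolyGrade

/-! ### Comparison of the Chern characters of two connections. -/

section Transgression

variable {E : Type uE} [NormedAddCommGroup E] [NormedSpace ℝ E] [FiniteDimensional ℝ E]
  {M : Type uM} [TopologicalSpace M] [ChartedSpace E M] [IsManifold 𝓘(ℝ, E) ∞ M]
  {ι : Type uI} {G : GerbeDatum.{uE, uM, uV, uI} E M ι} {T : TwistedBundle G}
  (nab nab' : TwistedConnection T) (δ : ι → ∀ x : M, Cotangent E x)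

/-- The matrix of `∇_α` in a local frame. -/
def TwistedConnection.connMat (nab : TwistedConnection T) (α : ι) (p : M) :
    Matrix (Fin ((T.bundle α).rank p)) (Fin ((T.bundle α).rank p)) (Form E M) :=
  (nab.nab α).matrix p

theorem TwistedConnection.connMat_near (nab : TwistedConnection T) {α : ι} {p x : M}
    (hp : x ∈ (T.bundle α).dom p) : MSmoothNear x (nab.connMat α p) :=
  (nab.nab α).matrix_smoothNear hp

theorem TwistedConnection.connMat_one (nab : TwistedConnection T) (α : ι) (p x : M) :
    MOneNear x (nab.connMat α p) :=
  (nab.nab α).matrix_oneNear p x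

/-- The entries of `∇'_α - ∇_α + δ_α` in a local frame, as covectors. -/
def diffCov (α : ι) (p : M) (i j : Fin ((T.bundle α).rank p)) (y : M) : Cotangent E y :=
  (nab'.nab α).coeff p i j y - (nab.nab α).coeff p i j y + if i = j then δ α y else 0

/-- The matrix of `∇'_α - ∇_α + δ_α` in a local frame. -/
def diffMat (α : ι) (p : M) :
    Matrix (Fin ((T.bundle α).rank p)) (Fin ((T.bundle α).rank p)) (Form E M) :=
  fun i j => ofCovector (diffCov nab nab' δ α p i j)

/-- The curvature of `∇_α + B` shifted by `ω_α`, where `B` is the difference of the connections. -/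
def endMatTheta (α : ι) (p : M) :
    Matrix (Fin ((T.bundle α).rank p)) (Fin ((T.bundle α).rank p)) (Form E M) :=
  thetaMatrix (nab.connMat α p + diffMat nab nab' δ α p) (nab.omega α)

/-- Identifies the end of the path: it is `∇'_α` shifted by the scalar 1-form `δ_α`. -/
theorem matrix_add_diffMat (α : ι) (p : M) :
    nab.connMat α p + diffMat nab nab' δ α p =
      nab'.connMat α p + Matrix.scalar _ (ofCovector (δ α)) := by
  ext i j
  funext y
  have h : (nab.nab α).coeff p i j y + diffCov nab nab' δ α p i j y =
      (nab'.nab α).coeff p i j y + if i = j then δ α y else 0 := by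
    rw [diffCov]
    abel
  have h2 := congrArg (ExteriorAlgebra.ι ℂ) h
  rw [map_add, map_add] at h2
  refine h2.trans (congrArg (_ + ·) ?_)
  rw [Matrix.scalar_apply, Matrix.diagonal_apply]
  split_ifs
  · rfl
  · exact map_zero _

variable {nab nab' δ} {η : Form E M}

theorem diffMat_near (hδ : IsConnDiff nab.toGerbeConnection nab'.toGerbeConnection δ)
    {α : ι} {p x : M} (hp : x ∈ (T.bundle α).dom p) :
    MSmoothNear x (diffMat nab nab' δ α p) := fun i j => by
  have h1 := nab.connMat_near hp i j
  have h2 := ((nab'.connMat_near hp).add (MSmoothNear.scalar (n := Fin ((T.bundle α).rank p))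
    (hδ.near ((T.bundle α).dom_le p hp)))) i j
  rw [← matrix_add_diffMat nab nab'] at h2
  have h3 := sub_mem h2 h1
  rwa [Matrix.add_apply, add_sub_cancel_left] at h3

theorem diffMat_one (α : ι) (p x : M) : MOneNear x (diffMat nab nab' δ α p) := fun _ _ =>
  Filter.Eventually.of_forall fun _ => ι_mem_exteriorPower _

/-- Subtracting the gauge relations of the two connections removes the inhomogeneous term `dg`. What
remains is the change `δ_α - δ_β` of the connection form of `L_αβ`, which the added `δ` absorbs. -/
theorem diffMat_conj (hδ : IsConnDiff nab.toGerbeConnection nab'.toGerbeConnection δ)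
    {α β : ι} {x p p' : M} (hx : x ∈ (G.L α β).dom x) (i : Fin ((G.L α β).rank x))
    (hp : x ∈ (T.bundle α).dom p) (hp' : x ∈ (T.bundle β).dom p') :
    (diffMat nab nab' δ β p').map (evalForm E x) *
        ((transMatrix (T.trans ((G.L α β).frame x i)) p' p).map fun f => f x).map
          (algebraMap ℂ (ExteriorAlgebra ℂ (Cotangent E x))) =
      ((transMatrix (T.trans ((G.L α β).frame x i)) p' p).map fun f => f x).map
          (algebraMap ℂ (ExteriorAlgebra ℂ (Cotangent E x))) *
        (diffMat nab nab' δ α p).map (evalForm E x) := by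
  ext a b
  set g := transMatrix (T.trans ((G.L α β).frame x i)) p' p with hg
  have h1 := gauge_relation (nab.intertwines x i) ⟨⟨hx, hp⟩, hp'⟩ a b
  have h2 := gauge_relation (nab'.intertwines x i) ⟨⟨hx, hp⟩, hp'⟩ a b
  rw [hδ.coeff_eq hx i] at h2
  rw [← hg] at h1 h2
  have key : ∑ k, g k b x • diffCov nab nab' δ β p' a k x =
      ∑ k, g a k x • diffCov nab nab' δ α p k b x := by
    simp only [diffCov, smul_add, smul_sub, Finset.sum_add_distrib, Finset.sum_sub_distrib,
      smul_ite, smul_zero, Finset.sum_ite_eq, Finset.sum_ite_eq', Finset.mem_univ, if_true]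
    have h3 := congrArg₂ (· - ·) h2 h1
    simp only [smul_add, smul_sub] at h3
    rw [add_sub_add_right_eq_sub] at h3
    rw [h3]
    abel
  have h4 := congrArg (ExteriorAlgebra.ι ℂ) key
  rw [ofCovector_sum_smul, ofCovector_sum_smul] at h4
  rw [Matrix.mul_apply, Matrix.mul_apply]
  refine Eq.trans (Finset.sum_congr rfl fun k _ => ?_) h4
  exact (Algebra.commutes (g k b x) (ExteriorAlgebra.ι ℂ (diffCov nab nab' δ β p' a k x))).symm

theorem two_pi_I_ne_zero : (2 * Real.pi * Complex.I : ℂ) ≠ 0 := Complex.two_pi_I_ne_zero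

/-- The curvature of `∇'_α + δ_α`, shifted by `ω_α` instead of `ω'_α`, is `θ' - (ω'_α - ω_α -
dδ_α)`, and the bracket is `2πi η`. -/
theorem endMatTheta_map (hδ : IsConnDiff nab.toGerbeConnection nab'.toGerbeConnection δ)
    (hη : IsCompForm nab.toGerbeConnection nab'.toGerbeConnection δ η) {α : ι} {p x : M}
    (hp : x ∈ (T.bundle α).dom p) :
    (endMatTheta nab nab' δ α p).map (evalForm E x) =
      (nab'.thetaMat α p).map (evalForm E x) +
        Matrix.scalar _ (-((2 * Real.pi * Complex.I : ℂ) • η x)) := by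
  have hα := (T.bundle α).dom_le p hp
  rw [endMatTheta, matrix_add_diffMat]
  refine thetaMatrix_add_scalar (e := -((2 * Real.pi * Complex.I : ℂ) • η))
    (nab'.connMat_near hp) (nab'.connMat_one α p x) (hδ.near hα)
    (Filter.Eventually.of_forall fun _ => ι_mem_exteriorPower _) ?_
  have h : (-((2 * Real.pi * Complex.I : ℂ) • η) : Form E M) x =
      -((2 * Real.pi * Complex.I : ℂ) • η x) := rfl
  rw [h, hη α x hα, smul_inv_smul₀ two_pi_I_ne_zero]
  abel

theorem endMatTheta_conj (hδ : IsConnDiff nab.toGerbeConnection nab'.toGerbeConnection δ)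
    (hη : IsCompForm nab.toGerbeConnection nab'.toGerbeConnection δ η)
    {α β : ι} {x p p' : M} (hx : x ∈ (G.L α β).dom x) (i : Fin ((G.L α β).rank x))
    (hp : x ∈ (T.bundle α).dom p) (hp' : x ∈ (T.bundle β).dom p') :
    (endMatTheta nab nab' δ β p').map (evalForm E x) *
        ((transMatrix (T.trans ((G.L α β).frame x i)) p' p).map fun f => f x).map
          (algebraMap ℂ (ExteriorAlgebra ℂ (Cotangent E x))) =
      ((transMatrix (T.trans ((G.L α β).frame x i)) p' p).map fun f => f x).map
          (algebraMap ℂ (ExteriorAlgebra ℂ (Cotangent E x))) *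
        (endMatTheta nab nab' δ α p).map (evalForm E x) := by
  rw [endMatTheta_map hδ hη hp, endMatTheta_map hδ hη hp', Matrix.add_mul, Matrix.mul_add,
    nab'.thetaMat_conj hx i hp hp']
  congr 1
  ext a b
  rw [Matrix.scalar_apply, Matrix.scalar_apply, Matrix.diagonal_mul, Matrix.mul_diagonal,
    Matrix.map_apply]
  exact (Algebra.commutes _ _).symm

variable (nab nab' δ) in
/-- The local transgression forms. -/
def localTransgress (α : ι) (p : M) (k : ℕ) : Form E M :=
  transgress chernConst (diffMat nab nab' δ α p) (nab.thetaMat α p) (endMatTheta nab nab' δ α p) k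

theorem localTransgress_eq (hδ : IsConnDiff nab.toGerbeConnection nab'.toGerbeConnection δ)
    (hη : IsCompForm nab.toGerbeConnection nab'.toGerbeConnection δ η)
    {α β : ι} {x p p' : M} (hp : x ∈ (T.bundle α).dom p) (hp' : x ∈ (T.bundle β).dom p') (k : ℕ) :
    localTransgress nab nab' δ β p' k x = localTransgress nab nab' δ α p k x := by
  have hx : x ∈ (G.L α β).dom x :=
    (G.L α β).mem_dom x ⟨(T.bundle α).dom_le p hp, (T.bundle β).dom_le p' hp'⟩
  obtain ⟨h, hgh, hhg⟩ := transMatrix_inverse hp hp' (T.trans_bijective hx (G.lineIdx hx))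
  rw [localTransgress, localTransgress, transgress_apply, transgress_apply]
  exact transgress_conj _ hgh hhg (diffMat_conj hδ hx _ hp hp') (nab.thetaMat_conj hx _ hp hp')
    (endMatTheta_conj hδ hη hx _ hp hp') k

theorem endMatTheta_near (hδ : IsConnDiff nab.toGerbeConnection nab'.toGerbeConnection δ)
    {α : ι} {p x : M} (hp : x ∈ (T.bundle α).dom p) :
    MSmoothNear x (endMatTheta nab nab' δ α p) :=
  ((nab.connMat_near hp).add (diffMat_near hδ hp)).theta
    (nab.omega_near ((T.bundle α).dom_le p hp))

theorem localTransgress_mem (hδ : IsConnDiff nab.toGerbeConnection nab'.toGerbeConnection δ)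
    {α : ι} {p x : M} (hp : x ∈ (T.bundle α).dom p) (k : ℕ) :
    localTransgress nab nab' δ α p k x ∈ ⋀[ℂ]^(1 + 2 * k) (Cotangent E x) := by
  have hα := (T.bundle α).dom_le p hp
  have hA := nab.connMat_near hp
  have hA1 := nab.connMat_one α p x
  rw [localTransgress, transgress_apply]
  exact transgress_mem_exteriorPower (fun i j => ι_mem_exteriorPower _)
    (thetaMatrix_mem hA hA1 (nab.omega_degree α x hα))
    (thetaMatrix_mem (hA.add (diffMat_near hδ hp)) (hA1.add (diffMat_one α p x))
      (nab.omega_degree α x hα)) _ k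

variable (nab nab' δ) in
/-- The transgression of the Chern character. -/
def transgressPoly : (Form E M)[X] :=
  ∑ k ∈ Finset.range (Module.finrank ℝ E + 1),
    monomial k fun x => localTransgress nab nab' δ (G.idx x) x k x

theorem coeff_transgressPoly (hδ : IsConnDiff nab.toGerbeConnection nab'.toGerbeConnection δ)
    (hη : IsCompForm nab.toGerbeConnection nab'.toGerbeConnection δ η)
    {α : ι} {p x : M} (hp : x ∈ (T.bundle α).dom p) (k : ℕ) :
    (transgressPoly nab nab' δ).coeff k x = localTransgress nab nab' δ α p k x := by
  have h : (transgressPoly nab nab' δ).coeff k = if k < Module.finrank ℝ E + 1 then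
      (fun x => localTransgress nab nab' δ (G.idx x) x k x) else 0 := by
    rw [transgressPoly, Polynomial.finsetSum_coeff]
    refine (Finset.sum_congr rfl fun j _ => Polynomial.coeff_monomial).trans
      ((Finset.sum_ite_eq' _ k _).trans ?_)
    exact if_congr Finset.mem_range rfl rfl
  rw [h]
  split_ifs with hk
  · exact localTransgress_eq hδ hη hp ((T.bundle _).mem_dom x (G.cover x).choose_spec) k
  · exact (form_eq_zero_of_mem (by lia) (localTransgress_mem hδ hp k)).symm

theorem coeff_transgressPoly_near
    (hδ : IsConnDiff nab.toGerbeConnection nab'.toGerbeConnection δ)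
    (hη : IsCompForm nab.toGerbeConnection nab'.toGerbeConnection δ η)
    {α : ι} {p x : M} (hp : x ∈ (T.bundle α).dom p) (k : ℕ) :
    ∀ᶠ y in 𝓝 x, localTransgress nab nab' δ α p k y = (transgressPoly nab nab' δ).coeff k y :=
  Filter.mem_of_superset (((T.bundle α).dom p).isOpen.mem_nhds hp) fun _ hy =>
    (coeff_transgressPoly hδ hη hy k).symm

theorem transgressPoly_smooth (hδ : IsConnDiff nab.toGerbeConnection nab'.toGerbeConnection δ)
    (hη : IsCompForm nab.toGerbeConnection nab'.toGerbeConnection δ η) :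
    transgressPoly nab nab' δ ∈ smoothPoly E M := fun k x _ => by
  obtain ⟨α, hα⟩ := G.cover x
  have hp := (T.bundle α).mem_dom x hα
  exact FormSmoothAt.congr (transgress_mem_smoothNear (diffMat_near hδ hp) (nab.thetaMat_near hp)
    (endMatTheta_near hδ hp) chernConst k).self_of_nhds (coeff_transgressPoly_near hδ hη hp k)

/-- Both ends of the path share the same `ω_α`, so the `dω_α` term of the transgression formula is
cancelled by `Ω`, leaving the difference of the Chern forms of the ends. -/
theorem coeff_chern_add_dTwist
    (hδ : IsConnDiff nab.toGerbeConnection nab'.toGerbeConnection δ)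
    (hη : IsCompForm nab.toGerbeConnection nab'.toGerbeConnection δ η)
    {α : ι} {x : M} (hα : x ∈ G.U α) (k : ℕ) :
    (nab.chern + dTwist nab.curv3 (transgressPoly nab nab' δ)).coeff k x =
      chernTr chernConst (endMatTheta nab nab' δ α x) k x := by
  have hp := (T.bundle α).mem_dom x hα
  have hA := nab.connMat_near hp
  have hA1 := nab.connMat_one α x x
  have hB := diffMat_near hδ hp
  have hB1 := diffMat_one (nab := nab) (nab' := nab') (δ := δ) α x x
  have hw := nab.omega_near hα
  have hw2 := nab.omega_even hα
  rw [coeff_add, Form.add_apply, nab.coeff_chern hp]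
  match k with
  | 0 =>
    rw [coeff_dTwist_zero, Form.zero_apply, add_zero, chernTr, chernTr, pow_zero, pow_zero, pow_zero]
  | 1 =>
    rw [coeff_dTwist_one, ← dForm_congr (coeff_transgressPoly_near hδ hη hp 0)]
    have h := dForm_transgress_zero hA hA1 hB hB1 hw hw2 chernConst
    exact (congrArg (_ + ·) h).trans (add_sub_cancel _ _)
  | k + 2 =>
    rw [coeff_dTwist_add_two, Form.add_apply, Form.mul_apply,
      ← dForm_congr (coeff_transgressPoly_near hδ hη hp (k + 1)), coeff_transgressPoly hδ hη hp,
      nab.curv3_eq hα, GerbeConnection.localCurv3, Form.smul_apply]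
    have h := dForm_transgress_succ hA hA1 hB hB1 hw hw2 chernConst k
    refine (congrArg (fun t => _ + (t + _)) h).trans ?_
    have h2 : (2 * Real.pi * Complex.I : ℂ)⁻¹ = -chernConst := (neg_neg _).symm
    rw [h2, smul_mul_assoc, neg_smul]
    exact (by
      intro a b c
      abel : ∀ a b c : ExteriorAlgebra ℂ (Cotangent E x), a + (b - a + c + -c) = b) _ _ _

theorem coeff_expU {η : Form E M} (h2 : IsHomogeneousOn 2 η Set.univ) (k : ℕ) :
    (expU (-η)).coeff k = (k.factorial : ℂ)⁻¹ • (-η) ^ k := by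
  refine coeff_expP (N := Module.finrank ℝ E + 1) ?_ k
  rw [neg_pow, pow_eq_zero_of_homogeneous h2, mul_zero]

/-- The Chern characters of two connections correspond up to an exact form. -/
theorem chern_eq_twistMap (hδ : IsConnDiff nab.toGerbeConnection nab'.toGerbeConnection δ)
    (hη : IsCompForm nab.toGerbeConnection nab'.toGerbeConnection δ η) :
    nab'.chern = twistMap η (nab.chern + dTwist nab.curv3 (transgressPoly nab nab' δ)) := by
  ext k : 1
  funext x
  obtain ⟨α, hα⟩ := G.cover x
  have hp := (T.bundle α).mem_dom x hα
  have h2 := IsCompForm.degree hδ hη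
  have he : ∀ r, ((2 * Real.pi * Complex.I : ℂ) • η x) * r =
      r * ((2 * Real.pi * Complex.I : ℂ) • η x) := fun r => by
    have := gradeInv_of_mem (h2 x trivial)
    rw [even_two.neg_one_pow, one_mul] at this
    rw [smul_mul_assoc, mul_smul_comm, (commute_of_gradeInv_eq this r)]
  have hc : chernConst • ((2 * Real.pi * Complex.I : ℂ) • η x) = -η x := by
    rw [smul_smul, chernConst, neg_mul, inv_mul_cancel₀ two_pi_I_ne_zero, neg_one_smul]
  -- Solve for `θ'`: it is the end of the path plus the central scalar `2πi η`, which `chernConst`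
  -- turns into `-η` in the exponent.
  have hT : (nab'.thetaMat α x).map (evalForm E x) =
      (endMatTheta nab nab' δ α x).map (evalForm E x) +
        Matrix.scalar _ ((2 * Real.pi * Complex.I : ℂ) • η x) := by
    rw [endMatTheta_map hδ hη hp, map_neg, neg_add_cancel_right]
  rw [nab'.coeff_chern hp, chernTr_apply, hT, chernTr_add_scalar _ _ he, hc, twistMap, coeff_mul]
  refine Eq.trans ?_ (form_sum_apply _ _ x).symm
  refine Finset.sum_congr rfl fun y _ => ?_
  rw [Form.mul_apply, coeff_chern_add_dTwist hδ hη hα, chernTr_apply, coeff_expU h2,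
    Form.smul_apply, form_pow_apply]
  rfl

end Transgression

/-! ### The canonical isomorphism. -/

section Canonical

variable {E : Type uE} [NormedAddCommGroup E] [NormedSpace ℝ E] [FiniteDimensional ℝ E]
  {M : Type uM} [TopologicalSpace M] [ChartedSpace E M] [IsManifold 𝓘(ℝ, E) ∞ M]
  {ι : Type uI} {G : GerbeDatum.{uE, uM, uV, uI} E M ι} {T : TwistedBundle G}

theorem TwistedConnection.chern_mem_twCocycles (nab : TwistedConnection T) :
    nab.chern ∈ twCocycles nab.curv3 :=
  mem_twCocycles.mpr ⟨nab.chern_smooth, nab.dTwist_chern⟩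

/-- The canonical isomorphism of twisted cohomologies, which maps Chern character to Chern
character. -/
theorem exists_canonical_equiv [T2Space M] [SecondCountableTopology M]
    (nab nab' : TwistedConnection T) :
    ∃ I : TwCohomology nab.curv3 ≃ₗ[ℂ] TwCohomology nab'.curv3,
      (∃ η, IsComparison nab.toGerbeConnection nab'.toGerbeConnection η) ∧
      (∀ η, IsComparison nab.toGerbeConnection nab'.toGerbeConnection η →
        FormSmoothOn η Set.univ ∧ IsHomogeneousOn 2 η Set.univ ∧
        nab'.curv3 = nab.curv3 + dForm η ∧
        ∀ ξ, ∀ h : ξ ∈ twCocycles nab.curv3,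
          ∃ h' : twistMap η ξ ∈ twCocycles nab'.curv3,
            I (twClass nab.curv3 ξ h) = twClass nab'.curv3 (twistMap η ξ) h') ∧
      ∃ (h : nab.chern ∈ twCocycles nab.curv3) (h' : nab'.chern ∈ twCocycles nab'.curv3),
        I (twClass nab.curv3 nab.chern h) = twClass nab'.curv3 nab'.chern h' := by
  obtain ⟨η, hcomp⟩ := exists_isComparison nab.toGerbeConnection nab'.toGerbeConnection
  obtain ⟨δ, hδ₁, hδ₂, hη⟩ := id hcomp
  have hδ : IsConnDiff nab.toGerbeConnection nab'.toGerbeConnection δ := ⟨hδ₁, hδ₂⟩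
  replace hη : IsCompForm nab.toGerbeConnection nab'.toGerbeConnection δ η := hη
  have hO := nab.curv3_smooth
  have hs := hη.smooth hδ
  have h2 := hη.degree hδ
  have h3 := hη.curv3_eq hδ
  refine ⟨LinearEquiv.ofBijective (twistCohomology hO hs h2 h3)
    (twistCohomology_bijective hO hs h2 h3), ⟨η, hcomp⟩, fun ζ hζ => ?_,
    nab.chern_mem_twCocycles, nab'.chern_mem_twCocycles, ?_⟩
  · obtain ⟨ε, hε₁, hε₂, hζ⟩ := hζ
    have hε : IsConnDiff nab.toGerbeConnection nab'.toGerbeConnection ε := ⟨hε₁, hε₂⟩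
    replace hζ : IsCompForm nab.toGerbeConnection nab'.toGerbeConnection ε ζ := hζ
    refine ⟨hζ.smooth hε, hζ.degree hε, hζ.curv3_eq hε, fun ξ hξ => ?_⟩
    refine ⟨twistMap_mem_twCocycles hO (hζ.smooth hε) (hζ.degree hε) (hζ.curv3_eq hε) hξ, ?_⟩
    rw [LinearEquiv.ofBijective_apply, twistCohomology_twClass, twClass_eq_iff]
    -- The isomorphism was built from one `η`; any other comparison form is `η + dτ` and gives the
    -- same map on classes.
    obtain ⟨τ, hτ, hτ1, rfl⟩ := hη.exists_eq_add hδ hε hζ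
    have h := twistMap_sub_mem hO nab.curv3_degree hs h2 hτ hτ1 hξ
    rw [← h3] at h
    rw [← neg_sub]
    exact neg_mem h
  · rw [LinearEquiv.ofBijective_apply, twistCohomology_twClass, twClass_eq_iff,
      chern_eq_twistMap hδ hη]
    -- The correction in `chern_eq_twistMap` is a coboundary for `Ω`, and `exp(-uη)` maps it to one
    -- for `Ω'`.
    have h := twistMap_mem_twCoboundaries hO hs h2 h3
      (mem_twCoboundaries.mpr ⟨_, transgressPoly_smooth hδ hη, rfl⟩)
    have h4 : twistMap η (nab.chern + dTwist nab.curv3 (transgressPoly nab nab' δ)) =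
        twistMap η nab.chern + twistMap η (dTwist nab.curv3 (transgressPoly nab nab' δ)) :=
      mul_add _ _ _
    rw [h4, sub_add_cancel_left]
    exact neg_mem h

end Canonical

end TwGerbe

end

theorem mainTheorem4 {E : Type*} [NormedAddCommGroup E] [NormedSpace ℝ E] [FiniteDimensional ℝ E]
    {M : Type*} [TopologicalSpace M] [ChartedSpace E M] [IsManifold 𝓘(ℝ, E) ∞ M]
    [T2Space M] [SecondCountableTopology M]
    {ι : Type*} {G : TwGerbe.GerbeDatum E M ι} (T : TwGerbe.TwistedBundle G) :
    -- the forms `Ω` and `Ch(∇)` are well defined, and `Ch(∇)` is closed for `d_Ω`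
    (∀ nabla : TwGerbe.TwistedConnection T,
      (TwGerbe.FormSmoothOn nabla.curv3 Set.univ ∧ TwGerbe.IsHomogeneousOn 3 nabla.curv3 Set.univ ∧
        TwGerbe.dForm nabla.curv3 = 0 ∧
        ∀ α, ∀ x ∈ G.U α, nabla.curv3 x = nabla.localCurv3 α x) ∧
      TwGerbe.twCoboundaries nabla.curv3 ≤ TwGerbe.twCocycles nabla.curv3 ∧
      nabla.chern ∈ TwGerbe.smoothPoly E M ∧
      (∀ α, ∀ x ∈ G.U α, ∀ k, nabla.chern.coeff k x = nabla.localChern α k x) ∧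
      TwGerbe.dTwist nabla.curv3 nabla.chern = 0) ∧
    -- the canonical isomorphism `I`, given by `I_η` for all admissible `η`, maps `[Ch(∇)]` to
    -- `[Ch(∇')]`
    ∀ nabla nabla' : TwGerbe.TwistedConnection T,
      ∃ I : TwGerbe.TwCohomology nabla.curv3 ≃ₗ[ℂ] TwGerbe.TwCohomology nabla'.curv3,
        (∃ η, TwGerbe.IsComparison nabla.toGerbeConnection nabla'.toGerbeConnection η) ∧
        (∀ η, TwGerbe.IsComparison nabla.toGerbeConnection nabla'.toGerbeConnection η →
          TwGerbe.FormSmoothOn η Set.univ ∧ TwGerbe.IsHomogeneousOn 2 η Set.univ ∧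
          nabla'.curv3 = nabla.curv3 + TwGerbe.dForm η ∧
          ∀ ξ, ∀ h : ξ ∈ TwGerbe.twCocycles nabla.curv3,
            ∃ h' : TwGerbe.twistMap η ξ ∈ TwGerbe.twCocycles nabla'.curv3,
              I (TwGerbe.twClass nabla.curv3 ξ h) =
                TwGerbe.twClass nabla'.curv3 (TwGerbe.twistMap η ξ) h') ∧
        ∃ (h : nabla.chern ∈ TwGerbe.twCocycles nabla.curv3)
          (h' : nabla'.chern ∈ TwGerbe.twCocycles nabla'.curv3),
          I (TwGerbe.twClass nabla.curv3 nabla.chern h) =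
            TwGerbe.twClass nabla'.curv3 nabla'.chern h' := by
  refine ⟨fun nab => ⟨⟨nab.curv3_smooth, nab.curv3_degree, nab.dForm_curv3,
    fun α x hx => nab.curv3_eq hx⟩,
    TwGerbe.twCoboundaries_le_twCocycles nab.curv3_smooth nab.curv3_degree nab.dForm_curv3,
    nab.chern_smooth, fun α x hx k => nab.coeff_chern_eq_localChern hx k, nab.dTwist_chern⟩,
    fun nab nab' => ?_⟩
  exact TwGerbe.exists_canonical_equiv nab nab'
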